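/- **Setting.** Let $G=(V,E)$ be a finite undirected simple graph with $n=|V|$, let $Q$ be a set of $q\ge 2$ spins, and write $N_v^+=\{v\}\cup\{u:\{u,v\}\in E\}$. For every $v\in V$ and $\tau\in Q^{N_v^+}$ let $P_v^\tau$ be a probability distribution on $Q$. In the continuous-time single-site dynamics $(X_t)_{t\ge 0}$ on $Q^V$ specified by $\{P_v^\tau\}$, every site carries an independent rate-1 Poisson clock, and whenever the clock at $v$ rings, the spin of $v$ is replaced by an independent sample from $P_v^\tau$, where $\tau$ is the current configuration on $N_v^+$. Write $d_{\mathrm{TV}}(\mu,\nu)=\frac12\sum_x|\mu(x)-\nu(x)|$, and let $\rho\in\mathbb{R}_{\ge0}^{V\times V}$ be the influence matrix, where $\rho(u,v)$ is the maximum of $d_{\mathrm{TV}}(P_v^{\tau},P_v^{\tau'})$ over all $\tau,\tau'\in Q^{N_v^+}$ that agree everywhere except possibly at $u$. For a constant $C$, consider the condition that $$\|\rho\|_p=\sup_{x\ne0}\frac{\|\rho x\|_p}{\|x\|_p}\le C\quad\text{for some }p\in[1,\infty].\qquad(\ast)$$ In the $\mathsf{CONGEST}(B)$ model on the network $G$,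 nodes have independent private random bits, unlimited memory and unlimited local computation. In each synchronous round every node sends a $B$-bit message to each of its neighbours. All nodes know $V$ and $q$ (and the constants below), and the local input of $v$ consists of its name, $N_v^+$, the distributions $(P_v^\tau)_{\tau\in Q^{N_v^+}}$, its initial spin $X_0(v)$ and the time $T$. In the end each node $v$ outputs a spin $X(v)$. **Theorem.** Let $c_0,c_1>0$ and $C$ be constants. There are constants $K_{\mathrm{msg}}$, depending only on $c_1$, and $K_{\mathrm{rounds}}$, depending only on $c_0,c_1,C$, such that for every finite vertex set $V$ and every $q\ge2$ there are an integer $B\le K_{\mathrm{msg}}\cdot\log n\cdot\log q$ and a $\mathsf{CONGEST}(B)$ algorithm with the following properties for every graph $G$ on $V$, all $\{P_v^\tau\}$ satisfying $(\ast)$, every $X_0\in Q^V$ and every $T$ with $0<T\le n^{c_0}$: 1. The algorithm terminates after at most $K_{\mathrm{rounds}}\cdot(T+\log n)$ rounds of communication. 2. The output $X=(X(v))_{v\in V}$ has a distribution within total variation distance $n^{-c_1}$ of the distribution of the state $X_T$ of the continuous-time single-site dynamics specified by $\{P_v^\tau\}$ and started at $X_0$. -/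

import Mathlib

open MeasureTheory
open scoped ENNReal

noncomputable section

/-- Total variation distance `(1/2) * ∑ x, |μ x - ν x|` of two mass functions on a finite set. -/
def tvDist {Ω : Type*} [Fintype Ω] (μ ν : Ω → ℝ) : ℝ :=
  (1 / 2) * ∑ x, |μ x - ν x|

/-! ### Single-site dynamics -/

/-- The inclusive neighbourhood `N_v⁺ = N_v ∪ {v}`. -/
def inclNbhd {V : Type*} (G : SimpleGraph V) (v : V) : Set V :=
  insert v (G.neighborSet v)

/-- Local update distributions `P_v^τ` over the spins `Fin q`, one for every site `v` and every
configuration `τ` on the inclusive neighbourhood of `v`. -/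
abbrev LocalRule {V : Type*} (G : SimpleGraph V) (q : ℕ) : Type _ :=
  (v : V) → (inclNbhd G v → Fin q) → PMF (Fin q)

/-- Dobrushin's influence matrix: `ρ u v` is the maximum of `d_TV (P_v^τ, P_v^τ')` over all pairs
`τ, τ'` of configurations on `N_v⁺` that agree everywhere except possibly at `u`. -/
def influenceMatrix {V : Type*} {G : SimpleGraph V} {q : ℕ} (P : LocalRule G q) :
    Matrix V V ℝ := fun u v =>
  ⨆ p : {p : (inclNbhd G v → Fin q) × (inclNbhd G v → Fin q) //
      ∀ w : inclNbhd G v, (w : V) ≠ u → p.1 w = p.2 w},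
    tvDist (fun x => (P v p.1.1 x).toReal) (fun x => (P v p.1.2 x).toReal)

/-- The operator norm `sup_{x ≠ 0} ‖M x‖_p / ‖x‖_p` of a real square matrix. -/
def lpOpNorm {V : Type*} [Fintype V] (p : ℝ≥0∞) (M : Matrix V V ℝ) : ℝ :=
  ⨆ x : {x : V → ℝ // x ≠ 0},
    ‖WithLp.toLp p (M.mulVec x.1)‖ / ‖WithLp.toLp p x.1‖

/-- The `ℓ_p`-Dobrushin-type condition with constant `C`: `‖ρ‖_p ≤ C` for some `p ∈ [1, ∞]`. -/
def DobrushinCond {V : Type*} [Fintype V] {G : SimpleGraph V} {q : ℕ} (P : LocalRule G q)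
    (C : ℝ) : Prop :=
  ∃ p : ℝ≥0∞, 1 ≤ p ∧ lpOpNorm p (influenceMatrix P) ≤ C

/-! ### The continuous-time chain, built from independent rate-1 Poisson clocks -/

/-- The sample space of the continuous-time chain. The ring number `i` (counted from `0`) of the
clock at `v` is the pair `(v, i)`. The first component holds the waiting time before each ring;
the second holds, for each ring `(v, i)` and each configuration `τ` on `N_v⁺`, the spin that this
ring writes at `v` if it finds the configuration `τ` on `N_v⁺`. -/
abbrev ChainSpace {V : Type*} (G : SimpleGraph V) (q : ℕ) : Type _ :=
  (V × ℕ → ℝ) × ((e : V × ℕ) → (inclNbhd G e.1 → Fin q) → Fin q)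

instance expOneIsProbabilityMeasure :
    IsProbabilityMeasure (ProbabilityTheory.expMeasure 1) :=
  ProbabilityTheory.isProbabilityMeasure_expMeasure one_pos

/-- All waiting times are exponential of rate `1`, the spin prepared for the ring `(v, i)` and the
configuration `τ` has law `P_v^τ`, and everything is independent. -/
def chainMeasure {V : Type*} {G : SimpleGraph V} {q : ℕ} (P : LocalRule G q) :
    Measure (ChainSpace G q) :=
  (Measure.infinitePi fun _ : V × ℕ => ProbabilityTheory.expMeasure 1).prod
    (Measure.infinitePi fun e : V × ℕ =>
      Measure.infinitePi fun τ : inclNbhd G e.1 → Fin q => (P e.1 τ).toMeasure)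

/-- The time at which the ring `e = (v, i)` occurs: the sum of the waiting times `0, …, i` at `v`. -/
def ringTime {V : Type*} (w : V × ℕ → ℝ) (e : V × ℕ) : ℝ :=
  ∑ j ∈ Finset.range (e.2 + 1), w (e.1, j)

open Classical in
/-- All rings up to time `t` in chronological order. Almost surely there are finitely many of them
and their times are distinct; on the remaining null event the value is immaterial. -/
def ringsUpTo {V : Type*} (w : V × ℕ → ℝ) (t : ℝ) : List (V × ℕ) :=
  if h : {e : V × ℕ | ringTime w e ≤ t}.Finite then
    h.toFinset.toList.mergeSort (fun a b => decide (ringTime w a ≤ ringTime w b))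
  else []

/-- The effect of the ring `e = (v, i)` on the configuration `σ`: the spin of `v` is replaced by
the spin prepared for this ring and the current configuration on `N_v⁺`. -/
def applyRing {V : Type*} [DecidableEq V] {G : SimpleGraph V} {q : ℕ}
    (Z : (e : V × ℕ) → (inclNbhd G e.1 → Fin q) → Fin q) (σ : V → Fin q) (e : V × ℕ) :
    V → Fin q :=
  Function.update σ e.1 (Z e (fun u => σ u))

/-- The state `X_t` of the continuous-time chain started at `X₀`. -/
def chainState {V : Type*} [DecidableEq V] {G : SimpleGraph V} {q : ℕ} (X₀ : V → Fin q)
    (t : ℝ) (ω : ChainSpace G q) : V → Fin q :=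
  (ringsUpTo ω.1 t).foldl (applyRing ω.2) X₀

/-- The mass function of `X_t` for the continuous-time chain specified by `P` and started
at `X₀`. -/
def chainLaw {V : Type*} [DecidableEq V] {G : SimpleGraph V} {q : ℕ} (P : LocalRule G q)
    (X₀ : V → Fin q) (t : ℝ) (σ : V → Fin q) : ℝ :=
  (chainMeasure P).real {ω | chainState X₀ t ω = σ}

/-! ### The CONGEST model -/

/-- A message of exactly `B` bits. -/
abbrev Msg (B : ℕ) : Type := Fin B → Bool

/-- The local input of a node: its name, its inclusive neighbourhood, its own local update
distributions, its own initial spin, and the time horizon. -/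
structure LocalInput (V : Type*) (q : ℕ) where
  self : V
  nbhd : Set V
  rule : (nbhd → Fin q) → PMF (Fin q)
  spin : Fin q
  horizon : ℝ

/-- The local input that the node `v` receives. -/
def localInput {V : Type*} {G : SimpleGraph V} {q : ℕ} (P : LocalRule G q) (X₀ : V → Fin q)
    (T : ℝ) (v : V) : LocalInput V q where
  self := v
  nbhd := inclNbhd G v
  rule := P v
  spin := X₀ v
  horizon := T

/-- A randomized `CONGEST(B)` algorithm for nodes with names in `V`. It runs for a number of
synchronous rounds fixed by the time horizon. Local computation and memory are unlimited, so a
message and the final output of a node may be any function of what the node knows at that moment: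
its local input, its private random bits, and the messages it has received in each earlier round
(in order, listed by the name of the sender). -/
structure CongestAlgorithm (V : Type*) (q B : ℕ) where
  /-- The number of communication rounds. -/
  rounds : ℝ → ℕ
  /-- The message that a node sends next to the neighbour named in the last argument. -/
  send : LocalInput V q → (ℕ → Bool) → List (V → Msg B) → V → Msg B
  /-- The spin that a node returns in the end. -/
  output : LocalInput V q → (ℕ → Bool) → List (V → Msg B) → Fin q
  measurable_send : ∀ inp hist u, Measurable fun bits => send inp bits hist u
  measurable_output : ∀ inp hist, Measurable fun bits => output inp bits hist

namespace CongestAlgorithm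

variable {V : Type*} {q B : ℕ}

open Classical in
/-- The messages received by each node in the first `r` rounds of the run on the network `G` with
local inputs `inp` and private random bits `bits`. Only neighbours exchange messages; the entries
of non-neighbours are constantly `false`. -/
def received (A : CongestAlgorithm V q B) (G : SimpleGraph V) (inp : V → LocalInput V q)
    (bits : V → ℕ → Bool) : ℕ → V → List (V → Msg B)
  | 0, _ => []
  | r + 1, v => A.received G inp bits r v ++
      [fun u => if G.Adj u v then A.send (inp u) (bits u) (A.received G inp bits r u) v
        else fun _ => false]

/-- The configuration returned by the nodes. -/
def run (A : CongestAlgorithm V q B) {G : SimpleGraph V} (P : LocalRule G q) (X₀ : V → Fin q)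
    (T : ℝ) (bits : V → ℕ → Bool) : V → Fin q := fun v =>
  A.output (localInput P X₀ T v) (bits v)
    (A.received G (localInput P X₀ T) bits (A.rounds T) v)

/-- The mass function of the returned configuration, when the private random bits of the nodes are
independent fair coin flips. -/
def outputLaw (A : CongestAlgorithm V q B) {G : SimpleGraph V} (P : LocalRule G q)
    (X₀ : V → Fin q) (T : ℝ) (σ : V → Fin q) : ℝ :=
  (Measure.infinitePi fun _ : V => Measure.infinitePi fun _ : ℕ =>
    (PMF.uniformOfFintype Bool).toMeasure).real {bits | A.run P X₀ T bits = σ}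

end CongestAlgorithm

end

/-!
The dynamics is simulated by iterating all updates in parallel, over a short window of time that
slides forward.

*Discretization.* Time is cut into `S = n ^ k` slots, in each of which every clock rings with
probability `p = T / S`; the sites that ring in a slot are updated simultaneously. Conditionally on
at most one ring in a slot this is the continuous-time chain, and exchanging the slots one at a time
gives a total error `O(n² T² / S)` (`abs_integral_slotState_sub_chainMean_le`, which rests on the
memorylessness of the clocks, `map_restart` and `map_restartAfter`, through
`abs_chainMean_sub_eulerStep_le`).

*Universal coupling.* A site that rings draws its spins for all configurations of its neighbourhood
from one table, by rejection sampling with common trials, so that the entries for two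
configurations differ with probability at most twice the total variation distance
(`exists_universalCoupling`). The tables, like everything random at a site, are functions of the
private coins of the site (`exists_measurable_map_coinMeasure`, `map_sampledSlots`).

*Contraction.* In iteration `r` each site recomputes its trajectory on the first `r` windows of
`W` slots from the trajectories of its neighbours in the previous iteration. A disagreement with the
chain needs a ring and a disagreement of a neighbour, and the expected number of rings in a window
is a small constant, so the disagreement is exponentially small in the number of iterations since
the window reached a slot (`measureReal_iterates_ne_le`). The condition on `‖ρ‖_p` enters only
through a polynomially bounded weight `g` with `ρᵀ g ≤ 2 C g`, which is a Neumann series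
(`exists_weight`); no smallness of `C` is needed, since it can be offset by the window length.

*Communication.* After `L = O(log n)` iterations a slot has converged with high probability and can
be frozen (`iterates_frozen_eq`). A trajectory therefore has to be sent only on `L` windows, in which
a site rings `O(log n)` times; given the ring pattern of the site, which is sent beforehand, the
spins after these rings fit into one message of `O(log n log q)` bits (`windowCode_ringCount`). All
failure probabilities are polynomially small (`measureReal_ringCount_le`,
`tvDist_outputLaw_simulation_le`, `exists_parameters`).
-/

/-! ### Product measures, fair coins and exponential clocks -/

section ProductMeasure

open Measure

variable {ι : Type*} {X : ι → Type*}

open Classical in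
/-- Replace the coordinates of the first point that lie in `A` by those of the second point. -/
noncomputable def mixOn (A : Set ι) (x y : ∀ i, X i) : ∀ i, X i :=
  fun i => if i ∈ A then y i else x i

theorem mixOn_of_mem {A : Set ι} {i : ι} (h : i ∈ A) (x y : ∀ i, X i) : mixOn A x y i = y i := by
  simp [mixOn, h]

theorem mixOn_of_notMem {A : Set ι} {i : ι} (h : i ∉ A) (x y : ∀ i, X i) :
    mixOn A x y i = x i := by
  simp [mixOn, h]

variable [∀ i, MeasurableSpace (X i)]

theorem measurable_mixOn (A : Set ι) :
    Measurable fun z : (∀ i, X i) × (∀ i, X i) => mixOn A z.1 z.2 := by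
  classical
  refine measurable_pi_iff.2 fun i => ?_
  by_cases h : i ∈ A
  · simp only [mixOn_of_mem h]; fun_prop
  · simp only [mixOn_of_notMem h]; fun_prop

/-- Resampling the coordinates in `A` does not change a product measure. This is the form in which
independence of the coordinates is used throughout. -/
theorem infinitePi_map_mixOn (μ : ∀ i, Measure (X i)) [∀ i, IsProbabilityMeasure (μ i)]
    (A : Set ι) :
    ((infinitePi μ).prod (infinitePi μ)).map (fun z => mixOn A z.1 z.2) = infinitePi μ := by
  classical
  refine eq_infinitePi μ fun s t ht => ?_
  rw [map_apply (measurable_mixOn A) (.pi s.countable_toSet fun i _ => ht i)]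
  have : (fun z : (∀ i, X i) × (∀ i, X i) => mixOn A z.1 z.2) ⁻¹' ((s : Set ι).pi t) =
      (((s.filter (· ∉ A) : Finset ι) : Set ι).pi t) ×ˢ
        (((s.filter (· ∈ A) : Finset ι) : Set ι).pi t) := by
    ext z
    simp only [Set.mem_preimage, Set.mem_pi, Finset.mem_coe, Set.mem_prod, Finset.mem_filter]
    constructor
    · intro h
      refine ⟨fun i hi => ?_, fun i hi => ?_⟩
      · simpa only [mixOn_of_notMem hi.2] using h i hi.1
      · simpa only [mixOn_of_mem hi.2] using h i hi.1
    · rintro ⟨h1, h2⟩ i hi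
      by_cases hA : i ∈ A
      · simpa only [mixOn_of_mem hA] using h2 i ⟨hi, hA⟩
      · simpa only [mixOn_of_notMem hA] using h1 i ⟨hi, hA⟩
  rw [this, prod_prod, infinitePi_pi _ (fun i _ => ht i), infinitePi_pi _ (fun i _ => ht i),
    mul_comm, Finset.prod_filter_mul_prod_filter_not]

theorem lintegral_infinitePi_mixOn (μ : ∀ i, Measure (X i)) [∀ i, IsProbabilityMeasure (μ i)]
    (A : Set ι) {f : (∀ i, X i) → ℝ≥0∞} (hf : Measurable f) :
    ∫⁻ x, f x ∂infinitePi μ = ∫⁻ x, ∫⁻ y, f (mixOn A x y) ∂infinitePi μ ∂infinitePi μ := by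
  conv_lhs => rw [← infinitePi_map_mixOn μ A]
  rw [lintegral_map hf (measurable_mixOn A),
    lintegral_prod (fun z => f (mixOn A z.1 z.2)) (hf.comp (measurable_mixOn A)).aemeasurable]

theorem integral_infinitePi_mixOn (μ : ∀ i, Measure (X i)) [∀ i, IsProbabilityMeasure (μ i)]
    (A : Set ι) {f : (∀ i, X i) → ℝ} (hf : Measurable f) {c : ℝ} (hc : ∀ x, |f x| ≤ c) :
    ∫ x, f x ∂infinitePi μ = ∫ x, ∫ y, f (mixOn A x y) ∂infinitePi μ ∂infinitePi μ := by
  conv_lhs => rw [← infinitePi_map_mixOn μ A]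
  rw [integral_map (measurable_mixOn A).aemeasurable hf.aestronglyMeasurable,
    integral_prod]
  exact Integrable.of_bound (hf.comp (measurable_mixOn A)).aestronglyMeasurable c
    (.of_forall fun z => hc _)

/-- The sequence with first term `y` and remaining terms `b`. -/
def seqCons {Y : Type*} (y : Y) (b : ℕ → Y) : ℕ → Y
  | 0 => y
  | n + 1 => b n

theorem measurable_seqCons {Y : Type*} [MeasurableSpace Y] :
    Measurable fun z : Y × (ℕ → Y) => seqCons z.1 z.2 := by
  refine measurable_pi_iff.2 fun n => ?_
  cases n with
  | zero => exact measurable_fst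
  | succ n => exact (measurable_pi_apply n).comp measurable_snd

/-- An i.i.d. sequence is a first term followed by an independent i.i.d. sequence. -/
theorem infinitePi_map_cons {Y : Type*} [MeasurableSpace Y] (μ : Measure Y)
    [IsProbabilityMeasure μ] :
    (μ.prod (infinitePi fun _ : ℕ => μ)).map
      (fun z => seqCons z.1 z.2) = infinitePi fun _ : ℕ => μ := by
  classical
  refine eq_infinitePi _ fun s t ht => ?_
  rw [map_apply measurable_seqCons (.pi s.countable_toSet fun i _ => ht i)]
  have h1 : (fun z : Y × (ℕ → Y) => seqCons z.1 z.2) ⁻¹' ((s : Set ℕ).pi t) =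
      (if 0 ∈ s then t 0 else Set.univ) ×ˢ
        (((s.preimage Nat.succ Nat.succ_injective.injOn : Finset ℕ) : Set ℕ).pi
          fun n => t (n + 1)) := by
    ext z
    simp only [Set.mem_preimage, Set.mem_pi, Finset.mem_coe, Set.mem_prod, Finset.mem_preimage]
    constructor
    · intro h
      refine ⟨?_, fun n hn => h _ hn⟩
      split_ifs with h0
      · exact h 0 h0
      · trivial
    · rintro ⟨h0, h2⟩ n hn
      cases n with
      | zero => simpa [hn, seqCons] using h0
      | succ n => exact h2 n hn
  rw [h1, prod_prod, infinitePi_pi _ (fun i _ => ht _)]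
  have h2 : ∏ i ∈ s.preimage Nat.succ Nat.succ_injective.injOn, μ (t (i + 1)) =
      ∏ i ∈ s.erase 0, μ (t i) := by
    refine Finset.prod_bij (fun i _ => i + 1) ?_ ?_ ?_ ?_
    · intro a ha; simpa using ha
    · intro a _ b _ h; simpa using h
    · intro b hb
      obtain ⟨h0, hb⟩ := Finset.mem_erase.1 hb
      obtain ⟨c, rfl⟩ := Nat.exists_eq_succ_of_ne_zero h0
      exact ⟨c, by simpa using hb, rfl⟩
    · intros; rfl
  rw [h2]
  split_ifs with h0
  · exact Finset.mul_prod_erase s (fun i => μ (t i)) h0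
  · rw [Finset.erase_eq_of_notMem h0]; simp

end ProductMeasure

section Coins

open Measure

/-- The law of an infinite sequence of fair coin flips. -/
noncomputable abbrev coinMeasure : Measure (ℕ → Bool) :=
  infinitePi fun _ : ℕ => (PMF.uniformOfFintype Bool).toMeasure

/-- The number in `[0, 1]` with the given binary digits. -/
noncomputable def binaryValue (b : ℕ → Bool) : ℝ :=
  ∑' n, (if b n then (1 : ℝ) else 0) / 2 / 2 ^ n

theorem summable_binary (b : ℕ → Bool) :
    Summable fun n => (if b n then (1 : ℝ) else 0) / 2 / 2 ^ n := by
  refine Summable.of_nonneg_of_le (fun n => ?_) (fun n => ?_) (summable_geometric_two' (1 : ℝ))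
  · split_ifs <;> positivity
  · gcongr; split_ifs <;> norm_num

theorem continuous_binaryValue : Continuous binaryValue := by
  refine continuous_tsum (u := fun n => (1 : ℝ) / 2 / 2 ^ n) (fun n => ?_)
    (summable_geometric_two' (1 : ℝ)) (fun n b => ?_)
  · have : Continuous fun x : Bool => (if x then (1 : ℝ) else 0) / 2 / 2 ^ n :=
      continuous_of_discreteTopology
    exact this.comp (continuous_apply n)
  · rw [Real.norm_of_nonneg (by split_ifs <;> positivity)]
    gcongr; split_ifs <;> norm_num

theorem binaryValue_nonneg (b : ℕ → Bool) : 0 ≤ binaryValue b :=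
  tsum_nonneg fun n => by split_ifs <;> positivity

theorem binaryValue_le_one (b : ℕ → Bool) : binaryValue b ≤ 1 := by
  rw [← tsum_geometric_two' (1 : ℝ)]
  refine (summable_binary b).tsum_le_tsum (fun n => ?_) (summable_geometric_two' (1 : ℝ))
  gcongr; split_ifs <;> norm_num

theorem binaryValue_cons (x : Bool) (b : ℕ → Bool) :
    binaryValue (seqCons x b) =
      ((if x then 1 else 0) + binaryValue b) / 2 := by
  unfold binaryValue
  rw [(summable_binary _).tsum_eq_zero_add, add_div, ← tsum_div_const]
  congr 1
  · simp only [seqCons, pow_zero, div_one]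
    cases x <;> rfl
  · refine tsum_congr fun n => ?_
    simp only [pow_succ, seqCons]
    field_simp
    congr

theorem coin_real_singleton (x : Bool) : (PMF.uniformOfFintype Bool).toMeasure.real {x} = 1 / 2 := by
  rw [measureReal_def, PMF.toMeasure_apply_singleton _ _ (measurableSet_singleton x)]
  simp

/-- Self-similarity of the distribution function of `binaryValue`. -/
theorem coinMeasure_binaryValue_le (x : ℝ) :
    coinMeasure.real {b | binaryValue b ≤ x} =
      coinMeasure.real {b | binaryValue b ≤ 2 * x} / 2 +
        coinMeasure.real {b | binaryValue b ≤ 2 * x - 1} / 2 := by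
  have hS : ∀ y, MeasurableSet {b | binaryValue b ≤ y} := fun y =>
    measurableSet_le continuous_binaryValue.measurable measurable_const
  conv_lhs => rw [measureReal_def, coinMeasure, ← infinitePi_map_cons, map_apply measurable_seqCons (hS x)]
  have : (fun z : Bool × (ℕ → Bool) => seqCons z.1 z.2) ⁻¹' {b | binaryValue b ≤ x} =
      ({false} ×ˢ {b | binaryValue b ≤ 2 * x}) ∪ ({true} ×ˢ {b | binaryValue b ≤ 2 * x - 1}) := by
    ext ⟨y, b⟩
    simp only [Set.mem_preimage, Set.mem_ofPred_eq, binaryValue_cons, Set.mem_union, Set.mem_prod,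
      Set.mem_singleton_iff]
    cases y
    · simp; constructor <;> intro h <;> linarith
    · simp; constructor <;> intro h <;> linarith
  rw [this, measure_union _ ((measurableSet_singleton _).prod (hS _)), prod_prod, prod_prod,
    ENNReal.toReal_add (by finiteness) (by finiteness), ENNReal.toReal_mul, ENNReal.toReal_mul,
    ← measureReal_def, ← measureReal_def, ← measureReal_def, ← measureReal_def,
    coin_real_singleton, coin_real_singleton]
  · ring
  · refine Set.disjoint_left.2 ?_
    rintro ⟨y, b⟩ h1 h2
    simp only [Set.mem_prod, Set.mem_singleton_iff] at h1 h2
    exact absurd (h1.1.symm.trans h2.1) (by decide)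

theorem coinMeasure_binaryValue_of_neg {x : ℝ} (hx : x < 0) :
    coinMeasure.real {b | binaryValue b ≤ x} = 0 := by
  rw [show {b | binaryValue b ≤ x} = ∅ from Set.eq_empty_of_forall_notMem fun b hb =>
    absurd (binaryValue_nonneg b) (not_le.2 (lt_of_le_of_lt hb hx))]
  simp

theorem coinMeasure_binaryValue_of_one_le {x : ℝ} (hx : 1 ≤ x) :
    coinMeasure.real {b | binaryValue b ≤ x} = 1 := by
  rw [show {b | binaryValue b ≤ x} = Set.univ from Set.eq_univ_of_forall fun b =>
    (binaryValue_le_one b).trans hx]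
  simp

/-- `binaryValue` is uniform on `[0, 1]`: by self-similarity the largest distance between the two
distribution functions is at most half of itself. -/
theorem coinMeasure_binaryValue (x : ℝ) (h0 : 0 ≤ x) (h1 : x ≤ 1) :
    coinMeasure.real {b | binaryValue b ≤ x} = x := by
  have key : ∀ k : ℕ, ∀ x : ℝ, 0 ≤ x → x ≤ 1 →
      |coinMeasure.real {b | binaryValue b ≤ x} - x| ≤ (1 / 2) ^ k := by
    intro k
    induction k with
    | zero =>
      intro x h0 h1
      have h2 : coinMeasure.real {b | binaryValue b ≤ x} ≤ 1 := measureReal_le_one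
      have h3 : 0 ≤ coinMeasure.real {b | binaryValue b ≤ x} := measureReal_nonneg
      rw [abs_le]; constructor <;> norm_num <;> linarith
    | succ k ih =>
      intro x h0 h1
      rw [coinMeasure_binaryValue_le, pow_succ]
      rcases lt_or_ge (2 * x) 1 with h | h
      · rw [coinMeasure_binaryValue_of_neg (x := 2 * x - 1) (by linarith)]
        have := ih (2 * x) (by linarith) h.le
        rw [abs_le] at this ⊢
        constructor <;> linarith [this.1, this.2]
      · rw [coinMeasure_binaryValue_of_one_le h]
        have := ih (2 * x - 1) (by linarith) (by linarith)
        rw [abs_le] at this ⊢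
        constructor <;> linarith [this.1, this.2]
  have h2 : |coinMeasure.real {b | binaryValue b ≤ x} - x| ≤ 0 :=
    ge_of_tendsto' (tendsto_pow_atTop_nhds_zero_of_lt_one (by norm_num) (by norm_num))
      fun k => key k x h0 h1
  linarith [abs_nonpos_iff.1 h2]

/-- Every probability measure on a standard Borel space is the law of a function of fair coins. -/
theorem exists_measurable_map_coinMeasure {Y : Type*} [MeasurableSpace Y] [StandardBorelSpace Y]
    (μ : Measure Y) [IsProbabilityMeasure μ] :
    ∃ f : (ℕ → Bool) → Y, Measurable f ∧ coinMeasure.map f = μ := by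
  have : Nonempty Y := nonempty_of_isProbabilityMeasure μ
  obtain ⟨g, hg, hgμ⟩ := exists_measurable_map_eq μ
  let u : (ℕ → Bool) → unitInterval :=
    fun b => ⟨binaryValue b, binaryValue_nonneg b, binaryValue_le_one b⟩
  have hu : Measurable u := continuous_binaryValue.measurable.subtype_mk
  have huv : coinMeasure.map u = volume := by
    have : IsProbabilityMeasure (coinMeasure.map u) := isProbabilityMeasure_map hu.aemeasurable
    refine ext_of_Iic _ _ fun x => ?_
    rw [map_apply hu measurableSet_Iic, unitInterval.volume_Iic,
      ← coinMeasure_binaryValue x x.2.1 x.2.2, ofReal_measureReal]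
    rfl
  refine ⟨g ∘ u, hg.comp hu, ?_⟩
  rw [← map_map hg hu, huv, hgμ]

end Coins

section Exponential

open ProbabilityTheory

theorem expMeasure_one_eq :
    expMeasure 1 = volume.withDensity (fun x : ℝ => if 0 ≤ x then ENNReal.ofReal (Real.exp (-x)) else 0) := by
  unfold expMeasure gammaMeasure
  congr 1
  funext x
  have h := exponentialPDF_eq 1 x
  rw [exponentialPDF] at h
  change ENNReal.ofReal (exponentialPDFReal 1 x) = _
  rw [h]
  split_ifs <;> simp

instance : NullSingletonClass (expMeasure 1) := by
  rw [expMeasure_one_eq]; infer_instance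

theorem measurable_expDensity :
    Measurable (fun x : ℝ => if 0 ≤ x then ENNReal.ofReal (Real.exp (-x)) else 0) :=
  Measurable.ite measurableSet_Ici (by fun_prop) measurable_const

theorem expMeasure_Iic_zero : expMeasure 1 (Set.Iic 0) = 0 := by
  rw [expMeasure_one_eq, withDensity_apply _ measurableSet_Iic, setLIntegral_congr Iio_ae_eq_Iic.symm,
    setLIntegral_congr_fun (g := 0) measurableSet_Iio]
  · simp
  · intro x hx
    simp [not_le.2 (Set.mem_Iio.1 hx)]

/-- The exponential law is memoryless. -/
theorem expMeasure_memoryless {x : ℝ} (hx : 0 ≤ x) {t : Set ℝ} (ht : MeasurableSet t) :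
    expMeasure 1 {y | x < y ∧ y - x ∈ t} = ENNReal.ofReal (Real.exp (-x)) * expMeasure 1 t := by
  have h0 : expMeasure 1 t = expMeasure 1 {y | 0 < y ∧ y ∈ t} := by
    refine le_antisymm ?_ (measure_mono fun y hy => hy.2)
    have : t ⊆ {y | 0 < y ∧ y ∈ t} ∪ Set.Iic 0 := by
      intro y hy
      rcases lt_or_ge 0 y with h | h
      · exact Or.inl ⟨h, hy⟩
      · exact Or.inr h
    refine (measure_mono this).trans ((measure_union_le _ _).trans ?_)
    rw [expMeasure_Iic_zero, add_zero]
  have hm1 : MeasurableSet {y : ℝ | x < y ∧ y - x ∈ t} :=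
    measurableSet_Ioi.inter (ht.preimage (measurable_id.sub_const x))
  have hm2 : MeasurableSet {y : ℝ | 0 < y ∧ y ∈ t} := measurableSet_Ioi.inter ht
  rw [h0, expMeasure_one_eq, withDensity_apply _ hm1, withDensity_apply _ hm2,
    ← lintegral_indicator hm1, ← lintegral_indicator hm2, ← lintegral_const_mul _
      (measurable_expDensity.indicator hm2)]
  conv_rhs => rw [← lintegral_sub_right_eq_self _ x]
  refine lintegral_congr fun y => ?_
  by_cases hy : x < y ∧ y - x ∈ t
  · rw [Set.indicator_of_mem (show y ∈ {y : ℝ | x < y ∧ y - x ∈ t} from hy),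
      Set.indicator_of_mem (show y - x ∈ {y : ℝ | 0 < y ∧ y ∈ t} from ⟨by linarith [hy.1], hy.2⟩),
      if_pos (by linarith [hy.1]), if_pos (by linarith [hy.1]),
      ← ENNReal.ofReal_mul (Real.exp_nonneg _), ← Real.exp_add]
    congr 2; ring
  · rw [Set.indicator_of_notMem (show y ∉ {y : ℝ | x < y ∧ y - x ∈ t} from hy),
      Set.indicator_of_notMem (show y - x ∉ {y : ℝ | 0 < y ∧ y ∈ t} from
        fun h => hy ⟨by linarith [h.1], h.2⟩), mul_zero]

theorem expMeasure_Ioi {x : ℝ} (hx : 0 ≤ x) :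
    expMeasure 1 (Set.Ioi x) = ENNReal.ofReal (Real.exp (-x)) := by
  have h := expMeasure_memoryless hx MeasurableSet.univ
  rw [measure_univ, mul_one] at h
  simpa [Set.Ioi] using h

/-- The mass of a first ring before `x` followed by no further ring up to time `x`. -/
theorem setLIntegral_expMeasure_exp {x : ℝ} (hx : 0 ≤ x) :
    ∫⁻ y in Set.Iic x, ENNReal.ofReal (Real.exp (-(x - y))) ∂expMeasure 1 =
      ENNReal.ofReal (x * Real.exp (-x)) := by
  rw [expMeasure_one_eq, setLIntegral_withDensity_eq_setLIntegral_mul _ measurable_expDensity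
    (by fun_prop) measurableSet_Iic, ← lintegral_indicator measurableSet_Iic]
  have : (fun y => (Set.Iic x).indicator (((fun x : ℝ =>
      if 0 ≤ x then ENNReal.ofReal (Real.exp (-x)) else 0)) *
        fun y => ENNReal.ofReal (Real.exp (-(x - y)))) y) =
      (Set.Icc 0 x).indicator fun _ => ENNReal.ofReal (Real.exp (-x)) := by
    funext y
    by_cases h0 : 0 ≤ y
    · by_cases h1 : y ≤ x
      · rw [Set.indicator_of_mem (show y ∈ Set.Iic x from h1),
          Set.indicator_of_mem (show y ∈ Set.Icc 0 x from ⟨h0, h1⟩)]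
        simp only [Pi.mul_apply, if_pos h0]
        rw [← ENNReal.ofReal_mul (Real.exp_nonneg _), ← Real.exp_add]
        congr 2; ring
      · rw [Set.indicator_of_notMem (show y ∉ Set.Iic x from h1),
          Set.indicator_of_notMem (fun h => h1 h.2)]
    · rw [Set.indicator_of_notMem (s := Set.Icc 0 x) (fun h => h0 h.1)]
      by_cases h1 : y ≤ x
      · rw [Set.indicator_of_mem (show y ∈ Set.Iic x from h1)]
        simp [h0]
      · rw [Set.indicator_of_notMem (show y ∉ Set.Iic x from h1)]
  rw [this, lintegral_indicator measurableSet_Icc, setLIntegral_const, Real.volume_Icc, sub_zero,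
    mul_comm, ← ENNReal.ofReal_mul hx]

end Exponential

/-! ### Averaging operators of the site updates -/

section FiniteRange

theorem exists_abs_le_of_finite {Y : Type*} [Finite Y] (f : Y → ℝ) : ∃ c, ∀ y, |f y| ≤ c := by
  obtain ⟨c, hc⟩ := (Set.finite_range fun y => |f y|).bddAbove
  exact ⟨c, fun y => hc ⟨y, rfl⟩⟩

theorem integrable_comp_of_finite {Ω Y : Type*} [MeasurableSpace Ω] [MeasurableSpace Y]
    [Finite Y] [DiscreteMeasurableSpace Y] {μ : Measure Ω} [IsFiniteMeasure μ] {X : Ω → Y}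
    (hX : AEMeasurable X μ) (f : Y → ℝ) : Integrable (fun ω => f (X ω)) μ := by
  obtain ⟨c, hc⟩ := exists_abs_le_of_finite f
  exact Integrable.of_bound
    ((measurable_of_finite f).comp_aemeasurable hX).aestronglyMeasurable c (.of_forall fun _ => hc _)

theorem integral_comp_eq_sum {Ω Y : Type*} [MeasurableSpace Ω] [MeasurableSpace Y]
    [Fintype Y] [DiscreteMeasurableSpace Y] {μ : Measure Ω} [IsFiniteMeasure μ] {X : Ω → Y}
    (hX : AEMeasurable X μ) (f : Y → ℝ) :
    ∫ ω, f (X ω) ∂μ = ∑ y, μ.real {ω | X ω = y} * f y := by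
  rw [← integral_map hX (measurable_of_finite f).aestronglyMeasurable, integral_fintype]
  · refine Finset.sum_congr rfl fun y _ => ?_
    rw [smul_eq_mul, measureReal_def, Measure.map_apply_of_aemeasurable hX (measurableSet_singleton y)]
    rfl
  · exact integrable_comp_of_finite (X := id) aemeasurable_id f

end FiniteRange

section SiteOperators

variable {V : Type*} [DecidableEq V] {G : SimpleGraph V} {q : ℕ}

/-- The averaging operator of one update of the site `v`. -/
noncomputable def siteOp (P : LocalRule G q) (v : V) (f : (V → Fin q) → ℝ) (X : V → Fin q) : ℝ :=
  ∑ x, (P v (fun u => X u) x).toReal * f (Function.update X v x)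

/-- The averaging operator of successive updates of the listed sites, the head being updated
first. -/
noncomputable def listOp (P : LocalRule G q) (l : List V) (f : (V → Fin q) → ℝ) :
    (V → Fin q) → ℝ :=
  l.foldr (siteOp P) f

theorem PMF.sum_toReal {Y : Type*} [Fintype Y] (p : PMF Y) : ∑ y, (p y).toReal = 1 := by
  rw [← ENNReal.toReal_sum (fun y _ => p.apply_ne_top y), ← tsum_fintype (L := .unconditional _),
    p.tsum_coe, ENNReal.toReal_one]

theorem abs_siteOp_le (P : LocalRule G q) (v : V) {f : (V → Fin q) → ℝ} {c : ℝ}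
    (hf : ∀ X, |f X| ≤ c) (X : V → Fin q) : |siteOp P v f X| ≤ c := by
  calc |siteOp P v f X| ≤ ∑ x, |(P v (fun u => X u) x).toReal * f (Function.update X v x)| :=
        Finset.abs_sum_le_sum_abs _ _
    _ ≤ ∑ x, (P v (fun u => X u) x).toReal * c := by
        refine Finset.sum_le_sum fun x _ => ?_
        rw [abs_mul, abs_of_nonneg ENNReal.toReal_nonneg]
        exact mul_le_mul_of_nonneg_left (hf _) ENNReal.toReal_nonneg
    _ = c := by rw [← Finset.sum_mul, PMF.sum_toReal, one_mul]

theorem abs_listOp_le (P : LocalRule G q) (l : List V) {f : (V → Fin q) → ℝ} {c : ℝ}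
    (hf : ∀ X, |f X| ≤ c) (X : V → Fin q) : |listOp P l f X| ≤ c := by
  induction l generalizing X with
  | nil => exact hf X
  | cons v l ih => exact abs_siteOp_le P v ih X

end SiteOperators

section PreparedSpins

open Measure

variable {V : Type*} [DecidableEq V] {G : SimpleGraph V} {q : ℕ}

/-- The law of the spins prepared for the rings. -/
noncomputable abbrev spinMeasure (P : LocalRule G q) :
    Measure ((e : V × ℕ) → (inclNbhd G e.1 → Fin q) → Fin q) :=
  infinitePi fun e : V × ℕ => infinitePi fun τ : inclNbhd G e.1 → Fin q => (P e.1 τ).toMeasure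

theorem foldl_applyRing_congr {Z Z' : (e : V × ℕ) → (inclNbhd G e.1 → Fin q) → Fin q}
    (l : List (V × ℕ)) (h : ∀ e ∈ l, Z e = Z' e) (X : V → Fin q) :
    l.foldl (applyRing Z) X = l.foldl (applyRing Z') X := by
  induction l generalizing X with
  | nil => rfl
  | cons e l ih =>
    rw [List.foldl_cons, List.foldl_cons, ih fun e' he' => h e' (List.mem_cons_of_mem _ he')]
    congr 1
    rw [applyRing, applyRing, h e List.mem_cons_self]

variable [Finite V]

theorem measurable_foldl_applyRing (l : List (V × ℕ))
    {g : ((e : V × ℕ) → (inclNbhd G e.1 → Fin q) → Fin q) → V → Fin q} (hg : Measurable g) :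
    Measurable fun Z => l.foldl (applyRing Z) (g Z) := by
  induction l generalizing g with
  | nil => exact hg
  | cons e l ih =>
    refine ih (g := fun Z => applyRing Z (g Z) e) ?_
    have h : Measurable fun p : (V → Fin q) × ((e : V × ℕ) → (inclNbhd G e.1 → Fin q) → Fin q) =>
        applyRing p.2 p.1 e := by
      refine measurable_from_prod_countable_right fun X => ?_
      exact (measurable_of_finite fun x : Fin q => Function.update X e.1 x).comp
        ((measurable_pi_apply fun u : inclNbhd G e.1 => X u).comp (measurable_pi_apply e))
    exact h.comp (hg.prodMk measurable_id)

/-- Since a ring reads only the spin prepared for the configuration it finds, the coupling of the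
prepared spins is irrelevant, and distinct rings act as independent site updates. -/
theorem integral_foldl_applyRing (P : LocalRule G q) (l : List (V × ℕ)) (hl : l.Nodup)
    (f : (V → Fin q) → ℝ) (X : V → Fin q) :
    ∫ Z, f (l.foldl (applyRing Z) X) ∂spinMeasure P = listOp P (l.map Prod.fst) f X := by
  induction l generalizing X with
  | nil => simp [listOp]
  | cons e l ih =>
    obtain ⟨he, hl⟩ := List.nodup_cons.1 hl
    obtain ⟨c, hc⟩ := exists_abs_le_of_finite f
    have hm : Measurable fun Z : (e : V × ℕ) → (inclNbhd G e.1 → Fin q) → Fin q =>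
        f ((e :: l).foldl (applyRing Z) X) :=
      (measurable_of_finite f).comp (measurable_foldl_applyRing (e :: l) measurable_const)
    rw [integral_infinitePi_mixOn _ {e} hm (fun _ => hc _)]
    have h1 : ∀ Z Z' : (e : V × ℕ) → (inclNbhd G e.1 → Fin q) → Fin q,
        (e :: l).foldl (applyRing (mixOn {e} Z Z')) X =
          l.foldl (applyRing Z) (Function.update X e.1 (Z' e fun u => X u)) := by
      intro Z Z'
      rw [List.foldl_cons, foldl_applyRing_congr (Z' := Z)]
      · rw [applyRing, mixOn_of_mem (Set.mem_singleton e)]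
      · intro e' he'
        exact mixOn_of_notMem (fun h => he (by rwa [← Set.mem_singleton_iff.1 h])) _ _
    simp_rw [h1]
    have h2 : ∀ g : Fin q → ℝ, ∫ Z', g (Z' e fun u => X u) ∂spinMeasure P =
        ∑ x, (P e.1 (fun u => X u) x).toReal * g x := by
      intro g
      have hm1 : Measurable fun Z' : (e : V × ℕ) → (inclNbhd G e.1 → Fin q) → Fin q => Z' e :=
        measurable_pi_apply e
      have hm2 : Measurable fun z : (inclNbhd G e.1 → Fin q) → Fin q => z fun u => X u :=
        measurable_pi_apply _
      have : (spinMeasure P).map (fun Z' => Z' e fun u => X u) =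
          (P e.1 fun u => X u).toMeasure := by
        rw [← infinitePi_map_eval (fun τ : inclNbhd G e.1 → Fin q => (P e.1 τ).toMeasure)
            (fun u => X u), ← infinitePi_map_eval (fun e : V × ℕ =>
              infinitePi fun τ : inclNbhd G e.1 → Fin q => (P e.1 τ).toMeasure) e,
            map_map hm2 hm1]
        rfl
      rw [← integral_map (φ := fun Z' : (e : V × ℕ) → (inclNbhd G e.1 → Fin q) → Fin q =>
          Z' e fun u => X u) (hm2.comp hm1).aemeasurable
          (measurable_of_finite g).aestronglyMeasurable, this,
        PMF.integral_eq_sum]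
      rfl
    simp_rw [fun Z => h2 fun x => f (l.foldl (applyRing Z) (Function.update X e.1 x))]
    rw [integral_finsetSum]
    · simp_rw [integral_const_mul, ih hl]
      rfl
    · intro x _
      exact (integrable_comp_of_finite
        (measurable_foldl_applyRing l measurable_const).aemeasurable f).const_mul _

end PreparedSpins

/-! ### Almost sure properties of the ring times -/

section RingTimes

open Measure ProbabilityTheory

variable {V : Type*}

/-- The law of the waiting times. -/
noncomputable abbrev clockMeasure (V : Type*) : Measure (V × ℕ → ℝ) :=
  infinitePi fun _ : V × ℕ => expMeasure 1

theorem measurable_ringTime (e : V × ℕ) : Measurable fun w : V × ℕ → ℝ => ringTime w e :=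
  Finset.measurable_sum _ fun _ _ => measurable_pi_apply _

theorem ringTime_succ (w : V × ℕ → ℝ) (v : V) (i : ℕ) :
    ringTime w (v, i + 1) = ringTime w (v, i) + w (v, i + 1) := by
  simp [ringTime, Finset.sum_range_succ]

theorem ringTime_zero (w : V × ℕ → ℝ) (v : V) : ringTime w (v, 0) = w (v, 0) := by
  simp [ringTime]

theorem ringTime_strictMono {w : V × ℕ → ℝ} (hw : ∀ e, 0 < w e) (v : V) :
    StrictMono fun i => ringTime w (v, i) :=
  strictMono_nat_of_lt_succ fun i => by rw [ringTime_succ]; linarith [hw (v, i + 1)]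

theorem le_ringTime {w : V × ℕ → ℝ} (hw : ∀ e, 0 < w e) (e : V × ℕ) : w e ≤ ringTime w e :=
  Finset.single_le_sum (f := fun j => w (e.1, j)) (fun _ _ => (hw _).le)
    (Finset.mem_range.2 (Nat.lt_succ_self e.2))

theorem clockMeasure_eval_preimage (e : V × ℕ) {t : Set ℝ} (ht : MeasurableSet t) :
    clockMeasure V {w | w e ∈ t} = expMeasure 1 t := by
  rw [← infinitePi_map_eval (fun _ : V × ℕ => expMeasure 1) e,
    map_apply (measurable_pi_apply e) ht]
  rfl

theorem ae_waiting_pos [Countable V] : ∀ᵐ w ∂clockMeasure V, ∀ e, 0 < w e := by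
  refine ae_all_iff.2 fun e => ?_
  rw [ae_iff]
  have := clockMeasure_eval_preimage e measurableSet_Iic (t := Set.Iic 0)
  rw [expMeasure_Iic_zero] at this
  simpa using this

theorem ae_ringTime_injective [Countable V] :
    ∀ᵐ w ∂clockMeasure V, Function.Injective (ringTime w) := by
  have h : ∀ e e' : V × ℕ, e.1 ≠ e'.1 → ∀ᵐ w ∂clockMeasure V, ringTime w e ≠ ringTime w e' := by
    intro e e' hne
    have hm : MeasurableSet {w : V × ℕ → ℝ | ringTime w e = ringTime w e'} :=
      measurableSet_eq_fun (measurable_ringTime e) (measurable_ringTime e')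
    have h0 : clockMeasure V {w | ringTime w e = ringTime w e'} = 0 := by
      rw [← lintegral_indicator_one hm, lintegral_infinitePi_mixOn _ {e}
        (measurable_one.indicator hm)]
      refine (lintegral_congr fun x => ?_).trans lintegral_zero
      have h1 : ∀ y, ringTime (mixOn {e} x y) e =
          (∑ j ∈ Finset.range e.2, x (e.1, j)) + y e := by
        intro y
        rw [ringTime, Finset.sum_range_succ]
        congr 1
        · refine Finset.sum_congr rfl fun j hj => mixOn_of_notMem (fun h => ?_) _ _
          have := congrArg Prod.snd (Set.mem_singleton_iff.1 h)
          simp only at this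
          exact absurd (Finset.mem_range.1 hj) (by omega)
        · exact mixOn_of_mem (Set.mem_singleton e) _ _
      have h2 : ∀ y, ringTime (mixOn {e} x y) e' = ringTime x e' := by
        intro y
        refine Finset.sum_congr rfl fun j _ => mixOn_of_notMem (fun h => hne ?_) _ _
        exact (congrArg Prod.fst (Set.mem_singleton_iff.1 h)).symm
      have h3 : ∀ y, Set.indicator {w : V × ℕ → ℝ | ringTime w e = ringTime w e'} (1 : (V × ℕ → ℝ) → ℝ≥0∞)
          (mixOn {e} x y) = Set.indicator {y : V × ℕ → ℝ |
            y e ∈ ({ringTime x e' - ∑ j ∈ Finset.range e.2, x (e.1, j)} : Set ℝ)} 1 y := by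
        intro y
        refine Set.indicator_eq_indicator ?_ rfl
        simp only [Set.mem_ofPred_eq, h1, h2, Set.mem_singleton_iff]
        constructor <;> intro h <;> linarith
      simp_rw [h3]
      rw [lintegral_indicator_one, clockMeasure_eval_preimage e (measurableSet_singleton _),
        measure_singleton]
      exact measurable_pi_apply e (measurableSet_singleton _)
    rw [ae_iff]
    simpa using h0
  have h' : ∀ᵐ w ∂clockMeasure V, ∀ e e' : V × ℕ, e.1 ≠ e'.1 → ringTime w e ≠ ringTime w e' :=
    ae_all_iff.2 fun e => ae_all_iff.2 fun e' => by
      by_cases hne : e.1 = e'.1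
      · exact .of_forall fun w hw => absurd hne hw
      · filter_upwards [h e e' hne] with w hw _ using hw
  filter_upwards [h', ae_waiting_pos] with w hw hpos e e' hee
  by_cases hne : e.1 = e'.1
  · obtain ⟨v, i⟩ := e
    obtain ⟨v', j⟩ := e'
    obtain rfl : v = v' := hne
    exact Prod.ext rfl ((ringTime_strictMono hpos v).injective hee)
  · exact absurd hee (hw e e' hne)

theorem ae_finite_rings [Finite V] (t : ℝ) :
    ∀ᵐ w ∂clockMeasure V, {e : V × ℕ | ringTime w e ≤ t}.Finite := by
  have h : ∀ v : V, ∀ᵐ w ∂clockMeasure V, ∃ i, t < w (v, i) := by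
    intro v
    rw [ae_iff]
    have hlt : expMeasure 1 (Set.Iic t) < 1 := by
      rcases lt_or_ge t 0 with ht | ht
      · refine lt_of_le_of_lt (measure_mono (Set.Iic_subset_Iic.2 ht.le)) ?_
        rw [expMeasure_Iic_zero]; exact one_pos
      · rw [← Set.compl_Ioi, prob_compl_eq_one_sub measurableSet_Ioi, expMeasure_Ioi ht]
        exact ENNReal.sub_lt_self ENNReal.one_ne_top one_ne_zero
          (ENNReal.ofReal_pos.2 (Real.exp_pos _)).ne'
    have hle : ∀ k : ℕ, clockMeasure V {w | ¬ ∃ i, t < w (v, i)} ≤ expMeasure 1 (Set.Iic t) ^ k := by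
      intro k
      have h1 := infinitePi_pi (fun _ : V × ℕ => expMeasure 1)
        (s := (Finset.range k).map ⟨fun i => (v, i), fun i j h => (Prod.ext_iff.1 h).2⟩)
        (t := fun _ => Set.Iic t) (fun _ _ => measurableSet_Iic)
      rw [Finset.prod_const, Finset.card_map, Finset.card_range] at h1
      rw [← h1]
      refine measure_mono fun w hw => ?_
      simp only [Set.mem_ofPred_eq, not_exists, not_lt] at hw
      intro e he
      obtain ⟨i, -, rfl⟩ := Finset.mem_map.1 (Finset.mem_coe.1 he)
      exact hw i
    exact le_antisymm (ge_of_tendsto' (ENNReal.tendsto_pow_atTop_nhds_zero_of_lt_one hlt) hle)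
      (zero_le)
  filter_upwards [ae_all_iff.2 h, ae_waiting_pos] with w hw hpos
  choose i hi using hw
  refine (Set.Finite.subset (s := ⋃ v : V, (fun j => (v, j)) '' Set.Iio (i v))
    (Set.finite_iUnion fun v => (Set.finite_Iio _).image _)) ?_
  rintro ⟨v, j⟩ hj
  refine Set.mem_iUnion.2 ⟨v, j, ?_, rfl⟩
  by_contra hlt
  have h1 := (ringTime_strictMono hpos v).monotone (not_lt.1 hlt)
  have h2 := le_ringTime hpos (v, i v)
  have h3 := hi v
  simp only [Set.mem_ofPred_eq] at hj h1
  linarith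

/-! ### The chronological list of rings -/

theorem mem_ringsUpTo {w : V × ℕ → ℝ} {t : ℝ} (h : {e : V × ℕ | ringTime w e ≤ t}.Finite)
    (e : V × ℕ) : e ∈ ringsUpTo w t ↔ ringTime w e ≤ t := by
  rw [ringsUpTo, dif_pos h]
  simp

theorem nodup_ringsUpTo (w : V × ℕ → ℝ) (t : ℝ) : (ringsUpTo w t).Nodup := by
  unfold ringsUpTo
  split_ifs with h
  · exact (List.mergeSort_perm _ _).nodup_iff.2 (Finset.nodup_toList _)
  · exact List.nodup_nil

theorem pairwise_ringsUpTo (w : V × ℕ → ℝ) (t : ℝ) :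
    (ringsUpTo w t).Pairwise fun a b => ringTime w a ≤ ringTime w b := by
  unfold ringsUpTo
  split_ifs with h
  · refine (List.pairwise_mergeSort (le := fun a b => decide (ringTime w a ≤ ringTime w b))
      ?_ ?_ _).imp fun h => by simpa using h
    · intro a b c hab hbc
      simp only [decide_eq_true_eq] at *
      exact hab.trans hbc
    · intro a b
      simpa using le_total _ _
  · exact List.Pairwise.nil

theorem eq_ringsUpTo {w : V × ℕ → ℝ} {t : ℝ} (hinj : Function.Injective (ringTime w))
    (h : {e : V × ℕ | ringTime w e ≤ t}.Finite) {l : List (V × ℕ)} (hl : l.Nodup)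
    (hmem : ∀ e, e ∈ l ↔ ringTime w e ≤ t)
    (hp : l.Pairwise fun a b => ringTime w a ≤ ringTime w b) : l = ringsUpTo w t := by
  refine List.Perm.eq_of_pairwise (fun a b _ _ h1 h2 => hinj (le_antisymm h1 h2)) hp
    (pairwise_ringsUpTo w t) ((List.perm_ext_iff_of_nodup hl (nodup_ringsUpTo w t)).2 fun e => ?_)
  rw [hmem, mem_ringsUpTo h]

theorem measurableSet_pairwise_ringTime (l : List (V × ℕ)) :
    MeasurableSet {w : V × ℕ → ℝ | l.Pairwise fun a b => ringTime w a ≤ ringTime w b} := by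
  induction l with
  | nil => simp
  | cons e l ih =>
    classical
    simp only [List.pairwise_cons, Set.ofPred_and]
    refine MeasurableSet.inter ?_ ih
    simp only [Set.ofPred_forall]
    exact MeasurableSet.biInter (f := fun e' => {w : V × ℕ → ℝ | ringTime w e ≤ ringTime w e'})
      (s := {e' | e' ∈ l}) l.finite_toSet.countable fun e' _ =>
        measurableSet_le (measurable_ringTime e) (measurable_ringTime e')

end RingTimes

section ChainExpectation

open Measure ProbabilityTheory

variable {V : Type*}

/-- The waiting times for which `ringsUpTo` really is the chronological list of rings. -/
def regularClocks (V : Type*) (t : ℝ) : Set (V × ℕ → ℝ) :=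
  {w | Function.Injective (ringTime w) ∧ {e : V × ℕ | ringTime w e ≤ t}.Finite}

theorem ae_mem_regularClocks [Finite V] (t : ℝ) : ∀ᵐ w ∂clockMeasure V, w ∈ regularClocks V t := by
  filter_upwards [ae_ringTime_injective, ae_finite_rings t] with w h1 h2 using ⟨h1, h2⟩

theorem mem_regularClocks_ringsUpTo_iff {w : V × ℕ → ℝ} {t : ℝ} {l : List (V × ℕ)} :
    w ∈ regularClocks V t ∧ ringsUpTo w t = l ↔
      Function.Injective (ringTime w) ∧ l.Nodup ∧ (∀ e, e ∈ l ↔ ringTime w e ≤ t) ∧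
        l.Pairwise fun a b => ringTime w a ≤ ringTime w b := by
  constructor
  · rintro ⟨⟨h1, h2⟩, rfl⟩
    exact ⟨h1, nodup_ringsUpTo w t, mem_ringsUpTo h2, pairwise_ringsUpTo w t⟩
  · rintro ⟨h1, h2, h3, h4⟩
    have hfin : {e : V × ℕ | ringTime w e ≤ t}.Finite := by
      refine l.finite_toSet.subset fun e he => (h3 e).2 he
    exact ⟨⟨h1, hfin⟩, (eq_ringsUpTo h1 hfin h2 h3 h4).symm⟩

theorem measurableSet_ringTime_injective [Countable V] :
    MeasurableSet {w : V × ℕ → ℝ | Function.Injective (ringTime w)} := by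
  have : {w : V × ℕ → ℝ | Function.Injective (ringTime w)} =
      ⋂ (e : V × ℕ) (e' : V × ℕ), {w | ringTime w e = ringTime w e' → e = e'} := by
    ext w
    simp [Function.Injective]
  rw [this]
  refine MeasurableSet.iInter fun e => MeasurableSet.iInter fun e' => ?_
  by_cases h : e = e'
  · simp [h]
  · simp only [h, imp_false]
    exact (measurableSet_eq_fun (measurable_ringTime e) (measurable_ringTime e')).compl

theorem measurableSet_ringsUpTo_eq [Countable V] (t : ℝ) (l : List (V × ℕ)) :
    MeasurableSet {w : V × ℕ → ℝ | w ∈ regularClocks V t ∧ ringsUpTo w t = l} := by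
  simp_rw [mem_regularClocks_ringsUpTo_iff, Set.ofPred_and]
  refine measurableSet_ringTime_injective.inter ((MeasurableSet.const _).inter (.inter ?_
    (measurableSet_pairwise_ringTime l)))
  simp only [Set.ofPred_forall]
  refine MeasurableSet.iInter fun e => ?_
  by_cases he : e ∈ l
  · simp only [he, true_iff]
    exact measurableSet_le (measurable_ringTime e) measurable_const
  · simp only [he, false_iff, not_le]
    exact measurableSet_lt measurable_const (measurable_ringTime e)

open Classical in
/-- A modification of `ringsUpTo` on a null set that is measurable. -/
noncomputable def regularRings (t : ℝ) (w : V × ℕ → ℝ) : List (V × ℕ) :=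
  if w ∈ regularClocks V t then ringsUpTo w t else []

theorem nodup_regularRings (t : ℝ) (w : V × ℕ → ℝ) : (regularRings t w).Nodup := by
  unfold regularRings
  split_ifs
  · exact nodup_ringsUpTo w t
  · exact List.nodup_nil

theorem regularRings_ae_eq [Finite V] (t : ℝ) :
    ∀ᵐ w ∂clockMeasure V, regularRings t w = ringsUpTo w t := by
  filter_upwards [ae_mem_regularClocks t] with w hw
  rw [regularRings, if_pos hw]

theorem measurable_regularRings [Countable V] (t : ℝ) :
    @Measurable _ _ _ ⊤ (regularRings t : (V × ℕ → ℝ) → List (V × ℕ)) := by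
  let _ : MeasurableSpace (List (V × ℕ)) := ⊤
  have h : ∀ l : List (V × ℕ), l ≠ [] → MeasurableSet (regularRings (V := V) t ⁻¹' {l}) := by
    intro l hl
    convert measurableSet_ringsUpTo_eq t l using 1
    ext w
    simp only [Set.mem_preimage, Set.mem_singleton_iff, regularRings, Set.mem_ofPred_eq]
    split_ifs with hw
    · simp [hw]
    · simpa [hw] using hl.symm
  refine measurable_to_countable' fun l => ?_
  by_cases hl : l = []
  · have : regularRings (V := V) t ⁻¹' {l} =
        (⋃ l' : {l' : List (V × ℕ) // l' ≠ []}, regularRings (V := V) t ⁻¹' {l'.1})ᶜ := by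
      ext w
      simp only [hl, Set.mem_preimage, Set.mem_singleton_iff, Set.mem_compl_iff, Set.mem_iUnion,
        not_exists, Subtype.forall]
      exact ⟨fun h l' hl' h' => hl' (h' ▸ h), fun h => by_contra fun h' => h _ h' rfl⟩
    rw [this]
    exact (MeasurableSet.iUnion fun l' : {l' : List (V × ℕ) // l' ≠ []} => h l'.1 l'.2).compl
  · exact h l hl

variable [DecidableEq V] {G : SimpleGraph V} {q : ℕ}

/-- The expectation of `φ` at time `t` of the continuous-time chain started at `X`. -/
noncomputable def chainMean (P : LocalRule G q) (φ : (V → Fin q) → ℝ) (t : ℝ) (X : V → Fin q) : ℝ :=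
  ∫ w, listOp P ((ringsUpTo w t).map Prod.fst) φ X ∂clockMeasure V

theorem aemeasurable_listOp_ringsUpTo [Finite V] (P : LocalRule G q) (φ : (V → Fin q) → ℝ) (t : ℝ)
    (X : V → Fin q) :
    AEMeasurable (fun w => listOp P ((ringsUpTo w t).map Prod.fst) φ X) (clockMeasure V) := by
  let _ : MeasurableSpace (List (V × ℕ)) := ⊤
  have hm : Measurable fun w : V × ℕ → ℝ => listOp P ((regularRings t w).map Prod.fst) φ X :=
    (measurable_from_top (f := fun l : List (V × ℕ) => listOp P (l.map Prod.fst) φ X)).comp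
      (measurable_regularRings t)
  refine ⟨_, hm, ?_⟩
  filter_upwards [regularRings_ae_eq t] with w hw
  rw [hw]

theorem integrable_listOp_ringsUpTo [Finite V] (P : LocalRule G q) (φ : (V → Fin q) → ℝ) (t : ℝ)
    (X : V → Fin q) :
    Integrable (fun w => listOp P ((ringsUpTo w t).map Prod.fst) φ X) (clockMeasure V) := by
  obtain ⟨c, hc⟩ := exists_abs_le_of_finite φ
  exact Integrable.of_bound (aemeasurable_listOp_ringsUpTo P φ t X).aestronglyMeasurable c
    (.of_forall fun w => abs_listOp_le P _ hc X)

theorem abs_chainMean_le [Finite V] (P : LocalRule G q) {φ : (V → Fin q) → ℝ} {c : ℝ}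
    (hφ : ∀ X, |φ X| ≤ c) (t : ℝ) (X : V → Fin q) : |chainMean P φ t X| ≤ c := by
  have := norm_integral_le_of_norm_le_const (μ := clockMeasure V)
    (f := fun w => listOp P ((ringsUpTo w t).map Prod.fst) φ X) (C := c)
    (.of_forall fun w => abs_listOp_le P _ hφ X)
  simpa [chainMean] using this

/-- Averaging first over the prepared spins and then over the clocks, the law of the chain is a
mixture of products of site updates. -/
theorem sum_chainLaw_mul [Fintype V] (P : LocalRule G q) (φ : (V → Fin q) → ℝ) (t : ℝ)
    (X : V → Fin q) : ∑ σ, chainLaw P X t σ * φ σ = chainMean P φ t X := by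
  let _ : MeasurableSpace (List (V × ℕ)) := ⊤
  have : DiscreteMeasurableSpace (List (V × ℕ)) := ⟨fun _ => trivial⟩
  have hm : Measurable fun ω : ChainSpace G q => (regularRings t ω.1).foldl (applyRing ω.2) X := by
    have h : Measurable fun p : List (V × ℕ) × ((e : V × ℕ) → (inclNbhd G e.1 → Fin q) → Fin q) =>
        p.1.foldl (applyRing p.2) X :=
      measurable_from_prod_countable_right fun l => measurable_foldl_applyRing l measurable_const
    exact h.comp (((measurable_regularRings t).comp measurable_fst).prodMk measurable_snd)
  have hae : ∀ᵐ ω ∂chainMeasure P,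
      (regularRings t ω.1).foldl (applyRing ω.2) X = chainState X t ω := by
    have h1 : ∀ᵐ ω ∂chainMeasure P, regularRings t ω.1 = ringsUpTo ω.1 t :=
      quasiMeasurePreserving_fst.ae (regularRings_ae_eq t)
    filter_upwards [h1] with ω hω
    rw [chainState, hω]
  have : IsProbabilityMeasure (chainMeasure P) := by unfold chainMeasure; infer_instance
  rw [show ∑ σ, chainLaw P X t σ * φ σ = ∑ σ, (chainMeasure P).real
      {ω | (regularRings t ω.1).foldl (applyRing ω.2) X = σ} * φ σ from ?_,
    ← integral_comp_eq_sum hm.aemeasurable]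
  · obtain ⟨c, hc⟩ := exists_abs_le_of_finite φ
    rw [chainMeasure, integral_prod]
    · refine integral_congr_ae ?_
      filter_upwards [regularRings_ae_eq t] with w hw
      rw [← hw]
      exact integral_foldl_applyRing P _ (nodup_regularRings t w) φ X
    · exact integrable_comp_of_finite hm.aemeasurable φ
  · refine Finset.sum_congr rfl fun σ _ => ?_
    rw [chainLaw]
    congr 1
    refine measureReal_congr ?_
    filter_upwards [hae] with ω hω
    exact propext ⟨fun h => hω.trans h, fun h => hω.symm.trans h⟩

end ChainExpectation

/-! ### Restarting the Poisson clocks -/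

section Restart

open Measure ProbabilityTheory

variable {V : Type*}

/-- The waiting times seen by an observer who starts the clock at `u` at time `d u`, provided that
no clock has rung before. -/
noncomputable def restart (d : V → ℝ) (w : V × ℕ → ℝ) : V × ℕ → ℝ :=
  fun e => if e.2 = 0 then w e - d e.1 else w e

theorem measurable_restart (d : V → ℝ) : Measurable (restart d) := by
  refine measurable_pi_iff.2 fun e => ?_
  unfold restart
  split_ifs
  · exact (measurable_pi_apply e).sub_const _
  · exact measurable_pi_apply e

theorem ringTime_restart (d : V → ℝ) (w : V × ℕ → ℝ) (e : V × ℕ) :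
    ringTime (restart d w) e = ringTime w e - d e.1 := by
  rw [ringTime, ringTime, Finset.sum_range_succ', Finset.sum_range_succ']
  simp only [restart]
  simp
  ring

/-- No clock rings before the time assigned to its site. -/
def quietUntil (d : V → ℝ) : Set (V × ℕ → ℝ) := {w | ∀ u, d u < w (u, 0)}

theorem measurableSet_quietUntil [Countable V] (d : V → ℝ) : MeasurableSet (quietUntil d) := by
  unfold quietUntil
  simp only [Set.ofPred_forall]
  exact MeasurableSet.iInter fun u => measurableSet_lt measurable_const (measurable_pi_apply _)

/-- The clocks are memoryless. -/
theorem map_restart [Fintype V] {d : V → ℝ} (hd : ∀ u, 0 ≤ d u) :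
    ((clockMeasure V).restrict (quietUntil d)).map (restart d) =
      ENNReal.ofReal (Real.exp (-∑ u, d u)) • clockMeasure V := by
  classical
  set c := ENNReal.ofReal (Real.exp (-∑ u, d u)) with hc
  have hc0 : c ≠ 0 := (ENNReal.ofReal_pos.2 (Real.exp_pos _)).ne'
  have hct : c ≠ ∞ := ENNReal.ofReal_ne_top
  suffices h : c⁻¹ • ((clockMeasure V).restrict (quietUntil d)).map (restart d) = clockMeasure V by
    conv_rhs => rw [← h, smul_smul, ENNReal.mul_inv_cancel hc0 hct, one_smul]
  refine eq_infinitePi _ fun s t ht => ?_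
  have hbox : MeasurableSet ((s : Set (V × ℕ)).pi t) := .pi s.countable_toSet fun i _ => ht i
  rw [Measure.smul_apply, map_apply (measurable_restart d) hbox,
    restrict_apply (measurable_restart d hbox), smul_eq_mul]
  let t' : V × ℕ → Set ℝ := fun i => if i ∈ s then t i else Set.univ
  have ht' : ∀ i, MeasurableSet (t' i) := fun i => by
    simp only [t']; split_ifs
    · exact ht i
    · exact MeasurableSet.univ
  let s' : Finset (V × ℕ) := s ∪ Finset.univ.map ⟨fun u => (u, 0), fun u u' h => (Prod.ext_iff.1 h).1⟩
  let T : V × ℕ → Set ℝ := fun i => if i.2 = 0 then {y | d i.1 < y ∧ y - d i.1 ∈ t' i} else t' i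
  have hmem0 : ∀ u : V, (u, 0) ∈ s' := fun u =>
    Finset.mem_union_right _ (Finset.mem_map.2 ⟨u, Finset.mem_univ u, rfl⟩)
  have hset : restart d ⁻¹' ((s : Set (V × ℕ)).pi t) ∩ quietUntil d = (s' : Set (V × ℕ)).pi T := by
    ext w
    constructor
    · rintro ⟨h1, h2⟩ ⟨u, i⟩ _
      by_cases hi : i = 0
      · subst hi
        simp only [T, if_pos]
        refine ⟨h2 u, ?_⟩
        simp only [t']
        split_ifs with hs
        · simpa [restart] using h1 (u, 0) hs
        · trivial
      · simp only [T, hi, if_false, t']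
        split_ifs with hs
        · simpa [restart, hi] using h1 (u, i) hs
        · trivial
    · intro h
      refine ⟨?_, fun u => ?_⟩
      · rintro ⟨u, i⟩ hs
        have h1 := h (u, i) (Finset.mem_coe.2 (Finset.mem_union_left _ hs))
        have hs' : (u, i) ∈ s := hs
        by_cases hi : i = 0
        · subst hi
          simp only [T, if_pos, t', hs'] at h1
          simpa [restart] using h1.2
        · simp only [T, hi, if_false, t', hs', if_true] at h1
          simpa [restart, hi] using h1
      · have h1 := h (u, 0) (Finset.mem_coe.2 (hmem0 u))
        simp only [T, if_pos] at h1
        exact h1.1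
  have hT : ∀ i, expMeasure 1 (T i) =
      (if i.2 = 0 then ENNReal.ofReal (Real.exp (-d i.1)) else 1) * expMeasure 1 (t' i) := by
    intro i
    simp only [T]
    split_ifs
    · exact expMeasure_memoryless (hd _) (ht' i)
    · rw [one_mul]
  have hTm : ∀ i, MeasurableSet (T i) := fun i => by
    simp only [T]; split_ifs
    · exact measurableSet_Ioi.inter ((ht' i).preimage (measurable_id.sub_const _))
    · exact ht' i
  rw [hset, infinitePi_pi _ fun i _ => hTm i]
  simp_rw [hT]
  have h1 : ∏ i ∈ s', expMeasure 1 (t' i) = ∏ i ∈ s, expMeasure 1 (t i) := by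
    rw [← Finset.prod_subset (Finset.subset_union_left : s ⊆ s')]
    · refine Finset.prod_congr rfl fun i hi => ?_
      simp [t', hi]
    · intro i _ hi
      simp [t', hi]
  have h2 : ∏ i ∈ s', (if i.2 = 0 then ENNReal.ofReal (Real.exp (-d i.1)) else 1) = c := by
    rw [← Finset.prod_filter, show s'.filter (fun i => i.2 = 0) =
      Finset.univ.map ⟨fun u => (u, 0), fun u u' h => (Prod.ext_iff.1 h).1⟩ from ?_,
      Finset.prod_map, hc, ← Finset.sum_neg_distrib, Real.exp_sum, ENNReal.ofReal_prod_of_nonneg]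
    · rfl
    · exact fun _ _ => Real.exp_nonneg _
    · ext ⟨u, i⟩
      simp only [Finset.mem_filter, Finset.mem_map, Finset.mem_univ, true_and]
      constructor
      · rintro ⟨-, rfl⟩; exact ⟨u, rfl⟩
      · rintro ⟨u', h⟩
        obtain ⟨rfl, rfl⟩ := Prod.mk.inj h
        exact ⟨hmem0 _, rfl⟩
  rw [Finset.prod_mul_distrib, h1, h2, ← mul_assoc, ENNReal.inv_mul_cancel hc0 hct, one_mul]

/-- An i.i.d. family restricted to an injectively chosen subfamily is an i.i.d. family. -/
theorem infinitePi_map_comp_injective {ι κ Y : Type*} [MeasurableSpace Y] (μ : Measure Y)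
    [IsProbabilityMeasure μ] {ψ : ι → κ} (hψ : Function.Injective ψ) :
    (infinitePi fun _ : κ => μ).map (fun w => w ∘ ψ) = infinitePi fun _ : ι => μ := by
  classical
  have hm : Measurable fun w : κ → Y => w ∘ ψ :=
    measurable_pi_iff.2 fun i => measurable_pi_apply (ψ i)
  refine eq_infinitePi _ fun s t ht => ?_
  rw [map_apply hm (.pi s.countable_toSet fun i _ => ht i)]
  rcases isEmpty_or_nonempty ι with h | h
  · obtain rfl : s = ∅ := Finset.eq_empty_of_isEmpty s
    simp
  have hset : (fun w : κ → Y => w ∘ ψ) ⁻¹' ((s : Set ι).pi t) =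
      ((s.map ⟨ψ, hψ⟩ : Finset κ) : Set κ).pi fun j => t (Function.invFun ψ j) := by
    ext w
    simp [Function.leftInverse_invFun hψ _]
  rw [hset, infinitePi_pi _ fun i _ => ht _, Finset.prod_map]
  simp [Function.leftInverse_invFun hψ _]

variable [DecidableEq V]

/-- The relabelling of the rings after the first ring at `v`. -/
def ringShift (v : V) (e : V × ℕ) : V × ℕ := if e.1 = v then (e.1, e.2 + 1) else e

theorem ringShift_injective (v : V) : Function.Injective (ringShift v) := by
  rintro ⟨u, i⟩ ⟨u', i'⟩ h
  unfold ringShift at h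
  split_ifs at h with h1 h2 h2 <;> simp_all

theorem ringShift_fst (v : V) (e : V × ℕ) : (ringShift v e).1 = e.1 := by
  unfold ringShift; split_ifs <;> rfl

theorem ringShift_ne (v : V) (e : V × ℕ) : ringShift v e ≠ (v, 0) := by
  unfold ringShift
  split_ifs with h
  · intro h'; simpa using congrArg Prod.snd h'
  · intro h'; exact h (congrArg Prod.fst h')

theorem exists_ringShift_eq {v : V} {e : V × ℕ} (he : e ≠ (v, 0)) : ∃ e', ringShift v e' = e := by
  obtain ⟨u, i⟩ := e
  by_cases hu : u = v
  · subst hu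
    obtain ⟨j, rfl⟩ := Nat.exists_eq_succ_of_ne_zero (n := i) fun h => he (by rw [h])
    exact ⟨(u, j), by simp [ringShift]⟩
  · exact ⟨(u, i), by simp [ringShift, hu]⟩

/-- The time by which each clock has to be advanced to restart at time `δ`, if the first ring at `v`
was at time `a` and its waiting time has been removed. -/
def restartDelay (δ : ℝ) (v : V) (a : ℝ) (u : V) : ℝ := if u = v then δ - a else δ

/-- The clock at `v` rings exactly once up to time `δ`, and no other clock does. -/
def ringsOnce (δ : ℝ) (v : V) : Set (V × ℕ → ℝ) :=
  {w | w (v, 0) ≤ δ ∧ w ∘ ringShift v ∈ quietUntil (restartDelay δ v (w (v, 0)))}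

/-- The waiting times seen by an observer who starts at time `δ`, on the event `ringsOnce δ v`. -/
noncomputable def restartAfter (δ : ℝ) (v : V) (w : V × ℕ → ℝ) : V × ℕ → ℝ :=
  restart (restartDelay δ v (w (v, 0))) (w ∘ ringShift v)

theorem measurable_restartDelay (δ : ℝ) (v u : V) :
    Measurable fun w : V × ℕ → ℝ => restartDelay δ v (w (v, 0)) u := by
  unfold restartDelay
  split_ifs
  · exact measurable_const.sub (measurable_pi_apply _)
  · exact measurable_const

theorem measurable_restartAfter (δ : ℝ) (v : V) : Measurable (restartAfter δ v) := by
  refine measurable_pi_iff.2 fun e => ?_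
  unfold restartAfter restart
  split_ifs
  · exact (measurable_pi_apply _).sub (measurable_restartDelay δ v _)
  · exact measurable_pi_apply _

theorem measurableSet_ringsOnce [Countable V] (δ : ℝ) (v : V) :
    MeasurableSet (ringsOnce δ v) := by
  refine (measurableSet_le (measurable_pi_apply _) measurable_const).inter ?_
  have : {w : V × ℕ → ℝ | w ∘ ringShift v ∈ quietUntil (restartDelay δ v (w (v, 0)))} =
      ⋂ u, {w : V × ℕ → ℝ | restartDelay δ v (w (v, 0)) u < w (ringShift v (u, 0))} := by
    ext w
    simp [quietUntil]
  change MeasurableSet {w : V × ℕ → ℝ | w ∘ ringShift v ∈ quietUntil (restartDelay δ v (w (v, 0)))}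
  rw [this]
  exact MeasurableSet.iInter fun u => measurableSet_lt (measurable_restartDelay δ v u)
    (measurable_pi_apply _)

theorem map_restartAfter [Fintype V] {δ : ℝ} (hδ : 0 ≤ δ) (v : V) :
    ((clockMeasure V).restrict (ringsOnce δ v)).map (restartAfter δ v) =
      ENNReal.ofReal (δ * Real.exp (-(Fintype.card V * δ))) • clockMeasure V := by
  ext B hB
  have hB' := measurable_restartAfter δ v hB
  have hm : MeasurableSet (restartAfter δ v ⁻¹' B ∩ ringsOnce δ v) :=
    hB'.inter (measurableSet_ringsOnce δ v)
  rw [map_apply (measurable_restartAfter δ v) hB, restrict_apply hB', Measure.smul_apply, smul_eq_mul,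
    ← lintegral_indicator_one hm, lintegral_infinitePi_mixOn _ {(v, 0)}ᶜ
      (measurable_one.indicator hm)]
  have h1 : ∀ x y : V × ℕ → ℝ, mixOn {(v, 0)}ᶜ x y (v, 0) = x (v, 0) := fun x y =>
    mixOn_of_notMem (by simp) _ _
  have h2 : ∀ x y : V × ℕ → ℝ, mixOn {(v, 0)}ᶜ x y ∘ ringShift v = y ∘ ringShift v := fun x y =>
    funext fun e => mixOn_of_mem (by simpa using ringShift_ne v e) _ _
  have h3 : ∀ x, ∫⁻ y, (restartAfter δ v ⁻¹' B ∩ ringsOnce δ v).indicator 1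
      (mixOn {(v, 0)}ᶜ x y) ∂clockMeasure V = (Set.Iic δ).indicator (fun a =>
        ENNReal.ofReal (Real.exp (-(δ - a))) *
          (ENNReal.ofReal (Real.exp (-((Fintype.card V - 1) * δ))) * clockMeasure V B))
            (x (v, 0)) := by
    intro x
    by_cases ha : x (v, 0) ≤ δ
    · rw [Set.indicator_of_mem (show x (v, 0) ∈ Set.Iic δ from ha)]
      set d := restartDelay δ v (x (v, 0)) with hd
      have hd0 : ∀ u, 0 ≤ d u := fun u => by
        simp only [hd, restartDelay]; split_ifs
        · linarith
        · exact hδ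
      have hsum : ∑ u, d u = (δ - x (v, 0)) + (Fintype.card V - 1) * δ := by
        simp only [hd, restartDelay]
        rw [← Finset.add_sum_erase _ _ (Finset.mem_univ v), if_pos rfl]
        congr 1
        rw [Finset.sum_congr rfl (g := fun _ => δ) fun u hu => if_neg (Finset.ne_of_mem_erase hu)]
        rw [Finset.sum_const, Finset.card_erase_of_mem (Finset.mem_univ v), Finset.card_univ,
          nsmul_eq_mul, Nat.cast_sub (Fintype.card_pos_iff.2 ⟨v⟩), Nat.cast_one]
      have hq : MeasurableSet (restart d ⁻¹' B ∩ quietUntil d) :=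
        (measurable_restart d hB).inter (measurableSet_quietUntil d)
      have hcomp : Measurable fun w : V × ℕ → ℝ => w ∘ ringShift v :=
        measurable_pi_iff.2 fun i => measurable_pi_apply _
      have h4 : ∀ y, (restartAfter δ v ⁻¹' B ∩ ringsOnce δ v).indicator (1 : (V × ℕ → ℝ) → ℝ≥0∞)
          (mixOn {(v, 0)}ᶜ x y) =
          ((fun w : V × ℕ → ℝ => w ∘ ringShift v) ⁻¹' (restart d ⁻¹' B ∩ quietUntil d)).indicator
            1 y := by
        intro y
        refine Set.indicator_eq_indicator ?_ rfl
        simp only [Set.mem_inter_iff, Set.mem_preimage, restartAfter, ringsOnce, Set.mem_ofPred_eq,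
          h1, h2, ha, true_and, hd]
      simp_rw [h4]
      rw [lintegral_indicator_one (hcomp hq), ← map_apply hcomp hq,
        infinitePi_map_comp_injective _ (ringShift_injective v),
        ← restrict_apply (measurable_restart d hB), ← map_apply (measurable_restart d) hB,
        map_restart hd0, Measure.smul_apply, smul_eq_mul, hsum, neg_add, Real.exp_add,
        ENNReal.ofReal_mul (Real.exp_nonneg _), mul_assoc]
    · rw [Set.indicator_of_notMem (show x (v, 0) ∉ Set.Iic δ from ha)]
      refine (lintegral_congr fun y => ?_).trans lintegral_zero
      refine Set.indicator_of_notMem ?_ _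
      rintro ⟨-, h, -⟩
      rw [h1] at h
      exact ha h
  simp_rw [h3]
  have hmeas : Measurable ((Set.Iic δ).indicator fun a => ENNReal.ofReal (Real.exp (-(δ - a))) *
      (ENNReal.ofReal (Real.exp (-((Fintype.card V - 1) * δ))) * clockMeasure V B)) :=
    Measurable.indicator (by fun_prop) measurableSet_Iic
  rw [← lintegral_map (μ := clockMeasure V) (g := fun x => x (v, 0)) hmeas (measurable_pi_apply _),
    infinitePi_map_eval, lintegral_indicator measurableSet_Iic, lintegral_mul_const _ (by fun_prop),
    setLIntegral_expMeasure_exp hδ, ← mul_assoc, ← ENNReal.ofReal_mul (by positivity),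
    mul_assoc δ, ← Real.exp_add]
  congr 4
  ring

end Restart

section ChainStep

open Measure ProbabilityTheory

variable {V : Type*}

theorem ringsUpTo_restart {δ t : ℝ} {w : V × ℕ → ℝ} (hw : w ∈ regularClocks V (t + δ)) :
    ringsUpTo w (t + δ) = ringsUpTo (restart (fun _ => δ) w) t := by
  have hfin : {e : V × ℕ | ringTime (restart (fun _ => δ) w) e ≤ t}.Finite := by
    refine hw.2.subset fun e he => ?_
    simp only [Set.mem_ofPred_eq, ringTime_restart] at he ⊢
    linarith
  refine (eq_ringsUpTo hw.1 hw.2 (nodup_ringsUpTo _ _) (fun e => ?_) ?_).symm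
  · rw [mem_ringsUpTo hfin, ringTime_restart, _root_.sub_le_iff_le_add]
  · refine (pairwise_ringsUpTo _ _).imp fun h => ?_
    simpa only [ringTime_restart, sub_le_sub_iff_right] using h

variable [DecidableEq V]

theorem ringTime_ringShift (δ : ℝ) (v : V) (w : V × ℕ → ℝ) (e : V × ℕ) :
    ringTime w (ringShift v e) = ringTime (restartAfter δ v w) e + δ := by
  rw [restartAfter, ringTime_restart]
  obtain ⟨u, i⟩ := e
  by_cases hu : u = v
  · subst hu
    simp only [ringTime, ringShift, restartDelay, if_true, Function.comp]
    rw [Finset.sum_range_succ']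
    ring
  · simp [ringTime, ringShift, restartDelay, hu]

theorem restartAfter_pos {δ : ℝ} {v : V} {w : V × ℕ → ℝ} (hpos : ∀ e, 0 < w e)
    (hw : w ∈ ringsOnce δ v) (e : V × ℕ) : 0 < restartAfter δ v w e := by
  obtain ⟨u, i⟩ := e
  simp only [restartAfter, restart]
  split_ifs with hi
  · obtain rfl : i = 0 := hi
    have := hw.2 u
    linarith
  · exact hpos _

theorem sites_ringsOnce {δ t : ℝ} (ht : 0 ≤ t) {v : V} {w : V × ℕ → ℝ}
    (hreg : w ∈ regularClocks V (t + δ)) (hpos : ∀ e, 0 < w e) (hw : w ∈ ringsOnce δ v) :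
    (ringsUpTo w (t + δ)).map Prod.fst =
      v :: (ringsUpTo (restartAfter δ v w) t).map Prod.fst := by
  have hpos' := restartAfter_pos hpos hw
  have hnn : ∀ e, 0 ≤ ringTime (restartAfter δ v w) e := fun e =>
    (hpos' e).le.trans (le_ringTime hpos' e)
  have hfin : {e : V × ℕ | ringTime (restartAfter δ v w) e ≤ t}.Finite := by
    refine (hreg.2.preimage (ringShift_injective v).injOn).subset fun e he => ?_
    simp only [Set.mem_preimage, Set.mem_ofPred_eq, ringTime_ringShift δ v w] at he ⊢
    linarith
  have h0 : ringTime w (v, 0) ≤ δ := by rw [ringTime_zero]; exact hw.1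
  have key : (v, 0) :: (ringsUpTo (restartAfter δ v w) t).map (ringShift v) =
      ringsUpTo w (t + δ) := by
    refine eq_ringsUpTo hreg.1 hreg.2 ?_ (fun e => ?_) ?_
    · refine List.nodup_cons.2 ⟨fun h => ?_, (nodup_ringsUpTo _ _).map (ringShift_injective v)⟩
      obtain ⟨e, -, he⟩ := List.mem_map.1 h
      exact ringShift_ne v e he
    · rw [List.mem_cons, List.mem_map]
      constructor
      · rintro (rfl | ⟨e', he', rfl⟩)
        · linarith
        · rw [mem_ringsUpTo hfin] at he'
          rw [ringTime_ringShift δ]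
          linarith
      · intro he
        by_cases h : e = (v, 0)
        · exact Or.inl h
        · obtain ⟨e', rfl⟩ := exists_ringShift_eq h
          refine Or.inr ⟨e', ?_, rfl⟩
          rw [mem_ringsUpTo hfin]
          rw [ringTime_ringShift δ] at he
          linarith
    · refine List.pairwise_cons.2 ⟨fun e he => ?_, ?_⟩
      · obtain ⟨e', -, rfl⟩ := List.mem_map.1 he
        rw [ringTime_ringShift δ]
        linarith [hnn e']
      · refine List.pairwise_map.2 ((pairwise_ringsUpTo _ _).imp fun h => ?_)
        rw [ringTime_ringShift δ, ringTime_ringShift δ]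
        linarith
  rw [← key, List.map_cons, List.map_map]
  congr 2
  exact funext fun e => ringShift_fst v e

variable [Fintype V] {G : SimpleGraph V} {q : ℕ}

theorem setIntegral_quietUntil (P : LocalRule G q) (φ : (V → Fin q) → ℝ) {δ t : ℝ} (hδ : 0 ≤ δ)
    (X : V → Fin q) :
    ∫ w in quietUntil fun _ => δ, listOp P ((ringsUpTo w (t + δ)).map Prod.fst) φ X
      ∂clockMeasure V = Real.exp (-(Fintype.card V * δ)) * chainMean P φ t X := by
  have hmap := map_restart (V := V) (d := fun _ => δ) fun _ => hδ
  rw [integral_congr_ae (g := fun w => listOp P ((ringsUpTo (restart (fun _ => δ) w) t).map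
    Prod.fst) φ X), ← integral_map (f := fun w => listOp P ((ringsUpTo w t).map Prod.fst) φ X)
      (measurable_restart _).aemeasurable, hmap,
    integral_smul_measure, ENNReal.toReal_ofReal (Real.exp_nonneg _), smul_eq_mul,
    Finset.sum_const, Finset.card_univ, nsmul_eq_mul]
  · rfl
  · rw [hmap]
    exact (aemeasurable_listOp_ringsUpTo P φ t X).aestronglyMeasurable.smul_measure _
  · filter_upwards [ae_restrict_of_ae (ae_mem_regularClocks (t + δ))] with w hw
    rw [ringsUpTo_restart hw]

theorem setIntegral_ringsOnce (P : LocalRule G q) (φ : (V → Fin q) → ℝ) {δ t : ℝ} (hδ : 0 ≤ δ)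
    (ht : 0 ≤ t) (X : V → Fin q) (v : V) :
    ∫ w in ringsOnce δ v, listOp P ((ringsUpTo w (t + δ)).map Prod.fst) φ X ∂clockMeasure V =
      δ * Real.exp (-(Fintype.card V * δ)) * siteOp P v (chainMean P φ t) X := by
  have hmap := map_restartAfter (V := V) hδ v
  have h0 : 0 ≤ δ * Real.exp (-(Fintype.card V * δ)) := by positivity
  rw [integral_congr_ae (g := fun w => siteOp P v
    (listOp P ((ringsUpTo (restartAfter δ v w) t).map Prod.fst) φ) X), ← integral_map
      (f := fun w => siteOp P v (listOp P ((ringsUpTo w t).map Prod.fst) φ) X)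
      (measurable_restartAfter δ v).aemeasurable, hmap,
    integral_smul_measure, ENNReal.toReal_ofReal h0, smul_eq_mul]
  · congr 1
    unfold siteOp
    rw [integral_finsetSum]
    · simp_rw [integral_const_mul]
      rfl
    · exact fun x _ => (integrable_listOp_ringsUpTo P φ t _).const_mul _
  · rw [hmap]
    refine AEStronglyMeasurable.smul_measure (AEMeasurable.aestronglyMeasurable ?_) _
    unfold siteOp
    exact Finset.aemeasurable_fun_sum _ fun x _ =>
      (aemeasurable_listOp_ringsUpTo P φ t _).const_mul _
  · filter_upwards [ae_restrict_of_ae (ae_mem_regularClocks (t + δ)),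
      ae_restrict_of_ae ae_waiting_pos, ae_restrict_mem (measurableSet_ringsOnce δ v)] with w h1 h2 h3
    rw [sites_ringsOnce ht h1 h2 h3]
    rfl

omit [DecidableEq V] in
theorem measureReal_quietUntil {δ : ℝ} (hδ : 0 ≤ δ) :
    (clockMeasure V).real (quietUntil fun _ => δ) = Real.exp (-(Fintype.card V * δ)) := by
  have h := congrArg (fun μ => μ Set.univ) (map_restart (V := V) (d := fun _ => δ) fun _ => hδ)
  simp only [map_apply (measurable_restart _) MeasurableSet.univ, Set.preimage_univ,
    restrict_apply_univ, Measure.smul_apply, measure_univ, smul_eq_mul, mul_one, Finset.sum_const,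
    Finset.card_univ, nsmul_eq_mul] at h
  rw [measureReal_def, h, ENNReal.toReal_ofReal (Real.exp_nonneg _)]

theorem measureReal_ringsOnce {δ : ℝ} (hδ : 0 ≤ δ) (v : V) :
    (clockMeasure V).real (ringsOnce δ v) = δ * Real.exp (-(Fintype.card V * δ)) := by
  have h := congrArg (fun μ => μ Set.univ) (map_restartAfter (V := V) hδ v)
  simp only [map_apply (measurable_restartAfter δ v) MeasurableSet.univ, Set.preimage_univ,
    restrict_apply_univ, Measure.smul_apply, measure_univ, smul_eq_mul, mul_one] at h
  rw [measureReal_def, h, ENNReal.toReal_ofReal (by positivity)]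

/-- The Euler step of length `δ` for the generator of the continuous-time chain. -/
noncomputable def eulerStep (P : LocalRule G q) (δ : ℝ) (f : (V → Fin q) → ℝ) (X : V → Fin q) : ℝ :=
  f X + δ * ∑ v, (siteOp P v f X - f X)

/-- Conditioning on the rings up to time `δ`: with probability `1 - O((nδ)²)` there is at most
one. -/
theorem abs_chainMean_sub_eulerStep_le (P : LocalRule G q) {φ : (V → Fin q) → ℝ} {c : ℝ}
    (hφ : ∀ X, |φ X| ≤ c) {δ t : ℝ} (hδ : 0 ≤ δ) (ht : 0 ≤ t) (hn : Fintype.card V * δ ≤ 1)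
    (X : V → Fin q) :
    |chainMean P φ (t + δ) X - eulerStep P δ (chainMean P φ t) X| ≤
      3 * c * (Fintype.card V * δ) ^ 2 := by
  set n : ℝ := (Fintype.card V : ℝ) with hn'
  set x := n * δ with hx
  have hx0 : 0 ≤ x := by positivity
  have hc : 0 ≤ c := (abs_nonneg _).trans (hφ X)
  set F := fun w => listOp P ((ringsUpTo w (t + δ)).map Prod.fst) φ X with hF
  have hFi : Integrable F (clockMeasure V) := integrable_listOp_ringsUpTo P φ (t + δ) X
  let A : Option V → Set (V × ℕ → ℝ) := fun o => o.elim (quietUntil fun _ => δ) fun v => ringsOnce δ v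
  have hA : ∀ o, MeasurableSet (A o) := by
    rintro (_ | v)
    · exact measurableSet_quietUntil _
    · exact measurableSet_ringsOnce δ v
  have hd0 : ∀ v : V, Disjoint (quietUntil fun _ => δ) (ringsOnce δ v) := fun v =>
    Set.disjoint_left.2 fun w h1 h2 => absurd h2.1 (not_le.2 (h1 v))
  have hdisj : Pairwise (Function.onFun Disjoint A) := by
    rintro (_ | v) (_ | v') hne
    · exact absurd rfl hne
    · exact hd0 v'
    · exact (hd0 v).symm
    · refine Set.disjoint_left.2 fun w h1 h2 => ?_
      have hvv : v ≠ v' := fun h => hne (by rw [h])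
      have h3 := h2.2 v
      simp only [restartDelay, hvv, if_false, ringShift, Function.comp] at h3
      exact absurd h1.1 (not_le.2 h3)
  have hU : MeasurableSet (⋃ o, A o) := MeasurableSet.iUnion hA
  have hsplit : ∫ w, F w ∂clockMeasure V =
      (∑ o, ∫ w in A o, F w ∂clockMeasure V) + ∫ w in (⋃ o, A o)ᶜ, F w ∂clockMeasure V := by
    rw [← integral_add_compl hU hFi, integral_iUnion_fintype hA hdisj fun o => hFi.integrableOn]
  have hmass : (clockMeasure V).real (⋃ o, A o)ᶜ = 1 - (1 + x) * Real.exp (-x) := by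
    rw [probReal_compl_eq_one_sub hU, measureReal_iUnion_fintype hdisj hA, Fintype.sum_option]
    simp only [A, Option.elim]
    rw [measureReal_quietUntil hδ]
    simp_rw [measureReal_ringsOnce hδ]
    rw [Finset.sum_const, Finset.card_univ, nsmul_eq_mul]
    ring
  have hrest : |∫ w in (⋃ o, A o)ᶜ, F w ∂clockMeasure V| ≤ c * (1 - (1 + x) * Real.exp (-x)) := by
    have := norm_setIntegral_le_of_norm_le_const (μ := clockMeasure V) (s := (⋃ o, A o)ᶜ) (f := F)
      (C := c) (measure_lt_top _ _) (fun w _ => abs_listOp_le P _ hφ X)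
    rwa [hmass] at this
  set u := chainMean P φ t with hu
  have hub : ∀ Y, |u Y| ≤ c := abs_chainMean_le P hφ t
  set S := ∑ v, siteOp P v u X with hS
  have hSb : |S| ≤ n * c := by
    refine (Finset.abs_sum_le_sum_abs _ _).trans ?_
    refine (Finset.sum_le_sum fun v _ => abs_siteOp_le P v hub X).trans ?_
    rw [Finset.sum_const, Finset.card_univ, nsmul_eq_mul]
  have hval : chainMean P φ (t + δ) X = Real.exp (-x) * (u X + δ * S) +
      ∫ w in (⋃ o, A o)ᶜ, F w ∂clockMeasure V := by
    change ∫ w, F w ∂clockMeasure V = _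
    rw [hsplit, Fintype.sum_option]
    congr 1
    simp only [A, Option.elim, hF]
    rw [setIntegral_quietUntil P φ hδ]
    simp_rw [setIntegral_ringsOnce P φ hδ ht]
    rw [← Finset.mul_sum]
    ring
  have heul : eulerStep P δ u X = (1 - x) * u X + δ * S := by
    rw [eulerStep, Finset.sum_sub_distrib, Finset.sum_const, Finset.card_univ, nsmul_eq_mul]
    ring
  have he1 : 1 - x ≤ Real.exp (-x) := by linarith [Real.add_one_le_exp (-x)]
  have he2 : |Real.exp (-x) - 1 - -x| ≤ (-x) ^ 2 :=
    Real.abs_exp_sub_one_sub_id_le (by rw [abs_neg, abs_of_nonneg hx0]; exact hn)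
  have he3 : Real.exp (-x) ≤ 1 := Real.exp_le_one_iff.2 (by linarith)
  rw [neg_sq, abs_le] at he2
  have hdS : |δ * S| ≤ c * x := by
    rw [abs_mul, abs_of_nonneg hδ]
    calc δ * |S| ≤ δ * (n * c) := mul_le_mul_of_nonneg_left hSb hδ
      _ = c * x := by ring
  have h1 : |(Real.exp (-x) - (1 - x)) * u X| ≤ x ^ 2 * c := by
    rw [abs_mul]
    refine mul_le_mul ?_ (hub X) (abs_nonneg _) (sq_nonneg x)
    rw [abs_le]
    constructor <;> linarith [sq_nonneg x]
  have h2 : |(Real.exp (-x) - 1) * (δ * S)| ≤ x * (c * x) := by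
    rw [abs_mul]
    refine mul_le_mul ?_ hdS (abs_nonneg _) hx0
    rw [abs_le]
    constructor <;> linarith
  have h3 : c * (1 - (1 + x) * Real.exp (-x)) ≤ c * x ^ 2 := by
    refine mul_le_mul_of_nonneg_left ?_ hc
    nlinarith
  have hfin : chainMean P φ (t + δ) X - eulerStep P δ u X =
      (Real.exp (-x) - (1 - x)) * u X + (Real.exp (-x) - 1) * (δ * S) +
        ∫ w in (⋃ o, A o)ᶜ, F w ∂clockMeasure V := by
    rw [hval, heul]; ring
  rw [hfin]
  refine (abs_add_le _ _).trans ((add_le_add (abs_add_le _ _) le_rfl).trans ?_)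
  linarith

end ChainStep

/-! ### Universal coupling of finitely many distributions -/

section UniversalCoupling

open Measure

/-- In an i.i.d. sequence, the first term in `B` lies in `A ⊆ B` with probability `γ A / γ B`. -/
theorem infinitePi_firstHit {Y : Type*} [MeasurableSpace Y] (γ : Measure Y) [IsProbabilityMeasure γ]
    {A B : Set Y} (hA : MeasurableSet A) (hB : MeasurableSet B) (hAB : A ⊆ B) :
    (infinitePi fun _ : ℕ => γ) {ω | ∃ k, (∀ l < k, ω l ∉ B) ∧ ω k ∈ A} = γ A / γ B := by
  let E : ℕ → Set (ℕ → Y) := fun k => {ω | (∀ l < k, ω l ∉ B) ∧ ω k ∈ A}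
  have hE : ∀ k, E k = ((Finset.range (k + 1) : Finset ℕ) : Set ℕ).pi
      fun l => if l = k then A else Bᶜ := by
    intro k
    ext ω
    simp only [E, Set.mem_ofPred_eq, Set.mem_pi, Finset.mem_coe, Finset.mem_range]
    constructor
    · rintro ⟨h1, h2⟩ l hl
      split_ifs with h
      · rwa [h]
      · exact h1 l (by omega)
    · intro h
      refine ⟨fun l hl => ?_, by simpa using h k (by omega)⟩
      have := h l (by omega)
      rwa [if_neg (by omega)] at this
  have hm : ∀ k l : ℕ, MeasurableSet (if l = k then A else Bᶜ) := fun k l => by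
    split_ifs
    · exact hA
    · exact hB.compl
  have hEm : ∀ k, MeasurableSet (E k) := fun k => by
    rw [hE]
    exact .pi (Finset.countable_toSet _) fun l _ => hm k l
  have hdisj : Pairwise (Function.onFun Disjoint E) := by
    have h : ∀ k l, k < l → Disjoint (E k) (E l) := fun k l hkl =>
      Set.disjoint_left.2 fun ω h1 h2 => h2.1 k hkl (hAB h1.2)
    intro k l hkl
    rcases lt_or_gt_of_ne hkl with h' | h'
    · exact h k l h'
    · exact (h l k h').symm
  have hμ : ∀ k, (infinitePi fun _ : ℕ => γ) (E k) = (1 - γ B) ^ k * γ A := by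
    intro k
    rw [hE, infinitePi_pi _ fun l _ => hm k l, Finset.prod_range_succ, if_pos rfl,
      Finset.prod_congr rfl (g := fun _ => 1 - γ B), Finset.prod_const, Finset.card_range]
    intro l hl
    rw [if_neg (Finset.mem_range.1 hl).ne, prob_compl_eq_one_sub hB]
  rw [show {ω : ℕ → Y | ∃ k, (∀ l < k, ω l ∉ B) ∧ ω k ∈ A} = ⋃ k, E k by ext; simp [E],
    measure_iUnion hdisj hEm]
  simp_rw [hμ]
  rw [ENNReal.tsum_mul_right, ENNReal.tsum_geometric,
    ENNReal.sub_sub_cancel ENNReal.one_ne_top prob_le_one, mul_comm, div_eq_mul_inv]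

/-- One trial of rejection sampling: a uniform spin and an independent uniform height. -/
noncomputable abbrev trialMeasure (q : ℕ) [NeZero q] : Measure (Fin q × unitInterval) :=
  (PMF.uniformOfFintype (Fin q)).toMeasure.prod volume

/-- The trials whose height lies below the graph of `f`. -/
def belowGraph {q : ℕ} (f : Fin q → ℝ) : Set (Fin q × unitInterval) := {z | (z.2 : ℝ) < f z.1}

theorem belowGraph_mono {q : ℕ} {f g : Fin q → ℝ} (h : ∀ x, f x ≤ g x) :
    belowGraph f ⊆ belowGraph g := fun z hz =>
  lt_of_lt_of_le (show (z.2 : ℝ) < f z.1 from hz) (h z.1)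

theorem measurableSet_belowGraph {q : ℕ} (f : Fin q → ℝ) : MeasurableSet (belowGraph f) :=
  measurableSet_lt (measurable_subtype_coe.comp measurable_snd)
    ((measurable_of_finite f).comp measurable_fst)

theorem trialMeasure_belowGraph {q : ℕ} [NeZero q] {f : Fin q → ℝ} (h0 : ∀ x, 0 ≤ f x)
    (h1 : ∀ x, f x ≤ 1) : (trialMeasure q).real (belowGraph f) = (∑ x, f x) / q := by
  have h2 : ∀ x, volume (Prod.mk x ⁻¹' belowGraph f) = ENNReal.ofReal (f x) := by
    intro x
    rw [← unitInterval.volume_Iio ⟨f x, h0 x, h1 x⟩]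
    rfl
  rw [measureReal_def, prod_apply (measurableSet_belowGraph f)]
  simp_rw [h2]
  rw [lintegral_fintype, ENNReal.toReal_sum fun x _ => by finiteness, Finset.sum_div]
  refine Finset.sum_congr rfl fun x _ => ?_
  rw [PMF.toMeasure_apply_singleton _ _ (measurableSet_singleton x), ENNReal.toReal_mul,
    ENNReal.toReal_ofReal (h0 x)]
  simp [div_eq_mul_inv]

open Classical in
/-- Rejection sampling: the spin of the first trial below the graph of `f`. -/
noncomputable def firstAccepted {q : ℕ} [NeZero q] (f : Fin q → ℝ)
    (ω : ℕ → Fin q × unitInterval) : Fin q :=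
  if h : ∃ k, ω k ∈ belowGraph f then (ω (Nat.find h)).1 else 0

theorem firstAccepted_eq {q : ℕ} [NeZero q] {f : Fin q → ℝ} {ω : ℕ → Fin q × unitInterval} {k : ℕ}
    (h1 : ∀ l < k, ω l ∉ belowGraph f) (h2 : ω k ∈ belowGraph f) :
    firstAccepted f ω = (ω k).1 := by
  classical
  have h : ∃ k, ω k ∈ belowGraph f := ⟨k, h2⟩
  rw [firstAccepted, dif_pos h, (Nat.find_eq_iff h).2 ⟨h2, h1⟩]

theorem measurable_firstAccepted {q : ℕ} [NeZero q] (f : Fin q → ℝ) :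
    Measurable (firstAccepted f) := by
  classical
  have hk : ∀ k, MeasurableSet {ω : ℕ → Fin q × unitInterval | ω k ∈ belowGraph f} := fun k =>
    measurable_pi_apply k (measurableSet_belowGraph f)
  refine measurable_to_countable' fun x => ?_
  have : firstAccepted f ⁻¹' {x} =
      (⋃ k, {ω | (∀ l < k, ω l ∉ belowGraph f) ∧ ω k ∈ belowGraph f ∧ (ω k).1 = x}) ∪
        {ω | (∀ k, ω k ∉ belowGraph f) ∧ (0 : Fin q) = x} := by
    ext ω
    simp only [Set.mem_preimage, Set.mem_singleton_iff, Set.mem_union, Set.mem_iUnion,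
      Set.mem_ofPred_eq]
    by_cases h : ∃ k, ω k ∈ belowGraph f
    · constructor
      · intro hx
        refine Or.inl ⟨Nat.find h, fun l hl => Nat.find_min h hl, Nat.find_spec h, ?_⟩
        rw [← hx, firstAccepted, dif_pos h]
      · rintro (⟨k, h1, h2, h3⟩ | ⟨h1, -⟩)
        · rw [firstAccepted_eq h1 h2, h3]
        · exact absurd h (not_exists.2 h1)
    · rw [firstAccepted, dif_neg h]
      constructor
      · exact fun hx => Or.inr ⟨not_exists.1 h, hx⟩
      · rintro (⟨k, -, h2, -⟩ | ⟨-, h2⟩)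
        · exact absurd ⟨k, h2⟩ h
        · exact h2
  rw [this]
  refine MeasurableSet.union (MeasurableSet.iUnion fun k => MeasurableSet.inter ?_
    ((hk k).inter ?_)) (MeasurableSet.inter ?_ (MeasurableSet.const _))
  · have : {ω : ℕ → Fin q × unitInterval | ∀ l < k, ω l ∉ belowGraph f} =
        ⋂ l, ⋂ (_ : l < k), {ω | ω l ∈ belowGraph f}ᶜ := by ext; simp
    change MeasurableSet {ω : ℕ → Fin q × unitInterval | ∀ l < k, ω l ∉ belowGraph f}
    rw [this]
    exact MeasurableSet.iInter fun l => MeasurableSet.iInter fun _ => (hk l).compl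
  · exact (measurable_fst.comp (measurable_pi_apply k)) (measurableSet_singleton x)
  · have : {ω : ℕ → Fin q × unitInterval | ∀ k, ω k ∉ belowGraph f} =
        ⋂ l, {ω | ω l ∈ belowGraph f}ᶜ := by ext; simp
    change MeasurableSet {ω : ℕ → Fin q × unitInterval | ∀ k, ω k ∉ belowGraph f}
    rw [this]
    exact MeasurableSet.iInter fun l => (hk l).compl

theorem sum_abs_sub_eq {Y : Type*} [Fintype Y] (f g : Y → ℝ) :
    ∑ x, max (f x) (g x) - ∑ x, min (f x) (g x) = ∑ x, |f x - g x| := by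
  rw [← Finset.sum_sub_distrib]
  exact Finset.sum_congr rfl fun x _ => max_sub_min_eq_abs' _ _

/-- All distributions of a finite family can be sampled simultaneously so that any two of the
samples differ with probability at most twice the total variation distance: rejection sampling with
common trials. -/
theorem exists_universalCoupling {I : Type*} [Finite I] {q : ℕ} [NeZero q] (μ : I → PMF (Fin q)) :
    ∃ ν : Measure (I → Fin q), IsProbabilityMeasure ν ∧
      (∀ i x, ν.real {z | z i = x} = (μ i x).toReal) ∧
      ∀ i j, ν.real {z | z i ≠ z j} ≤
        2 * tvDist (fun x => (μ i x).toReal) (fun x => (μ j x).toReal) := by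
  classical
  set f : I → Fin q → ℝ := fun i x => (μ i x).toReal with hf
  have hf0 : ∀ i x, 0 ≤ f i x := fun i x => ENNReal.toReal_nonneg
  have hfs : ∀ i, ∑ x, f i x = 1 := fun i => PMF.sum_toReal (μ i)
  have hf1 : ∀ i x, f i x ≤ 1 := fun i x => by
    rw [← hfs i]
    exact Finset.single_le_sum (fun y _ => hf0 i y) (Finset.mem_univ x)
  have hq : (0 : ℝ) < q := Nat.cast_pos.2 (NeZero.pos q)
  set Q := infinitePi fun _ : ℕ => trialMeasure q with hQ
  have hZ : Measurable fun (ω : ℕ → Fin q × unitInterval) i => firstAccepted (f i) ω :=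
    measurable_pi_iff.2 fun i => measurable_firstAccepted (f i)
  have hhit : ∀ A B : Set (Fin q × unitInterval), MeasurableSet A → MeasurableSet B → A ⊆ B →
      Q.real {ω | ∃ k, (∀ l < k, ω l ∉ B) ∧ ω k ∈ A} =
        (trialMeasure q).real A / (trialMeasure q).real B := by
    intro A B hA hB hAB
    rw [measureReal_def, infinitePi_firstHit _ hA hB hAB, ENNReal.toReal_div]
    rfl
  have hpre : ∀ S : Set (I → Fin q), (Q.map fun ω i => firstAccepted (f i) ω).real S =
      Q.real {ω | (fun i => firstAccepted (f i) ω) ∈ S} := fun S =>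
    map_measureReal_apply hZ (Set.toFinite S).measurableSet
  refine ⟨Q.map fun ω i => firstAccepted (f i) ω, isProbabilityMeasure_map hZ.aemeasurable,
    fun i => ?_, fun i j => ?_⟩
  · -- each atom has at least the prescribed mass, and both families of masses sum to one
    have hle : ∀ x, f i x ≤ Q.real {ω | firstAccepted (f i) ω = x} := by
      intro x
      have h1 : belowGraph (fun y => if y = x then f i y else 0) ⊆ belowGraph (f i) := by
        rintro ⟨y, s⟩ hs
        simp only [belowGraph, Set.mem_ofPred_eq] at hs ⊢
        split_ifs at hs
        · exact hs
        · exact absurd s.2.1 (not_le.2 hs)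
      have h2 := hhit _ _ (measurableSet_belowGraph _) (measurableSet_belowGraph _) h1
      rw [trialMeasure_belowGraph (fun y => by split_ifs <;> simp [hf0])
        (fun y => by split_ifs <;> simp [hf1]), trialMeasure_belowGraph (hf0 i) (hf1 i), hfs,
        Finset.sum_ite_eq' Finset.univ x, if_pos (Finset.mem_univ x), div_div_div_cancel_right₀ hq.ne',
        div_one] at h2
      rw [← h2]
      refine measureReal_mono ?_
      rintro ω ⟨k, hk1, hk2⟩
      have hk3 := firstAccepted_eq hk1 (h1 hk2)
      simp only [Set.mem_ofPred_eq]
      rw [hk3]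
      by_contra hne
      simp only [belowGraph, Set.mem_ofPred_eq, if_neg hne] at hk2
      exact absurd (ω k).2.2.1 (not_le.2 hk2)
    have hsum : ∑ x, Q.real {ω | firstAccepted (f i) ω = x} = ∑ x, f i x := by
      have := integral_comp_eq_sum (μ := Q) (measurable_firstAccepted (f i)).aemeasurable
        fun _ => (1 : ℝ)
      rw [hfs]
      simpa using this.symm
    intro x
    rw [hpre]
    exact ((Finset.sum_eq_sum_iff_of_le fun x _ => hle x).1 hsum.symm x (Finset.mem_univ x)).symm
  · have hmin0 : ∀ x, 0 ≤ min (f i x) (f j x) := fun x => le_min (hf0 i x) (hf0 j x)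
    have hmax1 : ∀ x, max (f i x) (f j x) ≤ 1 := fun x => max_le (hf1 i x) (hf1 j x)
    have h1 : belowGraph (fun y => min (f i y) (f j y)) ⊆
        belowGraph (fun y => max (f i y) (f j y)) := belowGraph_mono fun _ => min_le_max
    have h2 := hhit _ _ (measurableSet_belowGraph _) (measurableSet_belowGraph _) h1
    rw [trialMeasure_belowGraph hmin0 (fun x => min_le_max.trans (hmax1 x)),
      trialMeasure_belowGraph (fun x => (hmin0 x).trans min_le_max) hmax1,
      div_div_div_cancel_right₀ hq.ne'] at h2
    have h3 : Q.real {ω | ∃ k, (∀ l < k, ω l ∉ belowGraph fun y => max (f i y) (f j y)) ∧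
        ω k ∈ belowGraph fun y => min (f i y) (f j y)} ≤
        Q.real {ω | firstAccepted (f i) ω = firstAccepted (f j) ω} := by
      refine measureReal_mono ?_
      rintro ω ⟨k, hk1, hk2⟩
      simp only [Set.mem_ofPred_eq]
      rw [firstAccepted_eq (k := k) (fun l hl h => hk1 l hl (belowGraph_mono (fun _ => le_max_left _ _) h))
          (belowGraph_mono (fun _ => min_le_left _ _) hk2),
        firstAccepted_eq (k := k) (fun l hl h => hk1 l hl (belowGraph_mono (fun _ => le_max_right _ _) h))
          (belowGraph_mono (fun _ => min_le_right _ _) hk2)]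
    have hme : MeasurableSet {ω | firstAccepted (f i) ω = firstAccepted (f j) ω} :=
      measurableSet_eq_fun (measurable_firstAccepted _) (measurable_firstAccepted _)
    rw [hpre]
    have h4 : Q.real {ω | firstAccepted (f i) ω ≠ firstAccepted (f j) ω} =
        1 - Q.real {ω | firstAccepted (f i) ω = firstAccepted (f j) ω} :=
      probReal_compl_eq_one_sub hme
    have hM : 1 ≤ ∑ x, max (f i x) (f j x) := by
      rw [← hfs i]
      exact Finset.sum_le_sum fun x _ => le_max_left _ _
    have hmM := sum_abs_sub_eq (f i) (f j)
    have hnn : 0 ≤ ∑ x, |f i x - f j x| := Finset.sum_nonneg fun x _ => abs_nonneg _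
    change Q.real {ω | firstAccepted (f i) ω ≠ firstAccepted (f j) ω} ≤ _
    rw [h4, tvDist]
    rw [h2, div_le_iff₀ (by linarith)] at h3
    nlinarith

end UniversalCoupling

/-! ### The chain on discrete time slots -/

section SlotLaw

open Measure

/-- A clock that rings with probability `p`, independent of a table of spins from a universal
coupling. -/
theorem exists_slotLaw {I : Type*} [Finite I] {q : ℕ} [NeZero q] (p : unitInterval)
    (μ : I → PMF (Fin q)) :
    ∃ κ : Measure (Bool × (I → Fin q)), IsProbabilityMeasure κ ∧
      κ.real {z | z.1 = true} = p ∧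
      (∀ i x, κ.real {z | z.1 = true ∧ z.2 i = x} = p * (μ i x).toReal) ∧
      ∀ i j, κ.real {z | z.1 = true ∧ z.2 i ≠ z.2 j} ≤
        p * (2 * tvDist (fun x => (μ i x).toReal) (fun x => (μ j x).toReal)) := by
  obtain ⟨ν, hν, h1, h2⟩ := exists_universalCoupling μ
  let β : Measure Bool := (volume : Measure unitInterval).map fun y => decide (y < p)
  have hm : Measurable fun y : unitInterval => decide (y < p) := by
    refine measurable_to_bool ?_
    have : (fun y : unitInterval => decide (y < p)) ⁻¹' {true} = Set.Iio p := by ext; simp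
    rw [this]
    exact measurableSet_Iio
  have hβ : β.real {true} = p := by
    rw [map_measureReal_apply hm (measurableSet_singleton _), measureReal_def]
    have : (fun y : unitInterval => decide (y < p)) ⁻¹' {true} = Set.Iio p := by ext; simp
    rw [this, unitInterval.volume_Iio, ENNReal.toReal_ofReal p.2.1]
  have hβp : IsProbabilityMeasure β := isProbabilityMeasure_map hm.aemeasurable
  have key : ∀ A : Set (I → Fin q), (β.prod ν).real {z | z.1 = true ∧ z.2 ∈ A} = p * ν.real A := by
    intro A
    rw [← hβ, ← measureReal_prod_prod]
    congr 1
  refine ⟨β.prod ν, inferInstance, ?_, fun i x => ?_, fun i j => ?_⟩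
  · simpa using key Set.univ
  · rw [← h1 i x]; exact key {z | z i = x}
  · exact (key {z | z i ≠ z j}).trans_le (mul_le_mul_of_nonneg_left (h2 i j) p.2.1)

/-- The law of what happens at a site in one time slot: whether the clock rings, with probability
`p`, and the spins it would write for each configuration of the neighbourhood, which are drawn from
a universal coupling. -/
noncomputable def slotLaw {I : Type*} [Finite I] {q : ℕ} [NeZero q] (p : unitInterval)
    (μ : I → PMF (Fin q)) : Measure (Bool × (I → Fin q)) :=
  (exists_slotLaw p μ).choose

instance {I : Type*} [Finite I] {q : ℕ} [NeZero q] (p : unitInterval) (μ : I → PMF (Fin q)) :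
    IsProbabilityMeasure (slotLaw p μ) :=
  (exists_slotLaw p μ).choose_spec.1

variable {I : Type*} {q : ℕ} [NeZero q] {S : ℕ}

/-- Whether the clock rings in slot `s`. -/
def ringAt (D : Fin S → Bool × (I → Fin q)) (s : ℕ) : Bool :=
  if h : s < S then (D ⟨s, h⟩).1 else false

/-- The spin prepared for slot `s` and the configuration `τ`. -/
def writeAt (D : Fin S → Bool × (I → Fin q)) (s : ℕ) (τ : I) : Fin q :=
  if h : s < S then (D ⟨s, h⟩).2 τ else 0

omit [NeZero q] in
theorem ringAt_of_lt (D : Fin S → Bool × (I → Fin q)) {s : ℕ} (h : s < S) :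
    ringAt D s = (D ⟨s, h⟩).1 := dif_pos h

theorem writeAt_of_lt (D : Fin S → Bool × (I → Fin q)) {s : ℕ} (h : s < S) (τ : I) :
    writeAt D s τ = (D ⟨s, h⟩).2 τ := dif_pos h

end SlotLaw

section SlotChain

open Measure

variable {V : Type*} {G : SimpleGraph V} {q : ℕ} [NeZero q] {S : ℕ}

/-- The sample space of the slotted chain. -/
abbrev SlotSpace (G : SimpleGraph V) (q S : ℕ) : Type _ :=
  (i : (_ : V) × Fin S) → Bool × ((inclNbhd G i.1 → Fin q) → Fin q)

/-- All slots at all sites are independent. -/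
noncomputable abbrev slotMeasure [Finite V] (P : LocalRule G q) (S : ℕ) (p : unitInterval) :
    Measure (SlotSpace G q S) :=
  infinitePi fun i : (_ : V) × Fin S => slotLaw p (P i.1)

/-- What happens at the site `v`. -/
abbrev siteData (ω : SlotSpace G q S) (v : V) :
    Fin S → Bool × ((inclNbhd G v → Fin q) → Fin q) := fun s => ω ⟨v, s⟩

/-- The sites that ring in slot `s` are updated simultaneously. -/
def slotStep (ω : SlotSpace G q S) (s : ℕ) (X : V → Fin q) : V → Fin q := fun v =>
  if ringAt (siteData ω v) s then writeAt (siteData ω v) s (fun u => X u) else X v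

/-- The slotted chain started at `X₀`. -/
def slotState (X₀ : V → Fin q) (ω : SlotSpace G q S) : ℕ → V → Fin q
  | 0 => X₀
  | s + 1 => slotStep ω s (slotState X₀ ω s)

theorem slotStep_congr {ω ω' : SlotSpace G q S} {s : ℕ} (h : ∀ i, i.2.val = s → ω i = ω' i)
    (X : V → Fin q) : slotStep ω s X = slotStep ω' s X := by
  funext v
  by_cases hs : s < S
  · simp only [slotStep, ringAt_of_lt _ hs, writeAt_of_lt _ hs, siteData, h ⟨v, ⟨s, hs⟩⟩ rfl]
  · simp [slotStep, ringAt, hs]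

theorem slotState_congr {ω ω' : SlotSpace G q S} (X₀ : V → Fin q) {s : ℕ}
    (h : ∀ i, i.2.val < s → ω i = ω' i) : slotState X₀ ω s = slotState X₀ ω' s := by
  induction s with
  | zero => rfl
  | succ s ih =>
    rw [slotState, slotState, ih fun i hi => h i (by omega)]
    exact slotStep_congr (fun i hi => h i (by omega)) _

variable [Fintype V]

theorem integral_slotMeasure_eval (P : LocalRule G q) (p : unitInterval) (i : (_ : V) × Fin S)
    (g : Bool × ((inclNbhd G i.1 → Fin q) → Fin q) → ℝ) :
    ∫ ω, g (ω i) ∂slotMeasure P S p = ∫ z, g z ∂slotLaw p (P i.1) := by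
  rw [← infinitePi_map_eval (fun i : (_ : V) × Fin S => slotLaw p (P i.1)) i,
    integral_map (measurable_pi_apply i).aemeasurable
      (measurable_of_finite g).aestronglyMeasurable]

theorem integral_ite_slotLaw {I : Type*} [Finite I] (p : unitInterval) (μ : I → PMF (Fin q)) (τ : I)
    (g : Fin q → ℝ) :
    ∫ z, (if z.1 = true then g (z.2 τ) else 0) ∂slotLaw p μ = p * ∑ x, (μ τ x).toReal * g x := by
  have h : ∀ z : Bool × (I → Fin q), (if z.1 = true then g (z.2 τ) else 0) =
      ∑ x, Set.indicator {z : Bool × (I → Fin q) | z.1 = true ∧ z.2 τ = x} (fun _ => g x) z := by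
    intro z
    rw [Finset.sum_eq_single (z.2 τ)]
    · by_cases hz : z.1 = true <;> simp [Set.indicator, hz]
    · intro x _ hx
      exact Set.indicator_of_notMem (fun h => hx h.2.symm) _
    · simp
  simp_rw [h]
  rw [integral_finsetSum _ fun x _ => (integrable_const _).indicator (Set.toFinite _).measurableSet,
    Finset.mul_sum]
  refine Finset.sum_congr rfl fun x _ => ?_
  rw [integral_indicator_const _ (Set.toFinite _).measurableSet, smul_eq_mul,
    (exists_slotLaw p μ).choose_spec.2.2.1 τ x |> fun h => (show (slotLaw p μ).real _ = _ from h)]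
  ring

theorem measureReal_slotMeasure_ring_ring (P : LocalRule G q) (p : unitInterval) (s : Fin S)
    {u v : V} (huv : u ≠ v) :
    (slotMeasure P S p).real {ω | (ω ⟨u, s⟩).1 = true ∧ (ω ⟨v, s⟩).1 = true} = (p : ℝ) * p := by
  classical
  have hset : {ω : SlotSpace G q S | (ω ⟨u, s⟩).1 = true ∧ (ω ⟨v, s⟩).1 = true} =
      ((({⟨u, s⟩, ⟨v, s⟩} : Finset ((_ : V) × Fin S))) : Set ((_ : V) × Fin S)).pi
        fun _ => {z | z.1 = true} := by
    ext ω; simp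
  have hne : (⟨u, s⟩ : (_ : V) × Fin S) ∉ ({⟨v, s⟩} : Finset ((_ : V) × Fin S)) := by
    simpa using huv
  rw [hset, measureReal_def, infinitePi_pi _ fun i _ => (Set.toFinite _).measurableSet,
    Finset.prod_insert hne, Finset.prod_singleton, ENNReal.toReal_mul]
  have h : ∀ w : V, ((slotLaw p (P w)) {z | z.1 = true}).toReal = p := fun w =>
    (exists_slotLaw p (P w)).choose_spec.2.1
  rw [h, h]

variable [DecidableEq V]

/-- If at most one site rings, a slot acts as a single update; otherwise the deviation is bounded
by the number of ordered pairs of ringing sites. -/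
theorem abs_slotStep_sub_le {f : (V → Fin q) → ℝ} {c : ℝ} (hf : ∀ X, |f X| ≤ c)
    (ω : SlotSpace G q S) (s : Fin S) (X : V → Fin q) :
    |f (slotStep ω s X) - f X - ∑ v, (if (ω ⟨v, s⟩).1 = true then
        f (Function.update X v ((ω ⟨v, s⟩).2 fun u => X u)) - f X else 0)| ≤
      3 * c * ∑ u, ∑ v ∈ Finset.univ.erase u,
        Set.indicator {ω : SlotSpace G q S | (ω ⟨u, s⟩).1 = true ∧ (ω ⟨v, s⟩).1 = true} 1 ω := by
  have hc : 0 ≤ c := (abs_nonneg _).trans (hf X)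
  set K : Finset V := Finset.univ.filter fun v => (ω ⟨v, s⟩).1 = true with hK
  have hmem : ∀ v, v ∈ K ↔ (ω ⟨v, s⟩).1 = true := fun v => by simp [hK]
  have hstep : ∀ v, slotStep ω s X v = if v ∈ K then (ω ⟨v, s⟩).2 (fun u => X u) else X v := by
    intro v
    simp only [slotStep, ringAt_of_lt _ s.2, writeAt_of_lt _ s.2, siteData, hmem]
  have hsum : ∑ v, (if (ω ⟨v, s⟩).1 = true then
        f (Function.update X v ((ω ⟨v, s⟩).2 fun u => X u)) - f X else 0) =
      ∑ v ∈ K, (f (Function.update X v ((ω ⟨v, s⟩).2 fun u => X u)) - f X) := by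
    rw [hK, Finset.sum_filter]
  have hpairs : (∑ u, ∑ v ∈ Finset.univ.erase u,
      Set.indicator {ω : SlotSpace G q S | (ω ⟨u, s⟩).1 = true ∧ (ω ⟨v, s⟩).1 = true}
        (1 : SlotSpace G q S → ℝ) ω) = (K.card : ℝ) * (K.card - 1) := by
    have h1 : ∀ u v, Set.indicator {ω : SlotSpace G q S | (ω ⟨u, s⟩).1 = true ∧
        (ω ⟨v, s⟩).1 = true} (1 : SlotSpace G q S → ℝ) ω =
        (if u ∈ K then 1 else 0) * (if v ∈ K then 1 else 0) := by
      intro u v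
      simp only [Set.indicator, Set.mem_ofPred_eq, hmem, Pi.one_apply, ← ite_and, mul_ite, mul_one,
        mul_zero]
      by_cases h1 : (ω ⟨u, s⟩).1 = true <;> by_cases h2 : (ω ⟨v, s⟩).1 = true <;> simp [h1, h2]
    have h2 : ∀ u : V, ∑ v ∈ Finset.univ.erase u, (if v ∈ K then (1 : ℝ) else 0) =
        K.card - if u ∈ K then 1 else 0 := by
      intro u
      have h3 := Finset.add_sum_erase Finset.univ (fun v => if v ∈ K then (1 : ℝ) else 0)
        (Finset.mem_univ u)
      have h4 : ∑ v, (if v ∈ K then (1 : ℝ) else 0) = K.card := by simp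
      linarith
    simp_rw [h1, ← Finset.mul_sum, h2]
    rw [← Finset.sum_filter_add_sum_filter_not Finset.univ (· ∈ K)]
    rw [Finset.sum_congr rfl (g := fun _ => (K.card : ℝ) - 1) fun u hu => by
      simp [(Finset.mem_filter.1 hu).2], Finset.sum_congr (s₁ := Finset.univ.filter (· ∉ K)) rfl
        (g := fun _ => (0 : ℝ)) fun u hu => by simp [(Finset.mem_filter.1 hu).2]]
    simp
    ring
  rw [hsum, hpairs]
  rcases Nat.lt_or_ge K.card 2 with hcard | hcard
  · have hrhs : (K.card : ℝ) * (K.card - 1) = 0 := by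
      interval_cases K.card <;> simp
    rw [hrhs, mul_zero]
    refine (abs_nonpos_iff.2 ?_)
    rcases Nat.lt_or_ge K.card 1 with h0 | h1
    · have hK0 : K = ∅ := Finset.card_eq_zero.1 (by omega)
      have : slotStep ω s X = X := funext fun v => by rw [hstep, hK0]; simp
      rw [this, hK0]; simp
    · obtain ⟨v, hv⟩ := Finset.card_eq_one.1 (show K.card = 1 by omega)
      have : slotStep ω s X = Function.update X v ((ω ⟨v, s⟩).2 fun u => X u) := by
        funext u
        rw [hstep]
        by_cases h : u = v
        · subst h; simp [hv]
        · simp [hv, h]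
      rw [this, hv]; simp
  · have hk : (2 : ℝ) ≤ K.card := by exact_mod_cast hcard
    have h1 : |∑ v ∈ K, (f (Function.update X v ((ω ⟨v, s⟩).2 fun u => X u)) - f X)| ≤
        K.card * (2 * c) := by
      refine (Finset.abs_sum_le_sum_abs _ _).trans ?_
      rw [← nsmul_eq_mul, ← Finset.sum_const]
      refine Finset.sum_le_sum fun v _ => ?_
      refine (abs_sub _ _).trans ?_
      linarith [hf (Function.update X v ((ω ⟨v, s⟩).2 fun u => X u)), hf X]
    have h2 : |f (slotStep ω s X) - f X| ≤ 2 * c := by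
      refine (abs_sub _ _).trans ?_
      linarith [hf (slotStep ω s X), hf X]
    refine (abs_sub _ _).trans ((add_le_add h2 h1).trans ?_)
    nlinarith [mul_nonneg hc (sub_nonneg.2 hk), mul_nonneg (mul_nonneg hc (sub_nonneg.2 hk))
      (sub_nonneg.2 hk)]

theorem abs_integral_slotStep_sub_eulerStep_le (P : LocalRule G q) (p : unitInterval)
    {f : (V → Fin q) → ℝ} {c : ℝ} (hf : ∀ X, |f X| ≤ c) (s : Fin S) (X : V → Fin q) :
    |∫ ω, f (slotStep ω s X) ∂slotMeasure P S p - eulerStep P p f X| ≤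
      3 * c * (Fintype.card V * p) ^ 2 := by
  have hc : 0 ≤ c := (abs_nonneg _).trans (hf X)
  have hint : ∀ g : SlotSpace G q S → ℝ, Integrable g (slotMeasure P S p) := fun g =>
    integrable_comp_of_finite (X := id) aemeasurable_id g
  have heul : eulerStep P p f X = ∫ ω, (f X + ∑ v, (if (ω ⟨v, s⟩).1 = true then
      f (Function.update X v ((ω ⟨v, s⟩).2 fun u => X u)) - f X else 0)) ∂slotMeasure P S p := by
    rw [integral_add (hint _) (hint _), integral_const, probReal_univ, one_smul,
      integral_finsetSum _ fun _ _ => hint _, eulerStep, Finset.mul_sum]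
    congr 1
    refine Finset.sum_congr rfl fun v _ => ?_
    rw [integral_slotMeasure_eval P p ⟨v, s⟩ (fun z => if z.1 = true then
      f (Function.update X v (z.2 fun u => X u)) - f X else 0),
      integral_ite_slotLaw p (P v) (fun u => X u) fun x => f (Function.update X v x) - f X]
    simp_rw [mul_sub, Finset.sum_sub_distrib, ← Finset.sum_mul, PMF.sum_toReal, siteOp]
    ring
  rw [heul, ← integral_sub (hint _) (hint _)]
  calc _ ≤ ∫ ω, 3 * c * ∑ u, ∑ v ∈ Finset.univ.erase u,
        Set.indicator {ω : SlotSpace G q S | (ω ⟨u, s⟩).1 = true ∧ (ω ⟨v, s⟩).1 = true} 1 ω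
          ∂slotMeasure P S p := by
        refine abs_integral_le_integral_abs.trans (integral_mono (hint _) (hint _) fun ω => ?_)
        have := abs_slotStep_sub_le hf ω s X
        rwa [sub_sub] at this
    _ = 3 * c * ∑ u : V, ∑ v ∈ Finset.univ.erase u, (p : ℝ) * p := by
        rw [integral_const_mul, integral_finsetSum _ fun _ _ => hint _]
        congr 1
        refine Finset.sum_congr rfl fun u _ => ?_
        rw [integral_finsetSum _ fun _ _ => hint _]
        refine Finset.sum_congr rfl fun v hv => ?_
        rw [integral_indicator_one (Set.toFinite _).measurableSet,
          measureReal_slotMeasure_ring_ring P p s (Finset.ne_of_mem_erase hv).symm]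
    _ ≤ 3 * c * ∑ u : V, ∑ v : V, (p : ℝ) * p := by
        refine mul_le_mul_of_nonneg_left (Finset.sum_le_sum fun u _ => ?_) (by positivity)
        exact Finset.sum_le_sum_of_subset_of_nonneg (Finset.subset_univ _)
          fun _ _ _ => mul_nonneg p.2.1 p.2.1
    _ = _ := by
        simp only [Finset.sum_const, Finset.card_univ, nsmul_eq_mul]
        ring

/-- The slotted chain approximates the continuous-time chain. The slots are exchanged one at a
time for a continuous-time evolution of the same length. -/
theorem abs_integral_slotState_sub_chainMean_le (P : LocalRule G q) (p : unitInterval)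
    (hp : Fintype.card V * (p : ℝ) ≤ 1) {φ : (V → Fin q) → ℝ} {c : ℝ} (hφ : ∀ X, |φ X| ≤ c)
    (X₀ : V → Fin q) :
    |∫ ω, φ (slotState X₀ ω S) ∂slotMeasure P S p - chainMean P φ (S * p) X₀| ≤
      S * (6 * c * (Fintype.card V * p) ^ 2) := by
  have hint : ∀ g : SlotSpace G q S → ℝ, Integrable g (slotMeasure P S p) := fun g =>
    integrable_comp_of_finite (X := id) aemeasurable_id g
  have hp0 : (0 : ℝ) ≤ p := p.2.1
  let a : ℕ → ℝ := fun s => ∫ ω, chainMean P φ ((S - s : ℕ) * p) (slotState X₀ ω s)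
    ∂slotMeasure P S p
  have hstep : ∀ s < S, |a (s + 1) - a s| ≤ 6 * c * (Fintype.card V * p) ^ 2 := by
    intro s hs
    set f := chainMean P φ ((S - (s + 1) : ℕ) * p) with hf
    have hfb : ∀ X, |f X| ≤ c := abs_chainMean_le P hφ _
    have h1 : a (s + 1) = ∫ ω, ∫ ω', f (slotStep ω' s (slotState X₀ ω s)) ∂slotMeasure P S p
        ∂slotMeasure P S p := by
      change ∫ ω, f (slotState X₀ ω (s + 1)) ∂slotMeasure P S p = _
      rw [integral_infinitePi_mixOn _ {i | i.2.val = s} (measurable_of_finite _) fun _ => hfb _]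
      refine integral_congr_ae (.of_forall fun ω => integral_congr_ae (.of_forall fun ω' => ?_))
      simp only [slotState]
      rw [slotState_congr (ω' := ω) X₀ fun i hi => mixOn_of_notMem
          (by simp only [Set.mem_ofPred_eq]; omega) _ _,
        slotStep_congr (ω' := ω') fun i hi => mixOn_of_mem (by simpa using hi) _ _]
    have h2 : ((S - s : ℕ) : ℝ) * p = (S - (s + 1) : ℕ) * p + p := by
      rw [show S - s = (S - (s + 1)) + 1 by omega]
      push_cast; ring
    have h3 : a s = ∫ ω, chainMean P φ ((S - (s + 1) : ℕ) * p + p) (slotState X₀ ω s)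
        ∂slotMeasure P S p := by
      simp only [a, h2]
    rw [h1, h3, ← integral_sub (hint _) (hint _)]
    have h4 : ∀ ω : SlotSpace G q S, ‖∫ ω', f (slotStep ω' s (slotState X₀ ω s)) ∂slotMeasure P S p -
        chainMean P φ ((S - (s + 1) : ℕ) * p + p) (slotState X₀ ω s)‖ ≤
          6 * c * (Fintype.card V * p) ^ 2 := by
      intro ω
      have e1 := abs_integral_slotStep_sub_eulerStep_le P p hfb ⟨s, hs⟩ (slotState X₀ ω s)
      have e2 := abs_chainMean_sub_eulerStep_le P hφ hp0
        (t := (S - (s + 1) : ℕ) * p) (by positivity) hp (slotState X₀ ω s)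
      rw [Real.norm_eq_abs]
      rw [abs_sub_comm] at e2
      refine (abs_sub_le _ (eulerStep P p f (slotState X₀ ω s)) _).trans ?_
      exact (add_le_add e1 e2).trans (by linarith)
    have := norm_integral_le_of_norm_le_const (μ := slotMeasure P S p) (.of_forall h4)
    simpa using this
  have htel : ∀ s ≤ S, |a s - a 0| ≤ s * (6 * c * (Fintype.card V * p) ^ 2) := by
    intro s
    induction s with
    | zero => intro _; simp
    | succ s ih =>
      intro hs
      have e1 := hstep s (by omega)
      have e2 := ih (by omega)
      refine (abs_sub_le _ (a s) _).trans ((add_le_add e1 e2).trans ?_)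
      push_cast
      linarith
  have hS := htel S le_rfl
  have h0 : a 0 = chainMean P φ (S * p) X₀ := by simp [a, slotState]
  have hS' : a S = ∫ ω, φ (slotState X₀ ω S) ∂slotMeasure P S p := by
    refine integral_congr_ae (.of_forall fun ω => ?_)
    simp only [Nat.sub_self, Nat.cast_zero, zero_mul]
    have hne : ∀ᵐ w ∂clockMeasure V, ringsUpTo w 0 = [] := by
      filter_upwards [ae_waiting_pos, ae_finite_rings 0] with w hw hfin
      refine List.eq_nil_iff_forall_not_mem.2 fun e he => ?_
      rw [mem_ringsUpTo hfin] at he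
      linarith [hw e, le_ringTime hw e]
    rw [chainMean, integral_congr_ae (g := fun _ => φ (slotState X₀ ω S))]
    · simp
    · filter_upwards [hne] with w hw
      rw [hw]; rfl
  rwa [h0, hS'] at hS

end SlotChain

/-! ### The influence matrix -/

section Influence

theorem tvDist_nonneg {Y : Type*} [Fintype Y] (μ ν : Y → ℝ) : 0 ≤ tvDist μ ν :=
  mul_nonneg (by norm_num) (Finset.sum_nonneg fun _ _ => abs_nonneg _)

theorem tvDist_self {Y : Type*} [Fintype Y] (μ : Y → ℝ) : tvDist μ μ = 0 := by
  simp [tvDist]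

theorem tvDist_triangle {Y : Type*} [Fintype Y] (μ ν ξ : Y → ℝ) :
    tvDist μ ξ ≤ tvDist μ ν + tvDist ν ξ := by
  unfold tvDist
  rw [← mul_add, ← Finset.sum_add_distrib]
  exact mul_le_mul_of_nonneg_left (Finset.sum_le_sum fun x _ => abs_sub_le _ _ _) (by norm_num)

variable {V : Type*} {G : SimpleGraph V} {q : ℕ}

theorem influenceMatrix_nonneg (P : LocalRule G q) (u v : V) : 0 ≤ influenceMatrix P u v :=
  Real.iSup_nonneg fun _ => tvDist_nonneg _ _

theorem tvDist_le_influenceMatrix [Finite V] (P : LocalRule G q) {u v : V}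
    {τ τ' : inclNbhd G v → Fin q} (h : ∀ w : inclNbhd G v, (w : V) ≠ u → τ w = τ' w) :
    tvDist (fun x => (P v τ x).toReal) (fun x => (P v τ' x).toReal) ≤ influenceMatrix P u v :=
  le_ciSup (f := fun p : {p : (inclNbhd G v → Fin q) × (inclNbhd G v → Fin q) //
      ∀ w : inclNbhd G v, (w : V) ≠ u → p.1 w = p.2 w} =>
    tvDist (fun x => (P v p.1.1 x).toReal) (fun x => (P v p.1.2 x).toReal))
    (Set.finite_range _).bddAbove ⟨(τ, τ'), h⟩

/-- Changing the disagreeing sites one at a time bounds the change of a local distribution by the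
total influence of the disagreements. -/
theorem tvDist_rule_le_sum [Fintype V] (P : LocalRule G q) (v : V) (X Y : V → Fin q) :
    tvDist (fun x => (P v (fun u => X u) x).toReal) (fun x => (P v (fun u => Y u) x).toReal) ≤
      ∑ u, influenceMatrix P u v * (if X u ≠ Y u then 1 else 0) := by
  classical
  have key : ∀ K : Finset V,
      tvDist (fun x => (P v (fun u => X u) x).toReal)
        (fun x => (P v (fun u => K.piecewise Y X u) x).toReal) ≤
      ∑ u ∈ K, influenceMatrix P u v * (if X u ≠ Y u then 1 else 0) := by
    intro K
    induction K using Finset.induction_on with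
    | empty => simp [tvDist_self]
    | insert a K ha ih =>
      rw [Finset.sum_insert ha, add_comm]
      refine (tvDist_triangle _ _ _).trans (add_le_add ih ?_)
      by_cases hXY : X a = Y a
      · have : (insert a K).piecewise Y X = K.piecewise Y X := by
          rw [Finset.piecewise_insert, ← hXY]
          refine Function.update_eq_self_iff.2 ?_
          simp [ha]
        rw [this, tvDist_self]
        simp [hXY]
      · rw [if_pos hXY, mul_one]
        refine tvDist_le_influenceMatrix P fun w hw => ?_
        rw [Finset.piecewise_insert, Function.update_of_ne hw]
  simpa using key Finset.univ

end Influence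

section Weight

variable {V : Type*} [Fintype V]

theorem norm_mulVec_le_lpOpNorm {p : ℝ≥0∞} [Fact (1 ≤ p)] (M : Matrix V V ℝ) (x : V → ℝ) :
    ‖WithLp.toLp p (M.mulVec x)‖ ≤ lpOpNorm p M * ‖WithLp.toLp p x‖ := by
  by_cases hx : x = 0
  · subst hx; simp
  have hpos : 0 < ‖WithLp.toLp p x‖ := norm_pos_iff.2 fun h => hx (by
    simpa using congrArg WithLp.ofLp h)
  rw [← div_le_iff₀ hpos]
  let f : PiLp p (fun _ : V => ℝ) →ₗ[ℝ] PiLp p (fun _ : V => ℝ) :=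
    (WithLp.linearEquiv p ℝ (V → ℝ)).symm.toLinearMap ∘ₗ M.mulVecLin ∘ₗ
      (WithLp.linearEquiv p ℝ (V → ℝ)).toLinearMap
  have hbdd : BddAbove (Set.range fun x : {x : V → ℝ // x ≠ 0} =>
      ‖WithLp.toLp p (M.mulVec x.1)‖ / ‖WithLp.toLp p x.1‖) := by
    refine ⟨‖f.toContinuousLinearMap‖, ?_⟩
    rintro _ ⟨y, rfl⟩
    refine div_le_of_le_mul₀ (norm_nonneg _) (norm_nonneg _) ?_
    exact f.toContinuousLinearMap.le_opNorm (WithLp.toLp p y.1)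
  exact le_ciSup hbdd ⟨x, hx⟩

/-- The total mass of the `k`-th power of a matrix, bounded in terms of an `ℓ_p` operator norm. -/
theorem sum_sum_pow_le [DecidableEq V] {p : ℝ≥0∞} (hp : 1 ≤ p) {M : Matrix V V ℝ} {C : ℝ}
    (hC : 0 ≤ C) (hM : lpOpNorm p M ≤ C) (k : ℕ) :
    ∑ u, ∑ v, (M ^ k) u v ≤ (Fintype.card V : ℝ) ^ 2 * C ^ k := by
  have : Fact (1 ≤ p) := ⟨hp⟩
  have h1 : ‖WithLp.toLp p (1 : V → ℝ)‖ ≤ Fintype.card V := by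
    have : WithLp.toLp p (1 : V → ℝ) = ∑ v, PiLp.single p v (1 : ℝ) := by
      ext u
      simp [Pi.single_apply]
    rw [this]
    refine (norm_sum_le _ _).trans ?_
    simp
  have h2 : ∀ k, ‖WithLp.toLp p ((M ^ k).mulVec 1)‖ ≤ C ^ k * Fintype.card V := by
    intro k
    induction k with
    | zero => simpa using h1
    | succ k ih =>
      rw [pow_succ', ← Matrix.mulVec_mulVec]
      refine (norm_mulVec_le_lpOpNorm M _).trans ?_
      calc _ ≤ C * (C ^ k * Fintype.card V) :=
            mul_le_mul hM ih (norm_nonneg _) hC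
        _ = _ := by ring
  calc ∑ u, ∑ v, (M ^ k) u v = ∑ u, ((M ^ k).mulVec 1) u := by simp [Matrix.mulVec, dotProduct]
    _ ≤ ∑ u : V, C ^ k * Fintype.card V := by
        refine Finset.sum_le_sum fun u _ => (le_abs_self _).trans (le_trans ?_ (h2 k))
        exact PiLp.norm_apply_le (WithLp.toLp p ((M ^ k).mulVec 1)) u
    _ = _ := by
        rw [Finset.sum_const, Finset.card_univ, nsmul_eq_mul]; ring

/-- A polynomially bounded weight that is almost invariant under the transposed matrix: the Neumann
series of the all-ones vector. It replaces the norm of the matrix in the contraction argument, so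
that the exponent `p` no longer matters. -/
theorem exists_weight {p : ℝ≥0∞} (hp : 1 ≤ p) {M : Matrix V V ℝ} (h0 : ∀ u v, 0 ≤ M u v) {C : ℝ}
    (hC : 0 < C) (hM : lpOpNorm p M ≤ C) :
    ∃ g : V → ℝ, (∀ v, 1 ≤ g v) ∧ (∀ v, g v ≤ 2 * (Fintype.card V : ℝ) ^ 2) ∧
      ∀ v, ∑ u, M u v * g u ≤ 2 * C * g v := by
  classical
  set N : ℝ := (Fintype.card V : ℝ) ^ 2 with hN
  let c : ℕ → V → ℝ := fun k v => (∑ u, (M ^ k) u v) / (2 * C) ^ k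
  have hpow0 : ∀ k u v, 0 ≤ (M ^ k) u v := by
    intro k
    induction k with
    | zero => intro u v; rw [pow_zero, Matrix.one_apply]; split_ifs <;> norm_num
    | succ k ih =>
      intro u v
      rw [pow_succ, Matrix.mul_apply]
      exact Finset.sum_nonneg fun w _ => mul_nonneg (ih u w) (h0 w v)
  have hc0 : ∀ k v, 0 ≤ c k v := fun k v =>
    div_nonneg (Finset.sum_nonneg fun u _ => hpow0 k u v) (by positivity)
  have hcle : ∀ k v, c k v ≤ N * (1 / 2) ^ k := by
    intro k v
    rw [div_le_iff₀ (by positivity)]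
    have h1 : ∑ u, (M ^ k) u v ≤ N * C ^ k := by
      refine le_trans ?_ (sum_sum_pow_le hp hC.le hM k)
      refine Finset.sum_le_sum fun u _ => ?_
      exact Finset.single_le_sum (f := fun v => (M ^ k) u v) (fun w _ => hpow0 k u w)
        (Finset.mem_univ v)
    refine h1.trans_eq ?_
    rw [mul_assoc, ← mul_pow]
    congr 2
    ring
  have hgeo : Summable fun k : ℕ => N * (1 / 2 : ℝ) ^ k := summable_geometric_two.mul_left N
  have hsum : ∀ v, Summable fun k => c k v := fun v =>
    Summable.of_nonneg_of_le (fun k => hc0 k v) (fun k => hcle k v) hgeo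
  have hc_zero : ∀ v, c 0 v = 1 := fun v => by simp [c, Matrix.one_apply]
  have hc_succ : ∀ k v, ∑ u, M u v * c k u = 2 * C * c (k + 1) v := by
    intro k v
    simp only [c, pow_succ (M) k, Matrix.mul_apply]
    rw [Finset.sum_comm, pow_succ]
    simp_rw [← Finset.sum_mul]
    rw [mul_div_assoc', mul_comm (2 * C), mul_div_mul_right _ _ (by positivity), Finset.sum_div]
    exact Finset.sum_congr rfl fun u _ => by ring
  refine ⟨fun v => ∑' k, c k v, fun v => ?_, fun v => ?_, fun v => ?_⟩
  · rw [← hc_zero v]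
    exact (hsum v).le_tsum 0 fun k _ => hc0 k v
  · refine ((hsum v).tsum_le_tsum (fun k => hcle k v) hgeo).trans_eq ?_
    rw [tsum_mul_left, tsum_geometric_two]; ring
  · have h1 : ∑ u, M u v * ∑' k, c k u = ∑' k, 2 * C * c (k + 1) v := by
      simp_rw [← tsum_mul_left]
      rw [← Summable.tsum_finsetSum fun u _ => (hsum u).mul_left _]
      exact tsum_congr fun k => hc_succ k v
    rw [h1, tsum_mul_left]
    refine mul_le_mul_of_nonneg_left ?_ (by positivity)
    change _ ≤ ∑' k, c k v
    rw [(hsum v).tsum_eq_zero_add]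
    linarith [hc0 0 v]

end Weight

/-! ### Parallel iterations and their convergence -/

section WindowTrajectory

/-- The trajectory of a site over the slots `0, 1, …`, recomputed on the window of slots from `a` to
`b`: it is kept as `prev` before the window, is unspecified (constantly `0`) after the window, and
inside the window it changes to `wr s` when the clock rings in slot `s`. -/
def windowTrajectory {q : ℕ} [NeZero q] (a b : ℕ) (x₀ : Fin q) (ring : ℕ → Bool)
    (wr prev : ℕ → Fin q) : ℕ → Fin q
  | 0 => x₀
  | s + 1 =>
    if s + 1 < a then prev (s + 1)
    else if b < s + 1 then 0
    else if ring s then wr s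
    else windowTrajectory a b x₀ ring wr prev s

/-- The trajectory before the first iteration: only the initial spin is known. -/
def initTrajectory {q : ℕ} [NeZero q] (x₀ : Fin q) (s : ℕ) : Fin q := if s = 0 then x₀ else 0

theorem windowTrajectory_congr {q : ℕ} [NeZero q] {a b : ℕ} {x₀ : Fin q} {ring ring' : ℕ → Bool}
    {wr wr' prev prev' : ℕ → Fin q} {s : ℕ} (h1 : ∀ t < s, ring t = ring' t)
    (h2 : ∀ t < s, wr t = wr' t) (h3 : ∀ t ≤ s, prev t = prev' t) :
    windowTrajectory a b x₀ ring wr prev s = windowTrajectory a b x₀ ring' wr' prev' s := by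
  induction s with
  | zero => rfl
  | succ s ih =>
    simp only [windowTrajectory]
    rw [h3 (s + 1) le_rfl, h1 s (by omega), h2 s (by omega),
      ih (fun t ht => h1 t (by omega)) (fun t ht => h2 t (by omega)) fun t ht => h3 t (by omega)]

end WindowTrajectory

section Iterates

open Measure

variable {V : Type*} {G : SimpleGraph V} {q : ℕ} [NeZero q] {S : ℕ}

/-- The parallel iterations. In iteration `r` all sites recompute their trajectories on the window
from `a r` to `b r`, reading the trajectories of the previous iteration. -/
def iterates (a b : ℕ → ℕ) (X₀ : V → Fin q) (ω : SlotSpace G q S) : ℕ → V → ℕ → Fin q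
  | 0 => fun v => initTrajectory (X₀ v)
  | r + 1 => fun v => windowTrajectory (a (r + 1)) (b (r + 1)) (X₀ v) (ringAt (siteData ω v))
      (fun s => writeAt (siteData ω v) s fun u => iterates a b X₀ ω r u s)
      (iterates a b X₀ ω r v)

theorem siteData_congr {ω ω' : SlotSpace G q S} {s : ℕ} (h : ∀ i, i.2.val < s → ω i = ω' i) (v : V)
    {t : ℕ} (ht : t < s) : ringAt (siteData ω v) t = ringAt (siteData ω' v) t ∧
      writeAt (siteData ω v) t = writeAt (siteData ω' v) t := by
  by_cases hS : t < S
  · constructor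
    · simp only [ringAt_of_lt _ hS, siteData, h ⟨v, ⟨t, hS⟩⟩ ht]
    · funext τ
      simp only [writeAt_of_lt _ hS, siteData, h ⟨v, ⟨t, hS⟩⟩ ht]
  · constructor
    · simp [ringAt, hS]
    · funext τ; simp [writeAt, hS]

theorem iterates_congr {ω ω' : SlotSpace G q S} (a b : ℕ → ℕ) (X₀ : V → Fin q) {s : ℕ}
    (h : ∀ i, i.2.val < s → ω i = ω' i) (r : ℕ) (v : V) {t : ℕ} (ht : t ≤ s) :
    iterates a b X₀ ω r v t = iterates a b X₀ ω' r v t := by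
  induction r generalizing v t with
  | zero => rfl
  | succ r ih =>
    refine windowTrajectory_congr (fun t' ht' => (siteData_congr h v (by omega)).1)
      (fun t' ht' => ?_) fun t' ht' => ih v (by omega)
    rw [(siteData_congr h v (by omega)).2]
    congr 1
    funext u
    exact ih _ (by omega)

variable [Fintype V]

/-- A disagreement about the written spin needs a ring and, by the universal coupling, a
disagreement among the neighbours. -/
theorem measureReal_write_ne_le (P : LocalRule G q) (p : unitInterval) (i : (_ : V) × Fin S)
    (X Y : SlotSpace G q S → V → Fin q)
    (hX : ∀ ω ω' : SlotSpace G q S, (∀ j, j ≠ i → ω j = ω' j) → X ω = X ω')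
    (hY : ∀ ω ω' : SlotSpace G q S, (∀ j, j ≠ i → ω j = ω' j) → Y ω = Y ω') :
    (slotMeasure P S p).real {ω | (ω i).1 = true ∧
        (ω i).2 (fun u => X ω u) ≠ (ω i).2 (fun u => Y ω u)} ≤
      p * ∑ u, 2 * influenceMatrix P u i.1 * (slotMeasure P S p).real {ω | X ω u ≠ Y ω u} := by
  classical
  have hint : ∀ g : SlotSpace G q S → ℝ, Integrable g (slotMeasure P S p) := fun g =>
    integrable_comp_of_finite (X := id) aemeasurable_id g
  set A := {ω : SlotSpace G q S | (ω i).1 = true ∧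
    (ω i).2 (fun u => X ω u) ≠ (ω i).2 (fun u => Y ω u)} with hA
  rw [← integral_indicator_one (Set.toFinite A).measurableSet,
    integral_infinitePi_mixOn _ {i} (measurable_of_finite _) (c := 1) (fun ω => by
      by_cases h : ω ∈ A <;> simp [h])]
  have hin : ∀ ω : SlotSpace G q S, ∫ ω', A.indicator 1 (mixOn {i} ω ω') ∂slotMeasure P S p ≤
      p * ∑ u, 2 * influenceMatrix P u i.1 * (if X ω u ≠ Y ω u then 1 else 0) := by
    intro ω
    have hmix : ∀ ω' : SlotSpace G q S, ∀ j, j ≠ i → mixOn {i} ω ω' j = ω j := fun ω' j hj =>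
      mixOn_of_notMem (by simpa using hj) _ _
    have h1 : ∀ ω' : SlotSpace G q S, A.indicator (1 : SlotSpace G q S → ℝ) (mixOn {i} ω ω') =
        Set.indicator {z : Bool × ((inclNbhd G i.1 → Fin q) → Fin q) |
          z.1 = true ∧ z.2 (fun u => X ω u) ≠ z.2 (fun u => Y ω u)} 1 (ω' i) := by
      intro ω'
      refine Set.indicator_eq_indicator ?_ rfl
      simp only [hA, Set.mem_ofPred_eq, hX _ _ (hmix ω'), hY _ _ (hmix ω'),
        mixOn_of_mem (Set.mem_singleton i)]
    simp_rw [h1]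
    rw [integral_slotMeasure_eval P p i, integral_indicator_one (Set.toFinite _).measurableSet]
    have h2 : (slotLaw p (P i.1)).real {z | z.1 = true ∧
        z.2 (fun u => X ω u) ≠ z.2 (fun u => Y ω u)} ≤ _ :=
      (exists_slotLaw p (P i.1)).choose_spec.2.2.2 (fun u => X ω u) (fun u => Y ω u)
    refine h2.trans (mul_le_mul_of_nonneg_left ?_ p.2.1)
    simp_rw [mul_assoc, ← Finset.mul_sum]
    exact mul_le_mul_of_nonneg_left (tvDist_rule_le_sum P i.1 (X ω) (Y ω)) (by norm_num)
  refine (integral_mono (hint _) (hint _) hin).trans_eq ?_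
  rw [integral_const_mul, integral_finsetSum _ fun _ _ => hint _]
  congr 1
  refine Finset.sum_congr rfl fun u _ => ?_
  rw [integral_const_mul, ← integral_indicator_one (Set.toFinite _).measurableSet]
  congr 2
  funext ω
  simp [Set.indicator]

/-- Convergence of the parallel iterations: the disagreement between iteration `r` and the chain in
slot `s` is exponentially small in the number of iterations since the window reached `s`. The
windows are so short that the growth of the disagreement over a window loses to one iteration. -/
theorem measureReal_iterates_ne_le (P : LocalRule G q) (p : unitInterval) {g : V → ℝ} {A κ : ℝ}
    {W : ℕ} (hW : 0 < W) (hκ : 0 ≤ κ) (hg1 : ∀ v, 1 ≤ g v)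
    (hg : ∀ v, ∑ u, influenceMatrix P u v * g u ≤ A * g v)
    (hA : p * (2 * A) * Real.exp κ * W ≤ κ) (X₀ : V → Fin q) (r : ℕ) (v : V) {s : ℕ} (hs : s ≤ S) :
    (slotMeasure P S p).real {ω | iterates (fun _ => 0) (fun r => r * W) X₀ ω r v s ≠
      slotState X₀ ω s v} ≤ g v * Real.exp (κ * (s / W - r)) := by
  have hW' : (0 : ℝ) < W := Nat.cast_pos.2 hW
  have htriv : ∀ r s : ℕ, r * W < s → ∀ v : V, (1 : ℝ) ≤ g v * Real.exp (κ * (s / W - r)) := by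
    intro r s hrs v
    have h1 : (r : ℝ) ≤ s / W := by
      rw [le_div_iff₀ hW']
      exact_mod_cast hrs.le
    have h2 : 1 ≤ Real.exp (κ * (s / W - r)) :=
      Real.one_le_exp (mul_nonneg hκ (sub_nonneg.2 h1))
    exact one_le_mul_of_one_le_of_one_le (hg1 v) h2
  have hzero : ∀ r v, (slotMeasure P S p).real {ω | iterates (fun _ => 0) (fun r => r * W) X₀ ω r v
      0 ≠ slotState X₀ ω 0 v} ≤ g v * Real.exp (κ * ((0 : ℕ) / W - r)) := by
    intro r v
    have : {ω : SlotSpace G q S | iterates (fun _ => 0) (fun r => r * W) X₀ ω r v 0 ≠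
        slotState X₀ ω 0 v} = ∅ := by
      refine Set.eq_empty_of_forall_notMem fun ω hω => hω ?_
      cases r <;> rfl
    rw [this, measureReal_empty]
    exact mul_nonneg (zero_le_one.trans (hg1 v)) (Real.exp_nonneg _)
  induction r generalizing v s with
  | zero =>
    rcases Nat.eq_zero_or_pos s with rfl | h
    · exact hzero 0 v
    · exact measureReal_le_one.trans (htriv 0 s (by simpa using h) v)
  | succ r ihr =>
    induction s with
    | zero => exact hzero (r + 1) v
    | succ s ihs =>
      rcases lt_or_ge ((r + 1) * W) (s + 1) with hlt | hle
      · exact measureReal_le_one.trans (htriv (r + 1) (s + 1) hlt v)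
      have hsS : s < S := by omega
      set U := iterates (fun _ => 0) (fun r => r * W) X₀ (G := G) (S := S) with hU
      have hsub : {ω : SlotSpace G q S | U ω (r + 1) v (s + 1) ≠ slotState X₀ ω (s + 1) v} ⊆
          {ω | U ω (r + 1) v s ≠ slotState X₀ ω s v} ∪
          {ω | (ω ⟨v, ⟨s, hsS⟩⟩).1 = true ∧ (ω ⟨v, ⟨s, hsS⟩⟩).2 (fun u => U ω r u s) ≠
            (ω ⟨v, ⟨s, hsS⟩⟩).2 (fun u => slotState X₀ ω s u)} := by
        intro ω hω
        simp only [Set.mem_ofPred_eq, hU, iterates, windowTrajectory, slotState, slotStep,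
          ringAt_of_lt _ hsS, writeAt_of_lt _ hsS, Nat.not_lt_zero, if_false, not_lt.2 hle] at hω
        by_cases hring : (ω ⟨v, ⟨s, hsS⟩⟩).1 = true
        · right
          simp only [siteData, hring, if_true] at hω
          exact ⟨hring, hω⟩
        · left
          simp only [siteData, if_neg hring] at hω
          exact hω
      have h1 := ihs (by omega)
      have h2 := measureReal_write_ne_le P p ⟨v, ⟨s, hsS⟩⟩ (fun ω u => U ω r u s)
        (fun ω => slotState X₀ ω s)
        (fun ω ω' h => funext fun u => iterates_congr _ _ X₀ (fun i hi => h i fun hi' => by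
          rw [hi'] at hi; exact lt_irrefl _ hi) r u le_rfl)
        (fun ω ω' h => slotState_congr X₀ fun i hi => h i fun hi' => by
          rw [hi'] at hi; exact lt_irrefl _ hi)
      have h3 : ∑ u, 2 * influenceMatrix P u v *
          (slotMeasure P S p).real {ω | U ω r u s ≠ slotState X₀ ω s u} ≤
          2 * A * g v * Real.exp (κ * (s / W - r)) := by
        calc _ ≤ ∑ u, 2 * influenceMatrix P u v * (g u * Real.exp (κ * (s / W - r))) :=
              Finset.sum_le_sum fun u _ => mul_le_mul_of_nonneg_left (ihr u (by omega))
                (mul_nonneg (by norm_num) (influenceMatrix_nonneg P u v))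
          _ = 2 * (∑ u, influenceMatrix P u v * g u) * Real.exp (κ * (s / W - r)) := by
              rw [Finset.mul_sum, Finset.sum_mul]
              exact Finset.sum_congr rfl fun u _ => by ring
          _ ≤ 2 * (A * g v) * Real.exp (κ * (s / W - r)) := by
              refine mul_le_mul_of_nonneg_right ?_ (Real.exp_nonneg _)
              exact mul_le_mul_of_nonneg_left (hg v) (by norm_num)
          _ = _ := by ring
      refine (measureReal_mono hsub).trans ((measureReal_union_le _ _).trans
        ((add_le_add h1 (h2.trans (mul_le_mul_of_nonneg_left h3 p.2.1))).trans ?_))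
      have e1 : Real.exp (κ * (s / W - r)) =
          Real.exp κ * Real.exp (κ * (s / W - (r + 1 : ℕ))) := by
        rw [← Real.exp_add]; congr 1; push_cast; ring
      have e2 : Real.exp (κ * ((s + 1 : ℕ) / W - (r + 1 : ℕ))) =
          Real.exp (κ / W) * Real.exp (κ * (s / W - (r + 1 : ℕ))) := by
        rw [← Real.exp_add]; congr 1; push_cast; field_simp; ring
      have e3 : 1 + p * (2 * A) * Real.exp κ ≤ Real.exp (κ / W) := by
        have := Real.add_one_le_exp (κ / W)
        have h4 : p * (2 * A) * Real.exp κ ≤ κ / W := by rwa [le_div_iff₀ hW']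
        linarith
      rw [e1, e2]
      have e4 : 0 ≤ g v * Real.exp (κ * (s / W - (r + 1 : ℕ))) :=
        mul_nonneg (zero_le_one.trans (hg1 v)) (Real.exp_nonneg _)
      nlinarith [mul_le_mul_of_nonneg_right e3 e4]

/-! ### The number of rings -/

/-- The number of rings in the slots from `a` to `b - 1`. -/
def ringCount (ring : ℕ → Bool) (a b : ℕ) : ℕ := ((Finset.Ico a b).filter fun s => ring s).card

/-- A Chernoff bound for the number of rings in `l` slots: a union bound over the sets of `k` slots,
and `x ^ k / k! ≤ exp x`. -/
theorem measureReal_ringCount_le (P : LocalRule G q) (p : unitInterval) (v : V) (a l k : ℕ)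
    (θ : ℝ) :
    (slotMeasure P S p).real {ω | k ≤ ringCount (ringAt (siteData ω v)) a (a + l)} ≤
      Real.exp (-(θ * k)) * Real.exp (l * p * Real.exp θ) := by
  classical
  have hsub : {ω : SlotSpace G q S | k ≤ ringCount (ringAt (siteData ω v)) a (a + l)} ⊆
      ⋃ K ∈ (Finset.Ico a (a + l)).powersetCard k,
        {ω | ∀ s ∈ K, ringAt (siteData ω v) s = true} := by
    intro ω hω
    obtain ⟨K, hK1, hK2⟩ := Finset.exists_subset_card_eq (show k ≤ ((Finset.Ico a (a + l)).filter
      fun s => ringAt (siteData ω v) s).card from hω)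
    refine Set.mem_biUnion (Finset.mem_coe.2 (Finset.mem_powersetCard.2
      ⟨hK1.trans (Finset.filter_subset _ _), hK2⟩)) fun s hs => ?_
    exact (Finset.mem_filter.1 (hK1 hs)).2
  have hone : ∀ K ∈ (Finset.Ico a (a + l)).powersetCard k, (slotMeasure P S p).real
      {ω | ∀ s ∈ K, ringAt (siteData ω v) s = true} ≤ (p : ℝ) ^ k := by
    intro K hK
    by_cases hKS : ∀ s ∈ K, s < S
    · let K' : Finset ((_ : V) × Fin S) := K.attach.map ⟨fun s => ⟨v, ⟨s.1, hKS s.1 s.2⟩⟩, fun s s' h =>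
        Subtype.ext (congrArg (fun j : (_ : V) × Fin S => j.2.val) h)⟩
      have hset : {ω : SlotSpace G q S | ∀ s ∈ K, ringAt (siteData ω v) s = true} =
          (K' : Set ((_ : V) × Fin S)).pi fun _ => {z | z.1 = true} := by
        ext ω
        simp only [Set.mem_ofPred_eq, Set.mem_pi, K', Finset.coe_map, Set.mem_image,
          Finset.mem_coe, Finset.mem_attach, true_and]
        constructor
        · rintro h _ ⟨s, rfl⟩
          have := h s.1 s.2
          rwa [ringAt_of_lt _ (hKS s.1 s.2)] at this
        · intro h s hs
          rw [ringAt_of_lt _ (hKS s hs)]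
          exact h _ ⟨⟨s, hs⟩, rfl⟩
      have h1 : ∀ w : V, (slotLaw p (P w)).real {z | z.1 = true} = p := fun w =>
        (exists_slotLaw p (P w)).choose_spec.2.1
      rw [hset, measureReal_def, infinitePi_pi _ fun i _ => (Set.toFinite _).measurableSet,
        ENNReal.toReal_prod]
      simp_rw [← measureReal_def, h1]
      rw [Finset.prod_const, Finset.card_map, Finset.card_attach, (Finset.mem_powersetCard.1 hK).2]
    · push Not at hKS
      obtain ⟨s, hs, hsS⟩ := hKS
      have : {ω : SlotSpace G q S | ∀ s ∈ K, ringAt (siteData ω v) s = true} = ∅ := by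
        refine Set.eq_empty_of_forall_notMem fun ω hω => ?_
        have := hω s hs
        simp [ringAt, not_lt.2 hsS] at this
      rw [this, measureReal_empty]
      exact pow_nonneg p.2.1 k
  have hp0 : (0 : ℝ) ≤ p := p.2.1
  have h0 : (0 : ℝ) ≤ l * p * Real.exp θ := by positivity
  calc _ ≤ ∑ K ∈ (Finset.Ico a (a + l)).powersetCard k, (slotMeasure P S p).real
        {ω | ∀ s ∈ K, ringAt (siteData ω v) s = true} :=
        (measureReal_mono hsub (measure_ne_top _ _)).trans (measureReal_biUnion_finset_le _ _)
    _ ≤ (l.choose k : ℝ) * (p : ℝ) ^ k := by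
        refine (Finset.sum_le_sum hone).trans_eq ?_
        rw [Finset.sum_const, Finset.card_powersetCard, Nat.card_Ico, nsmul_eq_mul,
          Nat.add_sub_cancel_left]
    _ ≤ (l : ℝ) ^ k / k.factorial * (p : ℝ) ^ k :=
        mul_le_mul_of_nonneg_right (Nat.choose_le_pow_div k l) (pow_nonneg p.2.1 k)
    _ = Real.exp (-(θ * k)) * ((l * p * Real.exp θ) ^ k / k.factorial) := by
        rw [mul_pow, mul_pow, ← Real.exp_nat_mul, mul_comm (k : ℝ) θ, mul_div_assoc', mul_comm,
          Real.exp_neg]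
        field_simp
    _ ≤ _ := mul_le_mul_of_nonneg_left (Real.pow_div_factorial_le_exp _ h0 k) (Real.exp_nonneg _)

end Iterates

/-! ### Frozen iterations and the encoding of trajectories -/

section Freezing

variable {V : Type*} {G : SimpleGraph V} {q : ℕ} [NeZero q] {S : ℕ}

/-- Recomputing a slot only in the `L` iterations after the window has reached it changes nothing,
provided that the iterations have converged by then. -/
theorem iterates_frozen_eq (W L R : ℕ) (X₀ : V → Fin q) (ω : SlotSpace G q S)
    (hgood : ∀ r ≤ R, ∀ v, ∀ s ≤ S, s + L * W ≤ (r + 1) * W →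
      iterates (fun _ => 0) (fun r => r * W) X₀ ω r v s = slotState X₀ ω s v)
    {r : ℕ} (hr : r ≤ R) (v : V) {s : ℕ} (hs : s ≤ S) :
    iterates (fun r => (r - L) * W) (fun r => r * W) X₀ ω r v s =
      iterates (fun _ => 0) (fun r => r * W) X₀ ω r v s := by
  induction r generalizing v s with
  | zero => rfl
  | succ r ihr =>
    induction s with
    | zero => rfl
    | succ s ihs =>
      have h1 : ∀ u, iterates (fun r => (r - L) * W) (fun r => r * W) X₀ ω r u s =
          iterates (fun _ => 0) (fun r => r * W) X₀ ω r u s := fun u =>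
        ihr (by omega) u (by omega)
      have h2 := ihr (by omega) v hs
      have h3 := ihs (by omega)
      by_cases hlt : s + 1 < (r + 1 - L) * W
      · have h4 : s + 1 + L * W ≤ (r + 1) * W := by
          rw [Nat.sub_mul] at hlt; omega
        have h5 : (r + 1) * W ≤ (r + 1 + 1) * W := Nat.mul_le_mul_right _ (by omega)
        rw [hgood (r + 1) hr v (s + 1) hs (by omega), ← hgood r (by omega) v (s + 1) hs h4, ← h2]
        simp only [iterates, windowTrajectory, if_pos hlt]
      · simp only [iterates] at h3
        simp only [iterates, windowTrajectory, if_neg hlt, Nat.not_lt_zero, if_false, h1, h3]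

end Freezing

section Encoding

variable {q : ℕ} [NeZero q]

theorem ringCount_succ (ring : ℕ → Bool) {a s : ℕ} (h : a ≤ s) :
    ringCount ring a (s + 1) = ringCount ring a s + if ring s then 1 else 0 := by
  unfold ringCount
  rw [Nat.Ico_succ_right_eq_insert_Ico h, Finset.filter_insert]
  split_ifs
  · rw [Finset.card_insert_of_notMem (by simp)]
  · rfl

theorem ringCount_mono (ring : ℕ → Bool) (a : ℕ) {s t : ℕ} (h : s ≤ t) :
    ringCount ring a s ≤ ringCount ring a t :=
  Finset.card_le_card (Finset.filter_subset_filter _ (Finset.Ico_subset_Ico_right h))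

open Classical in
/-- The spins of a trajectory on the window from `a` to `b`, indexed by the number of rings since
the beginning of the window. -/
noncomputable def windowCode (m a b : ℕ) (ring : ℕ → Bool) (y : ℕ → Fin q) (i : Fin (m + 1)) :
    Fin q :=
  if h : ∃ s, a ≤ s ∧ s ≤ b ∧ ringCount ring a s = i then y h.choose else 0

/-- A trajectory that changes only at rings is determined by its code. -/
theorem windowCode_ringCount {m a b : ℕ} {ring : ℕ → Bool} {y : ℕ → Fin q}
    (hy : ∀ s, a ≤ s → s < b → ring s = false → y (s + 1) = y s) (hm : ringCount ring a b ≤ m)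
    {s : ℕ} (h1 : a ≤ s) (h2 : s ≤ b) :
    windowCode m a b ring y (Fin.ofNat (m + 1) (ringCount ring a s)) = y s := by
  have key : ∀ s t, a ≤ s → s ≤ t → t ≤ b → ringCount ring a s = ringCount ring a t →
      y t = y s := by
    intro s t has hst
    induction t, hst using Nat.le_induction with
    | base => intros; rfl
    | succ t hst ih =>
      intro ht hc
      have h3 := ringCount_succ ring (a := a) (s := t) (by omega)
      have h4 := ringCount_mono ring a hst
      have h5 : ring t = false := by
        by_contra h
        rw [if_pos (by simpa using h)] at h3
        omega
      rw [h5] at h3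
      rw [hy t (by omega) (by omega) h5, ih (by omega) (by simpa using hc.trans h3)]
  have hlt : ringCount ring a s < m + 1 := by
    have := ringCount_mono ring a h2
    omega
  have hval : ((Fin.ofNat (m + 1) (ringCount ring a s) : Fin (m + 1)) : ℕ) = ringCount ring a s :=
    Nat.mod_eq_of_lt hlt
  have h : ∃ s', a ≤ s' ∧ s' ≤ b ∧
      ringCount ring a s' = (Fin.ofNat (m + 1) (ringCount ring a s) : Fin (m + 1)) :=
    ⟨s, h1, h2, hval.symm⟩
  rw [windowCode, dif_pos h]
  obtain ⟨h3, h4, h5⟩ := h.choose_spec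
  replace h5 := h5.trans hval
  rcases le_total h.choose s with h6 | h6
  · exact (key _ _ h3 h6 h2 h5).symm
  · exact key _ _ h1 h6 h4 h5.symm

end Encoding

/-! ### The CONGEST algorithm -/

section Algorithm

open Measure

/-- The parameters of the algorithm for one time horizon, with the encodings of ring patterns and of
windows of trajectories as messages. -/
structure Protocol (q B : ℕ) where
  /-- The number of time slots. -/
  slots : ℕ
  /-- The probability that a clock rings in a slot. -/
  prob : unitInterval
  /-- The number of slots by which the window advances in one iteration. -/
  width : ℕ
  /-- The number of iterations for which a slot remains in the window. -/
  life : ℕ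
  /-- The maximal number of rings in a window. -/
  marks : ℕ
  /-- The number of rounds in which the ring patterns are exchanged. -/
  ringRounds : ℕ
  /-- The number of iterations. -/
  iterRounds : ℕ
  encodeRings : (Fin slots → Bool) → Fin ringRounds → Msg B
  decodeRings : (Fin ringRounds → Msg B) → Fin slots → Bool
  encodeMarks : (Fin (marks + 1) → Fin q) → Msg B
  decodeMarks : Msg B → Fin (marks + 1) → Fin q

namespace Protocol

variable {V : Type*} {q B : ℕ} [NeZero q] (Q : Protocol q B)

/-- The first slot of the window in iteration `r`. -/
def lo (r : ℕ) : ℕ := (r - Q.life) * Q.width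

/-- The last slot of the window in iteration `r`. -/
def hi (r : ℕ) : ℕ := r * Q.width

/-- The message of round `k` from `u`. -/
def getMsg (hist : List (V → Msg B)) (k : ℕ) (u : V) : Msg B :=
  hist.getD k (fun _ _ => false) u

/-- The rings of `u` as decoded by its neighbours. -/
def neighborRing (hist : List (V → Msg B)) (u : V) (s : ℕ) : Bool :=
  if h : s < Q.slots then Q.decodeRings (fun k => getMsg hist k u) ⟨s, h⟩ else false

/-- The trajectory of `u` in iteration `r` as decoded by its neighbours. -/
def neighborTrajectory (hist : List (V → Msg B)) (u : V) : ℕ → ℕ → Fin q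
  | 0, s => if Q.hi 0 < s then 0 else Q.decodeMarks (getMsg hist Q.ringRounds u)
      (Fin.ofNat _ (ringCount (Q.neighborRing hist u) (Q.lo 0) s))
  | r + 1, s => if s < Q.lo (r + 1) then neighborTrajectory hist u r s
      else if Q.hi (r + 1) < s then 0
      else Q.decodeMarks (getMsg hist (Q.ringRounds + (r + 1)) u)
        (Fin.ofNat _ (ringCount (Q.neighborRing hist u) (Q.lo (r + 1)) s))

open Classical in
/-- The trajectory of a node in iteration `r` as computed by itself. -/
noncomputable def ownTrajectory (inp : LocalInput V q)
    (D : Fin Q.slots → Bool × ((inp.nbhd → Fin q) → Fin q)) (hist : List (V → Msg B)) :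
    ℕ → ℕ → Fin q
  | 0 => initTrajectory inp.spin
  | r + 1 => windowTrajectory (Q.lo (r + 1)) (Q.hi (r + 1)) inp.spin (ringAt D)
      (fun s => writeAt D s fun u => if (u : V) = inp.self then ownTrajectory inp D hist r s
        else Q.neighborTrajectory hist u r s)
      (ownTrajectory inp D hist r)

/-- The message sent to all neighbours: a part of the ring pattern in the first rounds, then the
window of the trajectory of the current iteration. -/
noncomputable def message (inp : LocalInput V q)
    (D : Fin Q.slots → Bool × ((inp.nbhd → Fin q) → Fin q)) (hist : List (V → Msg B)) : Msg B :=
  if h : hist.length < Q.ringRounds then Q.encodeRings (fun s => (D s).1) ⟨hist.length, h⟩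
  else Q.encodeMarks (windowCode Q.marks (Q.lo (hist.length - Q.ringRounds))
    (Q.hi (hist.length - Q.ringRounds)) (ringAt D)
      (Q.ownTrajectory inp D hist (hist.length - Q.ringRounds)))

theorem message_of_lt (inp : LocalInput V q)
    (D : Fin Q.slots → Bool × ((inp.nbhd → Fin q) → Fin q)) (hist : List (V → Msg B))
    (k : Fin Q.ringRounds) (h : hist.length = k) :
    Q.message inp D hist = Q.encodeRings (fun s => (D s).1) k := by
  rw [message, dif_pos (h ▸ k.2)]
  congr 1
  exact Fin.ext h

theorem message_of_length_eq (inp : LocalInput V q)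
    (D : Fin Q.slots → Bool × ((inp.nbhd → Fin q) → Fin q)) (hist : List (V → Msg B)) (r : ℕ)
    (h : hist.length = Q.ringRounds + r) :
    Q.message inp D hist = Q.encodeMarks (windowCode Q.marks (Q.lo r) (Q.hi r) (ringAt D)
      (Q.ownTrajectory inp D hist r)) := by
  have h' : hist.length - Q.ringRounds = r := by omega
  rw [message, dif_neg (by omega), h']

end Protocol

variable {V : Type*} [Finite V] {q B : ℕ} [NeZero q]

/-- The joint law of what happens at a site in all slots. -/
noncomputable abbrev siteLaw (S : ℕ) (p : unitInterval) (inp : LocalInput V q) :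
    Measure (Fin S → Bool × ((inp.nbhd → Fin q) → Fin q)) :=
  infinitePi fun _ => slotLaw p inp.rule

/-- The private coins of a node, turned into the data of its slots. -/
noncomputable def sampler (S : ℕ) (p : unitInterval) (inp : LocalInput V q) :
    (ℕ → Bool) → Fin S → Bool × ((inp.nbhd → Fin q) → Fin q) :=
  (exists_measurable_map_coinMeasure (siteLaw S p inp)).choose

theorem measurable_sampler (S : ℕ) (p : unitInterval) (inp : LocalInput V q) :
    Measurable (sampler S p inp) :=
  (exists_measurable_map_coinMeasure (siteLaw S p inp)).choose_spec.1

theorem map_sampler (S : ℕ) (p : unitInterval) (inp : LocalInput V q) :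
    coinMeasure.map (sampler S p inp) = siteLaw S p inp :=
  (exists_measurable_map_coinMeasure (siteLaw S p inp)).choose_spec.2

/-- The algorithm with parameters depending on the time horizon. -/
noncomputable def simulation (prot : ℝ → Protocol q B) : CongestAlgorithm V q B where
  rounds T := (prot T).ringRounds + (prot T).iterRounds
  send inp bits hist _ := (prot inp.horizon).message inp
    (sampler (prot inp.horizon).slots (prot inp.horizon).prob inp bits) hist
  output inp bits hist := (prot inp.horizon).ownTrajectory inp
    (sampler (prot inp.horizon).slots (prot inp.horizon).prob inp bits) hist (prot inp.horizon).iterRounds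
      (prot inp.horizon).slots
  measurable_send inp hist _ := (measurable_of_finite fun D =>
    (prot inp.horizon).message inp D hist).comp (measurable_sampler _ _ inp)
  measurable_output inp hist := (measurable_of_finite fun D =>
    (prot inp.horizon).ownTrajectory inp D hist (prot inp.horizon).iterRounds
      (prot inp.horizon).slots).comp (measurable_sampler _ _ inp)

theorem length_received {V : Type*} {q B : ℕ} (A : CongestAlgorithm V q B) (G : SimpleGraph V)
    (inp : V → LocalInput V q) (bits : V → ℕ → Bool) (r : ℕ) (v : V) :
    (A.received G inp bits r v).length = r := by
  induction r with
  | zero => rfl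
  | succ r ih => simp [CongestAlgorithm.received, ih]

theorem getMsg_received {V : Type*} {q B : ℕ} (A : CongestAlgorithm V q B) (G : SimpleGraph V)
    (inp : V → LocalInput V q) (bits : V → ℕ → Bool) {r k : ℕ} (hk : k < r) {u v : V}
    (huv : G.Adj u v) :
    Protocol.getMsg (A.received G inp bits r v) k u =
      A.send (inp u) (bits u) (A.received G inp bits k u) v := by
  induction r with
  | zero => omega
  | succ r ih =>
    unfold Protocol.getMsg at ih ⊢
    rw [CongestAlgorithm.received]
    rcases Nat.lt_or_ge k r with h | h
    · rw [List.getD_append _ _ _ _ (by rwa [length_received]), ih h]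
    · obtain rfl : k = r := by omega
      rw [List.getD_append_right _ _ _ _ (by rw [length_received]), length_received]
      simp [huv]

variable {G : SimpleGraph V}

/-- The data of all slots produced by the private coins. -/
noncomputable def sampledSlots (P : LocalRule G q) (X₀ : V → Fin q) (T : ℝ) (S : ℕ)
    (p : unitInterval) (bits : V → ℕ → Bool) : SlotSpace G q S :=
  fun i => sampler S p (localInput P X₀ T i.1) (bits i.1) i.2

/-- If the ring patterns and the windows fit into the messages, the nodes compute the frozen
iterations. -/
theorem run_simulation_eq (prot : ℝ → Protocol q B) (P : LocalRule G q) (X₀ : V → Fin q) (T : ℝ)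
    (bits : V → ℕ → Bool)
    (hmarks : ∀ c, (prot T).decodeMarks ((prot T).encodeMarks c) = c)
    (hrings : ∀ v, (prot T).decodeRings ((prot T).encodeRings fun s =>
      (sampledSlots P X₀ T (prot T).slots (prot T).prob bits ⟨v, s⟩).1) =
        fun s => (sampledSlots P X₀ T (prot T).slots (prot T).prob bits ⟨v, s⟩).1)
    (hcount : ∀ r < (prot T).iterRounds, ∀ v, ringCount (ringAt (siteData (sampledSlots P X₀ T
      (prot T).slots (prot T).prob bits) v)) ((prot T).lo r) ((prot T).hi r) ≤ (prot T).marks) (v : V) :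
    (simulation prot : CongestAlgorithm V q B).run P X₀ T bits v =
      iterates (prot T).lo (prot T).hi X₀ (sampledSlots P X₀ T (prot T).slots (prot T).prob bits)
        (prot T).iterRounds v (prot T).slots := by
  set Θ := prot T with hΘ
  set ω := sampledSlots P X₀ T Θ.slots Θ.prob bits with hω
  set A : CongestAlgorithm V q B := simulation prot with hA
  set rec : ℕ → V → List (V → Msg B) := A.received G (localInput P X₀ T) bits with hrec
  set Y := iterates Θ.lo Θ.hi X₀ ω with hY
  have hlen : ∀ k v, (rec k v).length = k := length_received A G _ bits
  have hsend : ∀ k u v, A.send (localInput P X₀ T u) (bits u) (rec k u) v =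
      Θ.message (localInput P X₀ T u) (siteData ω u) (rec k u) := fun _ _ _ => rfl
  have hring : ∀ R ≥ Θ.ringRounds, ∀ u v, G.Adj u v →
      Θ.neighborRing (rec R v) u = ringAt (siteData ω u) := by
    intro R hR u v huv
    funext s
    unfold Protocol.neighborRing ringAt
    split_ifs with hs
    · have : (fun k : Fin Θ.ringRounds => Protocol.getMsg (rec R v) k u) =
          Θ.encodeRings fun s => (ω ⟨u, s⟩).1 := by
        funext k
        rw [hrec, getMsg_received A G _ bits (lt_of_lt_of_le k.2 hR) huv, ← hrec, hsend]
        exact Θ.message_of_lt _ _ _ k (hlen k u)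
      rw [this, hrings u]
    · rfl
  have hstart : ∀ r u, Y r u 0 = X₀ u := by
    intro r u
    cases r <;> rfl
  have hconst : ∀ r u s, Θ.lo r ≤ s → s < Θ.hi r → ringAt (siteData ω u) s = false →
      Y r u (s + 1) = Y r u s := by
    intro r u s h1 h2 h3
    cases r with
    | zero => simp [Protocol.hi] at h2
    | succ r =>
      simp only [hY, iterates, windowTrajectory, h3]
      rw [if_neg (by omega), if_neg (by omega)]
      rfl
  -- the message of iteration `r` conveys the trajectory on the window
  have hdecode : ∀ r < Θ.iterRounds, (∀ u, Θ.ownTrajectory (localInput P X₀ T u) (siteData ω u)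
      (rec (Θ.ringRounds + r) u) r = Y r u) → ∀ R > Θ.ringRounds + r, ∀ u v, G.Adj u v →
      ∀ s, Θ.lo r ≤ s → s ≤ Θ.hi r →
      Θ.decodeMarks (Protocol.getMsg (rec R v) (Θ.ringRounds + r) u)
        (Fin.ofNat _ (ringCount (Θ.neighborRing (rec R v) u) (Θ.lo r) s)) = Y r u s := by
    intro r hr hown R hR u v huv s h1 h2
    rw [hring R (by omega) u v huv, hrec, getMsg_received A G _ bits hR huv, ← hrec, hsend]
    have h3 := Θ.message_of_length_eq (localInput P X₀ T u) (siteData ω u)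
      (rec (Θ.ringRounds + r) u) r (hlen _ _)
    rw [hown u] at h3
    rw [h3, hmarks]
    exact windowCode_ringCount (hconst r u) (hcount r hr u) h1 h2
  have main : ∀ r, (r ≤ Θ.iterRounds → ∀ R ≥ Θ.ringRounds + r, ∀ v,
        Θ.ownTrajectory (localInput P X₀ T v) (siteData ω v) (rec R v) r = Y r v) ∧
      (r < Θ.iterRounds → ∀ R > Θ.ringRounds + r, ∀ u v, G.Adj u v →
        Θ.neighborTrajectory (rec R v) u r = Y r u) := by
    intro r
    induction r with
    | zero =>
      have hown : ∀ R v, Θ.ownTrajectory (localInput P X₀ T v) (siteData ω v) (rec R v) 0 =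
          Y 0 v := fun _ _ => rfl
      refine ⟨fun _ R _ v => hown R v, fun h0 R hR u v huv => ?_⟩
      funext s
      rw [Protocol.neighborTrajectory]
      split_ifs with hs
      · rw [Protocol.hi, Nat.zero_mul] at hs
        exact (if_neg (by omega)).symm
      · exact hdecode 0 h0 (fun u => hown _ u) R hR u v huv s
          (by rw [Protocol.lo, Nat.zero_sub, Nat.zero_mul]; exact Nat.zero_le _) (by omega)
    | succ r ih =>
      have hown : r + 1 ≤ Θ.iterRounds → ∀ R ≥ Θ.ringRounds + (r + 1), ∀ v,
          Θ.ownTrajectory (localInput P X₀ T v) (siteData ω v) (rec R v) (r + 1) =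
            Y (r + 1) v := by
        intro hr R hR v
        have h1 := ih.1 (by omega) R (by omega) v
        change windowTrajectory _ _ _ _ _ _ = windowTrajectory _ _ _ _ _ _
        rw [h1]
        congr 1
        funext s
        congr 1
        funext u
        split_ifs with hu
        · change u.1 = v at hu
          rw [hu]
        · have huv : G.Adj u.1 v := by
            rcases u.2 with h | h
            · exact absurd h hu
            · exact ((SimpleGraph.mem_neighborSet G v u.1).1 h).symm
          rw [ih.2 (by omega) R (by omega) u.1 v huv]
      refine ⟨hown, fun hr R hR u v huv => ?_⟩
      funext s
      rw [Protocol.neighborTrajectory]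
      split_ifs with h1 h2
      · rw [ih.2 (by omega) R (by omega) u v huv]
        cases s with
        | zero => rw [hstart, hstart]
        | succ s => simp only [hY, iterates, windowTrajectory, if_pos h1]
      · cases s with
        | zero => omega
        | succ s => simp only [hY, iterates, windowTrajectory, if_neg h1, if_pos h2]
      · exact hdecode (r + 1) hr (fun u => hown (by omega) _ le_rfl u) R hR u v huv s
          (by omega) (by omega)
  have hfin := (main Θ.iterRounds).1 le_rfl (Θ.ringRounds + Θ.iterRounds) le_rfl v
  exact congrFun hfin Θ.slots

/-- The private coins produce the law of the slotted chain. -/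
theorem map_sampledSlots (P : LocalRule G q) (X₀ : V → Fin q) (T : ℝ) (S : ℕ) (p : unitInterval) :
    (infinitePi fun _ : V => coinMeasure).map (sampledSlots P X₀ T S p) = slotMeasure P S p := by
  let f : (v : V) → (ℕ → Bool) → Fin S → Bool × ((inclNbhd G v → Fin q) → Fin q) := fun v =>
    sampler S p (localInput P X₀ T v)
  have hf : ∀ v, Measurable (f v) := fun v => measurable_sampler _ _ _
  have hs : ∀ v, coinMeasure.map (f v) = infinitePi fun _ : Fin S => slotLaw p (P v) :=
    fun v => map_sampler _ _ _
  have h1 := infinitePi_map_pi (fun _ : V => coinMeasure) (f := f) hf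
  simp_rw [hs] at h1
  have h2 := infinitePi_map_piCurry_symm (ι := V) (κ := fun _ => Fin S)
    (X := fun v _ => Bool × ((inclNbhd G v → Fin q) → Fin q)) fun v _ => slotLaw p (P v)
  have h3 : Measurable fun (x : V → ℕ → Bool) v => f v (x v) :=
    measurable_pi_iff.2 fun v => (hf v).comp (measurable_pi_apply v)
  rw [slotMeasure, ← h2, ← h1]
  refine Eq.symm (map_map (g := (MeasurableEquiv.piCurry fun (v : V) (_ : Fin S) =>
    Bool × ((inclNbhd G v → Fin q) → Fin q)).symm) ?_ h3)
  exact MeasurableEquiv.measurable _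

end Algorithm

/-! ### Error analysis of the algorithm -/

section ErrorAnalysis

open Measure

/-- Duality: the total variation distance is attained by the sign of the difference. -/
theorem tvDist_le_of_forall_test {Ω : Type*} [Fintype Ω] {μ ν : Ω → ℝ} {δ : ℝ}
    (h : ∀ φ : Ω → ℝ, (∀ x, |φ x| ≤ 1) → ∑ x, μ x * φ x - ∑ x, ν x * φ x ≤ 2 * δ) :
    tvDist μ ν ≤ δ := by
  have h1 := h (fun x => SignType.sign (μ x - ν x)) fun x => by
    rcases lt_trichotomy (μ x - ν x) 0 with h | h | h <;> simp [h]
  have h2 : ∑ x, |μ x - ν x| =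
      ∑ x, μ x * (SignType.sign (μ x - ν x) : ℝ) - ∑ x, ν x * SignType.sign (μ x - ν x) := by
    rw [← Finset.sum_sub_distrib]
    exact Finset.sum_congr rfl fun x _ => by rw [← sub_mul, self_mul_sign]
  rw [tvDist, h2]
  linarith

/-- A function of bounded oscillation changes in mean by at most twice the probability that its
arguments differ. -/
theorem integral_sub_integral_le_of_ne_subset {Ω Y : Type*} [MeasurableSpace Ω]
    [MeasurableSpace Y] [Finite Y] [DiscreteMeasurableSpace Y] {μ : Measure Ω}
    [IsFiniteMeasure μ] {X X' : Ω → Y} (hX : Measurable X) (hX' : Measurable X') {E : Set Ω}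
    (hE : MeasurableSet E) (h : ∀ ω ∉ E, X ω = X' ω) {φ : Y → ℝ} (hφ : ∀ y, |φ y| ≤ 1) :
    ∫ ω, φ (X ω) ∂μ - ∫ ω, φ (X' ω) ∂μ ≤ 2 * μ.real E := by
  have hi := integrable_comp_of_finite (μ := μ) hX.aemeasurable φ
  have hi' := integrable_comp_of_finite (μ := μ) hX'.aemeasurable φ
  rw [← integral_sub hi hi', mul_comm, ← smul_eq_mul, ← integral_indicator_const _ hE]
  refine integral_mono (hi.sub hi') ((integrable_const _).indicator hE) fun ω => ?_
  by_cases hω : ω ∈ E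
  · rw [Set.indicator_of_mem hω]
    have h1 := abs_le.1 (hφ (X ω))
    have h2 := abs_le.1 (hφ (X' ω))
    show φ (X ω) - φ (X' ω) ≤ 2
    linarith
  · rw [Set.indicator_of_notMem hω]
    simp [h ω hω]

variable {V : Type*} [Fintype V] {q B : ℕ} [NeZero q] {G : SimpleGraph V}

theorem measurable_sampledSlots (P : LocalRule G q) (X₀ : V → Fin q) (T : ℝ) (S : ℕ)
    (p : unitInterval) : Measurable (sampledSlots P X₀ T S p) :=
  measurable_pi_iff.2 fun i => (measurable_pi_apply i.2).comp
    ((measurable_sampler S p (localInput P X₀ T i.1)).comp (measurable_pi_apply i.1))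

/-- The private coins matter only through the data of the slots. -/
theorem exists_run_simulation_eq (prot : ℝ → Protocol q B) (P : LocalRule G q) (X₀ : V → Fin q)
    (T : ℝ) : ∃ F : SlotSpace G q (prot T).slots → V → Fin q, ∀ bits,
      (simulation prot : CongestAlgorithm V q B).run P X₀ T bits =
        F (sampledSlots P X₀ T (prot T).slots (prot T).prob bits) := by
  have key : Function.FactorsThrough ((simulation prot : CongestAlgorithm V q B).run P X₀ T)
      (sampledSlots P X₀ T (prot T).slots (prot T).prob) := by
    intro b b' h
    have h1 : ∀ v, sampler (prot T).slots (prot T).prob (localInput P X₀ T v) (b v) =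
        sampler (prot T).slots (prot T).prob (localInput P X₀ T v) (b' v) := fun v =>
      funext fun s => congrFun h ⟨v, s⟩
    have h2 : ∀ r, (simulation prot : CongestAlgorithm V q B).received G (localInput P X₀ T) b r =
        (simulation prot : CongestAlgorithm V q B).received G (localInput P X₀ T) b' r := by
      intro r
      induction r with
      | zero => rfl
      | succ r ih =>
        funext v
        simp only [CongestAlgorithm.received, ih]
        congr 2
        funext u
        split_ifs
        · exact congrArg (fun D => (prot T).message (localInput P X₀ T u) D _) (h1 u)
        · rfl
    funext v
    unfold CongestAlgorithm.run
    rw [h2]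
    exact congrArg (fun D => (prot T).ownTrajectory (localInput P X₀ T v) D _ _ _) (h1 v)
  obtain ⟨F, hF⟩ := (Function.factorsThrough_iff _).1 key
  exact ⟨F, fun bits => congrFun hF bits⟩

/-- The simulation fails only if a clock rings too often, in total or in one window, or if some
iterate has not converged when its slot is frozen. -/
theorem run_simulation_eq_slotState (prot : ℝ → Protocol q B) (P : LocalRule G q) (X₀ : V → Fin q)
    (T : ℝ) (bits : V → ℕ → Bool) {N : ℕ}
    (hmarks : ∀ c, (prot T).decodeMarks ((prot T).encodeMarks c) = c)
    (hrings : ∀ x : Fin (prot T).slots → Bool, ringCount (fun s => if h : s < (prot T).slots then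
      x ⟨s, h⟩ else false) 0 (prot T).slots ≤ N →
        (prot T).decodeRings ((prot T).encodeRings x) = x)
    (hiter : (prot T).slots + (prot T).life * (prot T).width ≤
      ((prot T).iterRounds + 1) * (prot T).width)
    {ω : SlotSpace G q (prot T).slots}
    (hω : sampledSlots P X₀ T (prot T).slots (prot T).prob bits = ω)
    (h1 : ∀ v, ringCount (ringAt (siteData ω v)) 0 (prot T).slots ≤ N)
    (h2 : ∀ v, ∀ r < (prot T).iterRounds, ringCount (ringAt (siteData ω v))
      ((r - (prot T).life) * (prot T).width) (r * (prot T).width) ≤ (prot T).marks)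
    (h3 : ∀ v, ∀ r ≤ (prot T).iterRounds, ∀ s ≤ (prot T).slots,
      s + (prot T).life * (prot T).width ≤ (r + 1) * (prot T).width →
      iterates (fun _ => 0) (fun r => r * (prot T).width) X₀ ω r v s = slotState X₀ ω s v) :
    (simulation prot : CongestAlgorithm V q B).run P X₀ T bits =
      slotState X₀ ω (prot T).slots := by
  funext v
  subst hω
  rw [run_simulation_eq prot P X₀ T bits hmarks (fun v => hrings _ (h1 v))
    (fun r hr v => h2 v r hr) v]
  change iterates (fun r => (r - (prot T).life) * (prot T).width)
    (fun r => r * (prot T).width) _ _ _ _ _ = _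
  rw [iterates_frozen_eq (prot T).width (prot T).life (prot T).iterRounds X₀ _
    (fun r hr v => h3 v r hr) le_rfl v le_rfl, h3 v _ le_rfl _ le_rfl hiter]

variable [DecidableEq V]

theorem measureReal_exists_le {Ω ι : Type*} [MeasurableSpace Ω] {μ : Measure Ω} (s : Finset ι)
    (E : ι → Ω → Prop) {c : ℝ} (h : ∀ i ∈ s, μ.real {ω | E i ω} ≤ c) :
    μ.real {ω | ∃ i ∈ s, E i ω} ≤ s.card * c := by
  have : {ω | ∃ i ∈ s, E i ω} = ⋃ i ∈ s, {ω | E i ω} := by ext; simp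
  rw [this]
  refine (measureReal_biUnion_finset_le _ _).trans ?_
  rw [← nsmul_eq_mul]
  exact Finset.sum_le_card_nsmul _ _ _ h

/-- The distance of the output from the chain: the three failure probabilities, and the error of the
discretization of time. -/
theorem tvDist_outputLaw_simulation_le (prot : ℝ → Protocol q B) (P : LocalRule G q)
    (X₀ : V → Fin q) (T : ℝ) {N : ℕ} {g : V → ℝ} {A κ Γ : ℝ}
    (hmarks : ∀ c, (prot T).decodeMarks ((prot T).encodeMarks c) = c)
    (hrings : ∀ x : Fin (prot T).slots → Bool, ringCount (fun s => if h : s < (prot T).slots then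
      x ⟨s, h⟩ else false) 0 (prot T).slots ≤ N →
        (prot T).decodeRings ((prot T).encodeRings x) = x)
    (hiter : (prot T).slots + (prot T).life * (prot T).width ≤
      ((prot T).iterRounds + 1) * (prot T).width)
    (hT : (prot T).slots * ((prot T).prob : ℝ) = T)
    (hp : Fintype.card V * ((prot T).prob : ℝ) ≤ 1) (hW : 0 < (prot T).width) (hκ : 0 ≤ κ)
    (hg1 : ∀ v, 1 ≤ g v) (hgΓ : ∀ v, g v ≤ Γ)
    (hg : ∀ v, ∑ u, influenceMatrix P u v * g u ≤ A * g v)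
    (hA : ((prot T).prob : ℝ) * (2 * A) * Real.exp κ * (prot T).width ≤ κ) :
    tvDist ((simulation prot : CongestAlgorithm V q B).outputLaw P X₀ T) (chainLaw P X₀ T) ≤
      Fintype.card V * (Real.exp (-(N + 1)) * Real.exp (T * Real.exp 1)) +
      Fintype.card V * ((prot T).iterRounds * (Real.exp (-(κ * ((prot T).marks + 1))) *
        Real.exp ((prot T).life * (prot T).width * (prot T).prob * Real.exp κ))) +
      Fintype.card V * (((prot T).iterRounds + 1) * (((prot T).slots + 1) *
        (Γ * Real.exp (κ * (1 - (prot T).life))))) +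
      3 * (prot T).slots * (Fintype.card V * (prot T).prob) ^ 2 := by
  set Q := prot T with hQ
  set μ := slotMeasure P Q.slots Q.prob with hμ
  let E1 : Set (SlotSpace G q Q.slots) :=
    {ω | ∃ v ∈ Finset.univ, N + 1 ≤ ringCount (ringAt (siteData ω v)) 0 (0 + Q.slots)}
  let E2 : Set (SlotSpace G q Q.slots) :=
    {ω | ∃ v ∈ Finset.univ, ∃ r ∈ Finset.range Q.iterRounds,
      Q.marks + 1 ≤ ringCount (ringAt (siteData ω v)) ((r - Q.life) * Q.width)
        ((r - Q.life) * Q.width + min r Q.life * Q.width)}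
  let E3 : Set (SlotSpace G q Q.slots) :=
    {ω | ∃ v ∈ Finset.univ, ∃ r ∈ Finset.range (Q.iterRounds + 1),
      ∃ s ∈ Finset.range (Q.slots + 1), s + Q.life * Q.width ≤ (r + 1) * Q.width ∧
      iterates (fun _ => 0) (fun r => r * Q.width) X₀ ω r v s ≠ slotState X₀ ω s v}
  have b1 : μ.real E1 ≤ Fintype.card V * (Real.exp (-(N + 1)) * Real.exp (T * Real.exp 1)) := by
    refine measureReal_exists_le _ _ fun v _ => ?_
    refine (measureReal_ringCount_le P Q.prob v 0 Q.slots (N + 1) 1).trans (le_of_eq ?_)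
    rw [hT]
    push_cast
    ring_nf
  have b2 : μ.real E2 ≤ Fintype.card V * (Q.iterRounds * (Real.exp (-(κ * (Q.marks + 1))) *
      Real.exp (Q.life * Q.width * Q.prob * Real.exp κ))) := by
    refine measureReal_exists_le _ _ fun v _ => ?_
    refine (measureReal_exists_le _ _ (c := Real.exp (-(κ * (Q.marks + 1))) *
      Real.exp (Q.life * Q.width * Q.prob * Real.exp κ)) fun r _ => ?_).trans (by
        rw [Finset.card_range])
    refine (measureReal_ringCount_le P Q.prob v _ _ (Q.marks + 1) κ).trans ?_
    push_cast
    have : (0 : ℝ) ≤ Q.prob := Q.prob.2.1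
    gcongr
    exact min_le_right _ _
  have b3 : μ.real E3 ≤ Fintype.card V * ((Q.iterRounds + 1) * ((Q.slots + 1) *
        (Γ * Real.exp (κ * (1 - Q.life))))) := by
    refine measureReal_exists_le _ _ fun v _ => ?_
    refine (measureReal_exists_le _ _ (c := (Q.slots + 1) *
        (Γ * Real.exp (κ * (1 - Q.life)))) fun r _ => ?_).trans (by simp)
    refine (measureReal_exists_le _ _ (c := Γ * Real.exp (κ * (1 - Q.life)))
      fun s hs => ?_).trans (by simp)
    have hΓ : 0 ≤ Γ := by linarith [hg1 v, hgΓ v]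
    by_cases hle : s + Q.life * Q.width ≤ (r + 1) * Q.width
    · simp only [hle, true_and]
      refine (measureReal_iterates_ne_le P Q.prob hW hκ hg1 hg hA X₀ r v
        (Nat.lt_succ_iff.1 (Finset.mem_range.1 hs))).trans ?_
      have hW' : (0 : ℝ) < Q.width := by exact_mod_cast hW
      have h1 : (s : ℝ) / Q.width - r ≤ 1 - Q.life := by
        have : ((s + Q.life * Q.width : ℕ) : ℝ) ≤ ((r + 1) * Q.width : ℕ) := by exact_mod_cast hle
        push_cast at this
        rw [_root_.sub_le_iff_le_add, div_le_iff₀ hW']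
        linarith
      gcongr
      exact hgΓ v
    · simp only [hle, false_and, Set.ofPred_false, measureReal_empty]
      positivity
  obtain ⟨F, hF⟩ := exists_run_simulation_eq prot P X₀ T
  have hD := measurable_sampledSlots P X₀ T Q.slots Q.prob
  have hmap := map_sampledSlots P X₀ T Q.slots Q.prob
  refine tvDist_le_of_forall_test fun φ hφ => ?_
  have hE : MeasurableSet (E1 ∪ E2 ∪ E3) := Set.Finite.measurableSet (Set.toFinite _)
  have hFm : Measurable F := measurable_of_finite F
  have hSm : Measurable fun ω : SlotSpace G q Q.slots => slotState X₀ ω Q.slots :=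
    measurable_of_finite _
  have e1 : ∑ σ, (simulation prot : CongestAlgorithm V q B).outputLaw P X₀ T σ * φ σ =
      ∫ bits, φ (F (sampledSlots P X₀ T Q.slots Q.prob bits)) ∂(infinitePi fun _ : V =>
        coinMeasure) := by
    rw [integral_comp_eq_sum (X := fun bits => F (sampledSlots P X₀ T Q.slots Q.prob bits))
      (hFm.comp hD).aemeasurable]
    have hF' : (simulation prot : CongestAlgorithm V q B).run P X₀ T = fun bits =>
        F (sampledSlots P X₀ T Q.slots Q.prob bits) := funext hF
    unfold CongestAlgorithm.outputLaw
    rw [hF']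
  have e2 : ∫ ω, φ (slotState X₀ ω Q.slots) ∂μ = ∫ bits, φ (slotState X₀
      (sampledSlots P X₀ T Q.slots Q.prob bits) Q.slots) ∂(infinitePi fun _ : V =>
        coinMeasure) := by
    rw [hμ, ← hmap]
    exact integral_map hD.aemeasurable
      (measurable_of_finite fun ω : SlotSpace G q Q.slots =>
        φ (slotState X₀ ω Q.slots)).aestronglyMeasurable
  have e3 := integral_sub_integral_le_of_ne_subset (μ := infinitePi fun _ : V => coinMeasure)
    (hFm.comp hD) (hSm.comp hD) (hD hE) (fun bits hbits => by
      simp only [Set.mem_preimage, Set.mem_union, not_or] at hbits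
      obtain ⟨⟨n1, n2⟩, n3⟩ := hbits
      change F _ = slotState X₀ _ _
      rw [← hF]
      refine run_simulation_eq_slotState prot P X₀ T bits hmarks hrings hiter rfl ?_ ?_ ?_
      · intro v
        by_contra h
        refine n1 ⟨v, Finset.mem_univ v, ?_⟩
        rw [zero_add]
        exact not_le.1 h
      · intro v r hr
        by_contra h
        refine n2 ⟨v, Finset.mem_univ v, r, Finset.mem_range.2 hr, ?_⟩
        have : (r - Q.life) * Q.width + min r Q.life * Q.width = r * Q.width := by
          rw [← add_mul]
          congr 1
          omega
        rw [this]
        exact not_le.1 h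
      · intro v r hr s hs hle
        by_contra h
        exact n3 ⟨v, Finset.mem_univ v, r, Finset.mem_range.2 (Nat.lt_succ_of_le hr), s,
          Finset.mem_range.2 (Nat.lt_succ_of_le hs), hle, h⟩) hφ
  have e4 : (infinitePi fun _ : V => coinMeasure).real
      (sampledSlots P X₀ T Q.slots Q.prob ⁻¹' (E1 ∪ E2 ∪ E3)) = μ.real (E1 ∪ E2 ∪ E3) := by
    rw [hμ, ← hmap, map_measureReal_apply hD hE]
  have e5 := abs_le.1 (abs_integral_slotState_sub_chainMean_le (S := Q.slots) P Q.prob hp hφ X₀)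
  have e6 := measureReal_union_le (μ := μ) (E1 ∪ E2) E3
  have e7 := measureReal_union_le (μ := μ) E1 E2
  rw [e1, sum_chainLaw_mul]
  simp only [Function.comp_apply] at e3
  rw [e4, ← e2] at e3
  rw [hT] at e5
  have e8 := e5.2
  linarith

end ErrorAnalysis

/-! ### Encodings -/

section Encodings

/-- A set that is not larger than `β` has an injective encoding in `β`. -/
theorem exists_encoding {α β : Type*} [Finite α] [Finite β] [Nonempty α] [Nonempty β] (s : Set α)
    (h : Nat.card s ≤ Nat.card β) : ∃ (enc : α → β) (dec : β → α), ∀ x ∈ s, dec (enc x) = x := by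
  classical
  have := Fintype.ofFinite α
  have := Fintype.ofFinite β
  rw [Nat.card_eq_fintype_card, Nat.card_eq_fintype_card] at h
  obtain ⟨f⟩ := Function.Embedding.nonempty_of_card_le h
  have hinj : Set.InjOn (fun x => if hx : x ∈ s then f ⟨x, hx⟩ else Classical.arbitrary β) s := by
    intro x hx y hy hxy
    simp only [dif_pos hx, dif_pos hy] at hxy
    exact congrArg Subtype.val (f.injective hxy)
  exact ⟨_, Function.invFunOn _ s, hinj.leftInvOn_invFunOn⟩

/-- Few rings in `S` slots can be encoded by listing their positions. -/
theorem exists_ring_encoding {S N B R : ℕ} (h : (S + 1) ^ N ≤ 2 ^ (B * R)) :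
    ∃ (enc : (Fin S → Bool) → Fin R → Msg B) (dec : (Fin R → Msg B) → Fin S → Bool),
      ∀ x : Fin S → Bool, ringCount (fun s => if h : s < S then x ⟨s, h⟩ else false) 0 S ≤ N →
        dec (enc x) = x := by
  classical
  let Φ : (Fin N → Option (Fin S)) → Fin S → Bool := fun y s => decide (∃ i, y i = some s)
  have hcard : Nat.card (Set.range Φ) ≤ Nat.card (Fin R → Msg B) := by
    refine (Finite.card_range_le Φ).trans ?_
    simpa [← pow_mul, mul_comm] using h
  obtain ⟨enc, dec, hed⟩ := exists_encoding (Set.range Φ) hcard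
  refine ⟨enc, dec, fun x hx => hed x ?_⟩
  set l := (Finset.univ.filter fun s => x s = true).toList with hl
  have hlen : l.length ≤ N := by
    rw [hl, Finset.length_toList]
    refine le_trans (Finset.card_le_card_of_injOn (fun s : Fin S => (s : ℕ)) ?_
      (Fin.val_injective.injOn)) hx
    intro s hs
    simpa using hs
  refine ⟨fun i => l[(i : ℕ)]?, funext fun s => ?_⟩
  have h1 : (∃ i : Fin N, l[(i : ℕ)]? = some s) ↔ x s = true := by
    rw [show x s = true ↔ s ∈ l by simp [hl], List.mem_iff_getElem?]
    constructor
    · rintro ⟨i, hi⟩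
      exact ⟨i, hi⟩
    · rintro ⟨i, hi⟩
      obtain ⟨hi', -⟩ := List.getElem?_eq_some_iff.1 hi
      exact ⟨⟨i, by omega⟩, hi⟩
  simp [Φ, h1]

theorem exists_mark_encoding {q : ℕ} [NeZero q] (m : ℕ) :
    ∃ (enc : (Fin (m + 1) → Fin q) → Msg ((m + 1) * Nat.clog 2 q))
      (dec : Msg ((m + 1) * Nat.clog 2 q) → Fin (m + 1) → Fin q), ∀ c, dec (enc c) = c := by
  have h : q ^ (m + 1) ≤ 2 ^ ((m + 1) * Nat.clog 2 q) := by
    rw [mul_comm, pow_mul]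
    exact Nat.pow_le_pow_left (Nat.le_pow_clog one_lt_two q) _
  obtain ⟨enc, dec, hed⟩ := exists_encoding (α := Fin (m + 1) → Fin q)
    (β := Msg ((m + 1) * Nat.clog 2 q)) Set.univ (by simpa using h)
  exact ⟨enc, dec, fun c => hed c trivial⟩

end Encodings

/-! ### Choice of the parameters -/

section Parameters

theorem half_le_log {n : ℕ} (hn : 2 ≤ n) : 1 / 2 ≤ Real.log n := by
  have h1 : Real.log 2 ≤ Real.log n :=
    Real.log_le_log two_pos (by exact_mod_cast hn)
  linarith [Real.log_two_gt_d9]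

/-- With the parameters of the algorithm all four contributions to the error are at most
`exp (-(e₁ + 2) * ℓ)`, where `ℓ` is the logarithm of the number `x` of vertices. -/
theorem error_terms_le {x ℓ T e₀ e₁ α a k m L N R W S : ℝ} (hx : x = Real.exp ℓ)
    (hℓ : 1 / 2 ≤ ℓ) (he₀ : 0 ≤ e₀) (he₁ : 0 ≤ e₁) (hα : 0 ≤ α) (ha : a = e₀ + α + e₁ + 8)
    (hk : k = e₀ + α + 2 * a + 4) (hS : S = Real.exp (k * ℓ)) (hT : 0 < T)
    (hTe : T ≤ Real.exp (e₀ * ℓ)) (hx2 : 2 ≤ x) (hm : 4 * ℓ ≤ m) (hL1 : 8 * ℓ ≤ L)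
    (hL2 : L ≤ 8 * ℓ + 1) (hN : (e₁ + 4) * ℓ + 3 * T ≤ N) (_ : 0 ≤ R) (hR : R + 1 ≤ x * S)
    (hS1 : S + 1 ≤ x * S) (hW : T / S * W * Real.exp a ≤ 1 / 4) :
    x * (Real.exp (-(N + 1)) * Real.exp (T * Real.exp 1)) +
      x * (R * (Real.exp (-(a * (m + 1))) * Real.exp (L * W * (T / S) * Real.exp a))) +
      x * ((R + 1) * ((S + 1) * (2 * x ^ 2 * Real.exp (a * (1 - L))))) +
      3 * S * (x * (T / S)) ^ 2 ≤ Real.exp (-e₁ * ℓ) := by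
  have ha0 : 0 ≤ a := by linarith
  have hS0 : 0 < S := hS ▸ Real.exp_pos _
  have hx0 : 0 < x := by linarith
  have hx2' : x ^ 2 = Real.exp (2 * ℓ) := by rw [hx, ← Real.exp_nat_mul]; norm_num
  have hfour : 4 ≤ Real.exp (2 * ℓ) := by rw [← hx2']; nlinarith
  have hexp : ∀ c : ℝ, c ≤ -(e₁ + 2) → Real.exp (c * ℓ) ≤ Real.exp (-(e₁ + 2) * ℓ) :=
    fun c hc => Real.exp_le_exp.2 (mul_le_mul_of_nonneg_right hc (by linarith))
  have hxS : x * S = Real.exp ((k + 1) * ℓ) := by rw [hx, hS, ← Real.exp_add]; ring_nf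
  rw [hxS] at hR hS1
  have t1 : x * (Real.exp (-(N + 1)) * Real.exp (T * Real.exp 1)) ≤
      Real.exp (-(e₁ + 2) * ℓ) := by
    rw [hx, ← Real.exp_add, ← Real.exp_add]
    refine Real.exp_le_exp.2 ?_
    have : T * Real.exp 1 ≤ T * 3 :=
      mul_le_mul_of_nonneg_left (by linarith [Real.exp_one_lt_d9]) hT.le
    linarith
  have t2 : x * (R * (Real.exp (-(a * (m + 1))) * Real.exp (L * W * (T / S) * Real.exp a))) ≤
      Real.exp (-(e₁ + 2) * ℓ) := by
    have h1 : L * W * (T / S) * Real.exp a ≤ 2 * ℓ + 1 := by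
      calc L * W * (T / S) * Real.exp a = L * (T / S * W * Real.exp a) := by ring
        _ ≤ L * (1 / 4) := mul_le_mul_of_nonneg_left hW (by linarith)
        _ ≤ _ := by linarith
    have h2 : -(a * (m + 1)) ≤ -4 * a * ℓ := by
      have : a * (4 * ℓ) ≤ a * (m + 1) := mul_le_mul_of_nonneg_left (by linarith) ha0
      linarith
    calc x * (R * (Real.exp (-(a * (m + 1))) * Real.exp (L * W * (T / S) * Real.exp a)))
        ≤ Real.exp ℓ * (Real.exp ((k + 1) * ℓ) * (Real.exp (-4 * a * ℓ) *
          Real.exp (2 * ℓ + 1))) := by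
          rw [hx]
          gcongr
          linarith
      _ = Real.exp ((k - 4 * a + 4) * ℓ + 1) := by
          simp only [← Real.exp_add]
          ring_nf
      _ ≤ Real.exp ((k - 4 * a + 6) * ℓ) := Real.exp_le_exp.2 (by linarith)
      _ ≤ _ := hexp _ (by linarith)
  have t3 : x * ((R + 1) * ((S + 1) * (2 * x ^ 2 * Real.exp (a * (1 - L))))) ≤
      Real.exp (-(e₁ + 2) * ℓ) := by
    have h1 : a * (1 - L) ≤ -6 * a * ℓ := by
      have : a * (6 * ℓ) ≤ a * (L - 1) := mul_le_mul_of_nonneg_left (by linarith) ha0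
      linarith
    calc x * ((R + 1) * ((S + 1) * (2 * x ^ 2 * Real.exp (a * (1 - L)))))
        ≤ x * (Real.exp ((k + 1) * ℓ) * (Real.exp ((k + 1) * ℓ) * (x * x ^ 2 *
          Real.exp (-6 * a * ℓ)))) := by gcongr
      _ = Real.exp ((2 * k + 6 - 6 * a) * ℓ) := by
          rw [hx2', hx]
          simp only [← Real.exp_add]
          ring_nf
      _ ≤ _ := hexp _ (by linarith)
  have t4 : 3 * S * (x * (T / S)) ^ 2 ≤ Real.exp (-(e₁ + 2) * ℓ) := by
    calc 3 * S * (x * (T / S)) ^ 2 = 3 * x ^ 2 * T ^ 2 / S := by field_simp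
      _ ≤ Real.exp (2 * ℓ) * x ^ 2 * Real.exp (e₀ * ℓ) ^ 2 / S := by
          gcongr
          linarith
      _ = Real.exp ((4 + 2 * e₀ - k) * ℓ) := by
          rw [hx2', hS, ← Real.exp_nat_mul, ← Real.exp_add, ← Real.exp_add, ← Real.exp_sub]
          push_cast
          ring_nf
      _ ≤ _ := hexp _ (by linarith)
  have t5 : 4 * Real.exp (-(e₁ + 2) * ℓ) ≤ Real.exp (-e₁ * ℓ) := by
    calc 4 * Real.exp (-(e₁ + 2) * ℓ) ≤ Real.exp (2 * ℓ) * Real.exp (-(e₁ + 2) * ℓ) := by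
          gcongr
      _ = _ := by rw [← Real.exp_add]; ring_nf
  linarith

/-- The parameters of the algorithm, `N` being the maximal number of rings of one clock. With
`n ^ k` slots, windows of `W` slots and `R` iterations all errors are polynomially small. The
weights `g` of the contraction are bounded by `2 * n ^ 2`. -/
theorem exists_parameters {n e₀ e₁ α : ℕ} (hn : 2 ≤ n) {A T : ℝ} (hA4 : 4 ≤ A) (hA : A ≤ 2 ^ α)
    (hT : 0 < T) (hTn : T ≤ (n : ℝ) ^ e₀) {a k m L S : ℕ} (ha : a = e₀ + α + e₁ + 8)
    (hk : k = e₀ + α + 2 * a + 4) (hm : m = ⌈4 * Real.log n⌉₊) (hL : L = ⌈8 * Real.log n⌉₊)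
    (hS : S = n ^ k) :
    n * (T / S) ≤ 1 ∧ ∃ N W R : ℕ, 0 < W ∧ T / S * A * Real.exp a * W ≤ a ∧
      S + L * W ≤ (R + 1) * W ∧ N ≤ (e₁ + 6) * Real.log n + 3 * T ∧
      R ≤ 2 * A * Real.exp a * T + 12 * Real.log n ∧
      n * (Real.exp (-(N + 1)) * Real.exp (T * Real.exp 1)) +
      n * (R * (Real.exp (-(a * (m + 1))) * Real.exp (L * W * (T / S) * Real.exp a))) +
      n * ((R + 1) * ((S + 1) * (2 * n ^ 2 * Real.exp (a * (1 - L))))) +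
      3 * S * (n * (T / S)) ^ 2 ≤ ((n : ℝ) ^ e₁)⁻¹ := by
  have hℓ2 : 1 / 2 ≤ Real.log n := half_le_log hn
  have hn1 : (n : ℝ) = Real.exp (Real.log n) :=
    (Real.exp_log (by exact_mod_cast (by omega : 0 < n))).symm
  have hℓn : Real.log n ≤ n - 1 := Real.log_le_sub_one_of_pos (by
    exact_mod_cast (by omega : 0 < n))
  generalize Real.log n = ℓ at *
  have hn0 : (0 : ℝ) < n := by exact_mod_cast (by omega : 0 < n)
  have hn2 : (2 : ℝ) ≤ n := by exact_mod_cast hn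
  have hpow : ∀ j : ℕ, (n : ℝ) ^ j = Real.exp (j * ℓ) := fun j => by
    rw [Real.exp_nat_mul, ← hn1]
  have hSr : (S : ℝ) = Real.exp (k * ℓ) := by rw [hS, ← hpow]; push_cast; rfl
  have hS0 : (0 : ℝ) < S := hSr ▸ Real.exp_pos _
  have haR : (a : ℝ) = e₀ + α + e₁ + 8 := by rw [ha]; push_cast; ring
  have hkR : (k : ℝ) = e₀ + α + 2 * a + 4 := by rw [hk]; push_cast; ring
  have he₀ : (0 : ℝ) ≤ e₀ := Nat.cast_nonneg _
  have he₁ : (0 : ℝ) ≤ e₁ := Nat.cast_nonneg _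
  have hα : (0 : ℝ) ≤ α := Nat.cast_nonneg _
  have hea : Real.exp a ≤ Real.exp (2 * a * ℓ) := Real.exp_le_exp.2 (by
    have := mul_le_mul_of_nonneg_left hℓ2 (Nat.cast_nonneg (α := ℝ) a)
    linarith)
  have hAe : A ≤ Real.exp (α * ℓ) := by
    rw [← hpow]
    exact hA.trans (pow_le_pow_left₀ two_pos.le hn2 α)
  have hTe : T ≤ Real.exp (e₀ * ℓ) := by rwa [← hpow]
  have hp0 : 0 < T / S := by positivity
  have hA0 : 0 < A := by linarith
  -- `A * exp a * w = 1` is what the contraction with rate `a` per window needs;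
  -- the expected number of rings of one clock in a window is at most `w`
  set w : ℝ := (A * Real.exp a)⁻¹ with hw
  have hw0 : 0 < w := by positivity
  have hwS : 1 ≤ w * S / T := by
    rw [hw, le_div_iff₀ hT, one_mul, ← div_eq_inv_mul, le_div_iff₀ (by positivity), hSr]
    calc T * (A * Real.exp a) ≤ Real.exp (e₀ * ℓ) * (Real.exp (α * ℓ) * Real.exp (2 * a * ℓ)) := by
          gcongr
      _ = Real.exp ((e₀ + α + 2 * a) * ℓ) := by rw [← Real.exp_add, ← Real.exp_add]; ring_nf
      _ ≤ Real.exp (k * ℓ) := Real.exp_le_exp.2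
          (mul_le_mul_of_nonneg_right (by linarith) (by linarith))
  set W := ⌊w * S / T⌋₊ with hWdef
  have hW1 : 1 ≤ W := Nat.le_floor (by exact_mod_cast hwS)
  have hWle : (W : ℝ) ≤ w * S / T := Nat.floor_le (by positivity)
  have hW1' : (1 : ℝ) ≤ W := by exact_mod_cast hW1
  have hWge : w * S / T ≤ 2 * W := by
    have := Nat.lt_floor_add_one (w * S / T)
    rw [← hWdef] at this
    linarith
  have hpW : T / S * W ≤ w := by
    calc T / S * W ≤ T / S * (w * S / T) := by gcongr
      _ = w := by field_simp
  have hwA : w * A * Real.exp a = 1 := by rw [hw]; field_simp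
  have hwe : w * Real.exp a ≤ 1 / 4 := by
    have : w * Real.exp a * A = 1 := by rw [← hwA]; ring
    have h0 : w * Real.exp a * 4 ≤ w * Real.exp a * A :=
      mul_le_mul_of_nonneg_left hA4 (by positivity)
    linarith
  have hL1 : 8 * ℓ ≤ L := by rw [hL]; exact Nat.le_ceil _
  have hL2 : (L : ℝ) ≤ 8 * ℓ + 1 := by
    rw [hL]; exact (Nat.ceil_lt_add_one (by linarith)).le
  have hm1 : 4 * ℓ ≤ m := by rw [hm]; exact Nat.le_ceil _
  set N := ⌈(e₁ + 4) * ℓ + 3 * T⌉₊ with hN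
  have hN1 : (e₁ + 4) * ℓ + 3 * T ≤ N := Nat.le_ceil _
  have hN2 : (N : ℝ) ≤ (e₁ + 4) * ℓ + 3 * T + 1 :=
    (Nat.ceil_lt_add_one (by positivity)).le
  set R := ⌈(S : ℝ) / W⌉₊ + L with hR
  have hR1 : (R : ℝ) ≤ S / W + 1 + L := by
    rw [hR]
    push_cast
    linarith [(Nat.ceil_lt_add_one (show (0 : ℝ) ≤ S / W by positivity)).le]
  have hSW : (S : ℝ) / W ≤ S := div_le_self hS0.le hW1'
  have hk4 : 4 ≤ (k : ℝ) := by rw [hkR]; linarith [(Nat.cast_nonneg a : (0 : ℝ) ≤ a)]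
  have h8n : 8 * (n : ℝ) ≤ S := by
    have h1 : (n : ℝ) ^ 4 ≤ S := by
      rw [hS]
      push_cast
      exact pow_le_pow_right₀ (by linarith) (by omega)
    have h2 : (2 : ℝ) ^ 3 * n ≤ (n : ℝ) ^ 3 * n :=
      mul_le_mul_of_nonneg_right (pow_le_pow_left₀ two_pos.le hn2 3) hn0.le
    linarith
  have h2S : 2 * (S : ℝ) ≤ n * S := mul_le_mul_of_nonneg_right hn2 hS0.le
  have hS1 : (S : ℝ) + 1 ≤ n * S := by linarith
  have hR2 : (R : ℝ) + 1 ≤ n * S := by linarith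
  refine ⟨?_, N, W, R, hW1, ?_, ?_, ?_, ?_, ?_⟩
  · rw [← mul_div_assoc, div_le_one hS0, hSr]
    calc n * T ≤ Real.exp ℓ * Real.exp (e₀ * ℓ) := by rw [← hn1]; gcongr
      _ = Real.exp ((1 + e₀) * ℓ) := by rw [← Real.exp_add]; ring_nf
      _ ≤ Real.exp (k * ℓ) := Real.exp_le_exp.2
          (mul_le_mul_of_nonneg_right (by linarith) (by linarith))
  · calc T / S * A * Real.exp a * W = T / S * W * (A * Real.exp a) := by ring
      _ ≤ w * (A * Real.exp a) := by gcongr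
      _ = 1 := by rw [← hwA]; ring
      _ ≤ a := by rw [haR]; linarith
  · have h1 : (S : ℝ) ≤ ⌈(S : ℝ) / W⌉₊ * W := by
      rw [← div_le_iff₀ (by linarith)]
      exact Nat.le_ceil _
    have h2 : S ≤ ⌈(S : ℝ) / W⌉₊ * W := by exact_mod_cast h1
    rw [hR, add_mul, add_mul]
    omega
  · linarith
  · have h1 : (S : ℝ) / W ≤ 2 * A * Real.exp a * T := by
      rw [div_le_iff₀ (by linarith)]
      have h2 : w * S ≤ 2 * W * T := by rwa [div_le_iff₀ hT] at hWge
      calc (S : ℝ) = w * S * (A * Real.exp a) := by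
            rw [mul_right_comm, ← mul_assoc w, hwA, one_mul]
        _ ≤ 2 * W * T * (A * Real.exp a) := by gcongr
        _ = _ := by ring
    linarith
  · have := error_terms_le (W := W) hn1 hℓ2 he₀ he₁ hα haR hkR hSr hT hTe hn2 hm1 hL1 hL2 hN1
      (Nat.cast_nonneg R) hR2 hS1 ((mul_le_mul_of_nonneg_right hpW (Real.exp_pos _).le).trans hwe)
    refine this.trans (le_of_eq ?_)
    rw [hpow, ← Real.exp_neg, neg_mul]

/-- The messages have at most `24 * log n * log q` bits. -/
theorem card_marks_mul_clog_le {n q : ℕ} (hn : 2 ≤ n) (hq : 2 ≤ q) :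
    (((⌈4 * Real.log n⌉₊ + 1) * Nat.clog 2 q : ℕ) : ℝ) ≤ 24 * (Real.log n * Real.log q) := by
  have h1 := half_le_log hn
  have h2 := half_le_log hq
  -- `m + 1 ≤ 8 * log n`, and rounding up `log₂ q` costs a constant factor since `q ≥ 2`
  have h3 : ((⌈4 * Real.log n⌉₊ : ℕ) : ℝ) ≤ 4 * Real.log n + 1 :=
    (Nat.ceil_lt_add_one (by linarith)).le
  have h4 : (Nat.clog 2 q : ℝ) ≤ 3 * Real.log q := by
    have h5 : 2 ^ (Nat.clog 2 q - 1) < q := Nat.pow_pred_clog_lt_self one_lt_two (by omega)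
    have h6 : (Nat.clog 2 q - 1 : ℕ) * Real.log 2 ≤ Real.log q := by
      rw [← Real.log_pow]
      exact Real.log_le_log (by positivity) (by exact_mod_cast h5.le)
    have h7 : 0 < Nat.clog 2 q := Nat.clog_pos one_lt_two hq
    rw [Nat.cast_sub h7] at h6
    have h8 : Real.log 2 ≤ Real.log q := Real.log_le_log two_pos (by exact_mod_cast hq)
    push_cast at h6
    nlinarith [Real.log_two_gt_d9]
  push_cast
  calc (((⌈4 * Real.log n⌉₊ : ℕ) : ℝ) + 1) * Nat.clog 2 q
      ≤ (8 * Real.log n) * (3 * Real.log q) := by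
        gcongr
        linarith
    _ = _ := by ring

/-- One message has room for the name of a vertex. -/
theorem le_two_pow_marks_mul_clog {n q : ℕ} (hn : 2 ≤ n) (hq : 2 ≤ q) :
    n ≤ 2 ^ ((⌈4 * Real.log n⌉₊ + 1) * Nat.clog 2 q) := by
  have h7 : 0 < Nat.clog 2 q := Nat.clog_pos one_lt_two hq
  have hn0 : (0 : ℝ) < n := by exact_mod_cast (by omega : 0 < n)
  refine le_trans ?_ (Nat.pow_le_pow_right two_pos (show ⌈4 * Real.log n⌉₊ ≤ _ by nlinarith))
  have h1 : 4 * Real.log n ≤ ⌈4 * Real.log n⌉₊ := Nat.le_ceil _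
  have h : (n : ℝ) ≤ 2 ^ ⌈4 * Real.log n⌉₊ := by
    rw [← Real.log_le_log_iff hn0 (by positivity), Real.log_pow]
    nlinarith [Real.log_two_gt_d9, half_le_log hn]
  exact_mod_cast h

end Parameters

/-! ### The algorithm with its parameters -/

section Conclusion

/-- The algorithm without communication that returns the initial configuration. -/
noncomputable def idleAlgorithm (V : Type*) (q : ℕ) : CongestAlgorithm V q 0 where
  rounds _ := 0
  send _ _ _ _ := fun _ => false
  output inp _ _ := inp.spin
  measurable_send _ _ _ := measurable_const
  measurable_output _ _ := measurable_const

theorem tvDist_idleAlgorithm_le {V : Type*} [Fintype V] [DecidableEq V] {q : ℕ}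
    {G : SimpleGraph V} (P : LocalRule G q) (X₀ : V → Fin q) (T : ℝ) :
    tvDist ((idleAlgorithm V q).outputLaw P X₀ T) (chainLaw P X₀ T) ≤ 1 := by
  refine tvDist_le_of_forall_test fun φ hφ => ?_
  have h1 : ∑ σ, (idleAlgorithm V q).outputLaw P X₀ T σ * φ σ = φ X₀ := by
    have := integral_comp_eq_sum (μ := Measure.infinitePi fun _ : V => coinMeasure)
      (X := fun _ => X₀) aemeasurable_const φ
    rw [integral_const, probReal_univ, one_smul] at this
    exact this.symm
  rw [h1, sum_chainLaw_mul]
  have h2 := abs_le.1 (hφ X₀)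
  have h3 := abs_le.1 (abs_chainMean_le P hφ T X₀)
  linarith

/-- The simulation with the chosen parameters has all required properties if there are at least two
vertices. -/
theorem exists_simulation {c₀ c₁ C : ℝ} {e₀ e₁ α : ℕ} (h₀ : c₀ ≤ e₀) (h₁ : c₁ ≤ e₁) (hC : 1 ≤ C)
    (hα : 4 * C ≤ 2 ^ α) {a k : ℕ} (ha : a = e₀ + α + e₁ + 8) (hk : k = e₀ + α + 2 * a + 4)
    {V : Type*} [Fintype V] [DecidableEq V] {q : ℕ} (hq : 2 ≤ q) (hn : 2 ≤ Fintype.card V) :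
    ∃ A : CongestAlgorithm V q ((⌈4 * Real.log (Fintype.card V)⌉₊ + 1) * Nat.clog 2 q),
      ∀ (G : SimpleGraph V) (P : LocalRule G q), DobrushinCond P C →
      ∀ (X₀ : V → Fin q) (T : ℝ), 0 < T → T ≤ (Fintype.card V : ℝ) ^ c₀ →
        (A.rounds T : ℝ) ≤ ((k + 1) * (e₁ + 9) + 2 * (4 * C) * Real.exp a + 12) *
          (T + Real.log (Fintype.card V)) ∧
        tvDist (A.outputLaw P X₀ T) (chainLaw P X₀ T) ≤ (Fintype.card V : ℝ) ^ (-c₁) := by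
  have : NeZero q := ⟨by omega⟩
  set n := Fintype.card V with hnV
  set m := ⌈4 * Real.log n⌉₊ with hm
  set B := (m + 1) * Nat.clog 2 q with hB
  have hn1 : (1 : ℝ) ≤ n := by exact_mod_cast (by omega : 1 ≤ n)
  have hlog := half_le_log hn
  have hTn : ∀ T : ℝ, T ≤ (n : ℝ) ^ c₀ → T ≤ (n : ℝ) ^ e₀ := fun T hT =>
    hT.trans (by rw [← Real.rpow_natCast]; exact Real.rpow_le_rpow_of_exponent_le hn1 h₀)
  have key : ∀ T : ℝ, ∃ Q : Protocol q B, 0 < T → T ≤ (n : ℝ) ^ c₀ →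
      ((Q.ringRounds + Q.iterRounds : ℕ) : ℝ) ≤ ((k + 1) * (e₁ + 9) +
        2 * (4 * C) * Real.exp a + 12) * (T + Real.log n) ∧
      ∀ prot : ℝ → Protocol q B, prot T = Q → ∀ (G : SimpleGraph V) (P : LocalRule G q),
        DobrushinCond P C → ∀ X₀ : V → Fin q,
          tvDist ((simulation prot : CongestAlgorithm V q B).outputLaw P X₀ T)
            (chainLaw P X₀ T) ≤ ((n : ℝ) ^ e₁)⁻¹ := by
    intro T
    by_cases hT : 0 < T ∧ T ≤ (n : ℝ) ^ c₀
    swap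
    -- for other horizons nothing is required
    · exact ⟨⟨0, 0, 0, 0, 0, 0, 0, fun _ _ _ => false, fun _ _ => false, fun _ _ => false,
        fun _ _ => 0⟩, fun h0 h1 => absurd ⟨h0, h1⟩ hT⟩
    obtain ⟨hT0, hT1⟩ := hT
    obtain ⟨hp, N, W, R, hW, hκ, hiter, hN, hR, herr⟩ := exists_parameters hn
      (by linarith : 4 ≤ 4 * C) hα hT0 (hTn T hT1) ha hk hm rfl rfl
    set S := n ^ k with hS
    set L := ⌈8 * Real.log n⌉₊ with hL
    have hS0 : 0 < S := pow_pos (by omega) _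
    have hp0 : 0 ≤ T / S := by positivity
    have hp1 : T / S ≤ 1 := by nlinarith
    have hcode : (S + 1) ^ N ≤ 2 ^ (B * (N * (k + 1))) := by
      have h1 : S + 1 ≤ n ^ (k + 1) := by rw [pow_succ]; nlinarith
      calc (S + 1) ^ N ≤ (n ^ (k + 1)) ^ N := Nat.pow_le_pow_left h1 _
        _ = n ^ (N * (k + 1)) := by rw [← pow_mul, mul_comm]
        _ ≤ (2 ^ B) ^ (N * (k + 1)) := Nat.pow_le_pow_left (le_two_pow_marks_mul_clog hn hq) _
        _ = _ := by rw [← pow_mul]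
    obtain ⟨encR, decR, hrings⟩ := exists_ring_encoding hcode
    obtain ⟨encM, decM, hmarks⟩ := exists_mark_encoding (q := q) m
    refine ⟨⟨S, ⟨T / S, hp0, hp1⟩, W, L, m, N * (k + 1), R, encR, decR, encM, decM⟩,
      fun _ _ => ⟨?_, fun prot hprot G P hP X₀ => ?_⟩⟩
    · push_cast
      have h1 : (N : ℝ) * (k + 1) ≤ ((e₁ + 6) * Real.log n + 3 * T) * (k + 1) := by gcongr
      have h2 : (0 : ℝ) ≤ (e₁ + 6) * T * (k + 1) + 3 * Real.log n * (k + 1) +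
        2 * (4 * C) * Real.exp a * Real.log n + 12 * T := by positivity
      linarith
    · obtain ⟨x, hx, hPx⟩ := hP
      obtain ⟨g, hg1, hg2, hg⟩ := exists_weight hx (influenceMatrix_nonneg P) (by linarith) hPx
      have := tvDist_outputLaw_simulation_le prot P X₀ T (N := N) (A := 2 * C) (κ := a)
        (Γ := 2 * n ^ 2) (g := g)
      rw [hprot] at this
      refine (this hmarks hrings hiter (mul_div_cancel₀ _ (by positivity)) hp hW
        (Nat.cast_nonneg a) hg1 hg2 hg (le_trans (le_of_eq (by ring)) hκ)).trans herr
  choose prot hprot using key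
  refine ⟨simulation prot, fun G P hP X₀ T hT0 hT1 => ?_⟩
  obtain ⟨h1, h2⟩ := hprot T hT0 hT1
  refine ⟨h1, (h2 prot rfl G P hP X₀).trans ?_⟩
  rw [← Real.rpow_natCast, ← Real.rpow_neg (by linarith)]
  exact Real.rpow_le_rpow_of_exponent_le hn1 (neg_le_neg h₁)

end Conclusion

/-- `c₀, c₁` are arbitrary positive constants and `C` is the constant of the Dobrushin-type
condition. The message constant depends only on `c₁`, the round constant on `c₀, c₁, C`. The
algorithm is uniform: each node knows only `V`, `q` and its own local input. -/
theorem theorem4p4 :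
    ∀ c₁ : ℝ, 0 < c₁ → ∃ K_msg : ℝ, ∀ c₀ : ℝ, 0 < c₀ → ∀ C : ℝ, ∃ K_rounds : ℝ,
      ∀ (V : Type*) [Fintype V] [DecidableEq V] (q : ℕ), 2 ≤ q →
        ∃ B : ℕ, (B : ℝ) ≤ K_msg * (Real.log (Fintype.card V) * Real.log q) ∧
        ∃ A : CongestAlgorithm V q B,
          ∀ (G : SimpleGraph V) (P : LocalRule G q), DobrushinCond P C →
          ∀ (X₀ : V → Fin q) (T : ℝ), 0 < T → T ≤ (Fintype.card V : ℝ) ^ c₀ →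
            (A.rounds T : ℝ) ≤ K_rounds * (T + Real.log (Fintype.card V)) ∧
            tvDist (A.outputLaw P X₀ T) (chainLaw P X₀ T) ≤ (Fintype.card V : ℝ) ^ (-c₁) := by
  intro c₁ _
  refine ⟨24, fun c₀ hc₀ C => ?_⟩
  obtain ⟨e₀, h₀⟩ := exists_nat_ge c₀
  obtain ⟨e₁, h₁⟩ := exists_nat_ge c₁
  obtain ⟨α, hα⟩ := pow_unbounded_of_one_lt (4 * max C 1) one_lt_two
  have hC : 1 ≤ max C 1 := le_max_right _ _
  refine ⟨((e₀ + α + 2 * (e₀ + α + e₁ + 8 : ℕ) + 4 : ℕ) + 1) * (e₁ + 9) +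
    2 * (4 * max C 1) * Real.exp (e₀ + α + e₁ + 8 : ℕ) + 12, fun V _ _ q hq => ?_⟩
  rcases Nat.lt_or_ge (Fintype.card V) 2 with hn | hn
  -- for a single vertex no communication is allowed, but the required distance is `1`;
  -- without vertices there is no horizon `0 < T ≤ 0 ^ c₀ = 0`
  · refine ⟨0, ?_, idleAlgorithm V q, fun G P _ X₀ T hT hTn => ?_⟩
    · interval_cases Fintype.card V <;> simp
    · interval_cases hV : Fintype.card V
      · rw [Nat.cast_zero, Real.zero_rpow hc₀.ne'] at hTn
        exact absurd hTn (not_le.2 hT)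
      · refine ⟨?_, ?_⟩
        · simp only [idleAlgorithm, Nat.cast_zero, Nat.cast_one, Real.log_one, add_zero]
          positivity
        · rw [Nat.cast_one, Real.one_rpow]
          exact tvDist_idleAlgorithm_le P X₀ T
  · obtain ⟨A, hA⟩ := exists_simulation (C := max C 1) h₀ h₁ hC hα.le rfl rfl hq hn (V := V)
    refine ⟨_, card_marks_mul_clog_le hn hq, A, fun G P ⟨p, hp, hP⟩ => ?_⟩
    exact hA G P ⟨p, hp, hP.trans (le_max_left _ _)⟩
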